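/- Let $\Omega\subset\mathbb C$ be a bounded domain whose boundary $b\Omega$ consists of finitely many pairwise disjoint $C^\infty$ smooth (regular) simple closed curves, and let $\varphi$ be a positive real-valued $C^\infty$ function on $b\Omega$. Let $ds$ denote arc length on $b\Omega$, let $H^2(b\Omega)\subset L^2(b\Omega,ds)$ be the Hardy space of $L^2$ boundary values of holomorphic functions on $\Omega$ (each such function being identified with its boundary values), and put $$\langle u,v\rangle_\varphi=\int_{b\Omega}u\,\overline{v}\,\varphi\,ds .$$ Let $\sigma(z,w)$, $z,w\in\Omega$, be the weighted Szegő kernel, that is, the reproducing kernel of $H^2(b\Omega)$ for this inner product: for every $w\in\Omega$, $\sigma(\cdot,w)\in H^2(b\Omega)$ and $h(w)=\langle h,\sigma(\cdot,w)\rangle_\varphi$ for all $h\in H^2(b\Omega)$. Theorem 8.2. Suppose that $f$ is a proper holomorphic mapping of $\Omega$ onto the unit disc $\{|\zeta|<1\}$ whose zeros in $\Omega$ are exactly the distinct points $a_1,\dots,a_N$, all of them simple. Then the $N\times N$ matrix $[\sigma(a_k,a_j)]_{k,j}$ is invertible and, if $[c_{ij}]$ denotes its inverse, $$\sigma(z,w)=\frac{1}{1-f(z)\overline{f(w)}}\sum_{i,j=1}^{N}c_{ij}\,\sigma(z,a_i)\,\overline{\sigma(w,a_j)}\qquad\text{for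 all }z,w\in\Omega .$$ -/

import Mathlib

open Set Filter Topology MeasureTheory
open scoped ContDiff ComplexConjugate

/-- A bounded `n`-connected domain in the plane with `C^∞` smooth boundary: a bounded, connected,
nonempty open set whose boundary is the union of `n` pairwise disjoint regular `C^∞` simple closed
curves. The curves `curve j` have period `1` and are parameterized in the standard sense: the domain
lies locally on their left, and its exterior on their right. -/
structure SmoothDomain (n : ℕ) where
  carrier : Set ℂ
  isOpen : IsOpen carrier
  isConnected : IsConnected carrier
  isBounded : Bornology.IsBounded carrier
  curve : Fin n → ℝ → ℂ
  smooth : ∀ j, ContDiff ℝ ∞ (curve j)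
  periodic : ∀ j, Function.Periodic (curve j) 1
  regular : ∀ j t, deriv (curve j) t ≠ 0
  simple : ∀ j, InjOn (curve j) (Ico 0 1)
  disjoint : ∀ j k, j ≠ k → Disjoint (range (curve j)) (range (curve k))
  frontier_eq : frontier carrier = ⋃ j, range (curve j)
  orientation : ∀ j t, ∀ᶠ ε : ℝ in 𝓝[>] 0,
    curve j t + ε * (Complex.I * deriv (curve j) t) ∈ carrier ∧
      curve j t - ε * (Complex.I * deriv (curve j) t) ∉ closure carrier

namespace SmoothDomain

variable {n : ℕ}

/-- The unit tangent vector `T`, at the boundary point `curve j t`, as a complex number. -/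
noncomputable def tangent (Ω : SmoothDomain n) (j : Fin n) (t : ℝ) : ℂ :=
  deriv (Ω.curve j) t / (‖deriv (Ω.curve j) t‖ : ℂ)

/-- Arc length `ds = |z_j'(t)| dt` on the `j`-th boundary curve, as a measure on one period of the
parameter. -/
noncomputable def arcLength (Ω : SmoothDomain n) (j : Fin n) : Measure ℝ :=
  (volume.restrict (Ico 0 1)).withDensity fun t => ENNReal.ofReal ‖deriv (Ω.curve j) t‖

/-- A positive `C^∞` weight function on the boundary (values off the boundary are irrelevant). -/
structure IsWeight (Ω : SmoothDomain n) (φ : ℂ → ℝ) : Prop where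
  smooth : ∀ j, ContDiff ℝ ∞ fun t => φ (Ω.curve j t)
  pos : ∀ ζ ∈ frontier Ω.carrier, 0 < φ ζ

/-- `u` is square integrable on the boundary with respect to arc length. -/
def MemL2 (Ω : SmoothDomain n) (u : ℂ → ℂ) : Prop :=
  ∀ j, MemLp (fun t => u (Ω.curve j t)) 2 (Ω.arcLength j)

/-- The weighted inner product `⟨u, v⟩_φ = ∫_{bΩ} u (conj v) φ ds`. -/
noncomputable def weightedInner (Ω : SmoothDomain n) (φ : ℂ → ℝ) (u v : ℂ → ℂ) : ℂ :=
  ∑ j, ∫ t, u (Ω.curve j t) * conj (v (Ω.curve j t)) * (φ (Ω.curve j t) : ℂ) ∂(Ω.arcLength j)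

/-- `h` is holomorphic on the domain and has `u` as its `L²` boundary values: `u ∈ L²(bΩ)` and
the functions `ζ ↦ h (ζ + ε i T(ζ))` on the boundary, the values of `h` at distance `ε` along the
inner normal, tend to `u` in `L²(bΩ)` as `ε → 0⁺`. The Hardy space `H²(bΩ)` consists of all `u`
such that this holds for some `h`; as usual `u` and `h` are identified. -/
structure IsHardy (Ω : SmoothDomain n) (h u : ℂ → ℂ) : Prop where
  holomorphic : DifferentiableOn ℂ h Ω.carrier
  memL2 : Ω.MemL2 u
  tendsto : ∀ j, Tendsto
    (fun ε : ℝ => eLpNorm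
      (fun t => h (Ω.curve j t + ε * (Complex.I * Ω.tangent j t)) - u (Ω.curve j t)) 2
      (Ω.arcLength j))
    (𝓝[>] 0) (𝓝 0)

/-- `K` is the reproducing kernel of the Hardy space for the inner product with weight `φ`:
for every `w` in the domain, `K(·, w)` belongs to `H²(bΩ)` and `h(w) = ⟨h, K(·, w)⟩_φ` for
every `h` in `H²(bΩ)`. -/
def IsSzegoKernel (Ω : SmoothDomain n) (φ : ℂ → ℝ) (K : ℂ → ℂ → ℂ) : Prop :=
  ∀ w ∈ Ω.carrier, ∃ k : ℂ → ℂ, Ω.IsHardy (fun z => K z w) k ∧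
    ∀ h u : ℂ → ℂ, Ω.IsHardy h u → h w = Ω.weightedInner φ u k

theorem conj_weightedInner (Ω : SmoothDomain n) (φ : ℂ → ℝ) (u v : ℂ → ℂ) :
    conj (Ω.weightedInner φ u v) = Ω.weightedInner φ v u := by
  unfold weightedInner
  rw [map_sum]
  refine Finset.sum_congr rfl fun j _ => ?_
  rw [← integral_conj]
  congr 1
  ext t
  simp only [map_mul, Complex.conj_conj, Complex.conj_ofReal]
  ring

/-- The kernel is unique on the domain. -/
theorem IsSzegoKernel.unique {Ω : SmoothDomain n} {φ : ℂ → ℝ} {K L : ℂ → ℂ → ℂ}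
    (hK : Ω.IsSzegoKernel φ K) (hL : Ω.IsSzegoKernel φ L) {z w : ℂ}
    (hz : z ∈ Ω.carrier) (hw : w ∈ Ω.carrier) : K z w = L z w := by
  obtain ⟨k, hk, hk'⟩ := hK w hw
  obtain ⟨l, hl, hl'⟩ := hL z hz
  obtain ⟨m, hm, hm'⟩ := hL w hw
  have h1 := hl' _ _ hk
  have h2 := hk' _ _ hl
  have h3 := hm' _ _ hl
  have h4 := hl' _ _ hm
  rw [h1, h4, ← conj_weightedInner, ← h2, h3, conj_weightedInner]

open Classical in
/-- The weighted Szegő kernel `σ(z, w)` of the domain with respect to the weight `φ`; it is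
determined on the domain by `IsSzegoKernel.unique`. -/
noncomputable def szegoKernel (Ω : SmoothDomain n) (φ : ℂ → ℝ) : ℂ → ℂ → ℂ :=
  if h : ∃ K, Ω.IsSzegoKernel φ K then h.choose else 0

end SmoothDomain

/-!
The idea of the proof. A proper holomorphic map `f` from the domain to the unit disc has boundary
values `b` of modulus one, so multiplication by `f` is an isometry of the Hardy space. For `w` in
the domain the function `g = σ(·, w) - conj (f w) f σ(·, w)` is then orthogonal to `f h` for every
`h` in the Hardy space, since both terms of `⟨f h, g⟩` are equal to `f w * h w`. As the zeros `a_i`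
of `f` are simple, `f H²` consists of the functions that vanish at all the `a_i`, and its orthogonal
complement is spanned by the kernel functions `σ(·, a_i)`. Their Gram matrix `[σ(a_k, a_j)]` is
invertible because polynomials separate the points `a_i`, and the coefficients of `g` are found by
evaluation at these points, where `g` agrees with `σ(·, w)`. This algebra is carried out in
`IsSzegoKernel.isUnit_det_gram` and `IsSzegoKernel.one_sub_mul_eq_sum`.

The analysis behind it concerns boundary behaviour, where Hardy functions are described by
`L²` convergence along the inner normals.

* The Szegő kernel exists (`exists_isSzegoKernel`): the Hardy space is closed in `L²` and has
  bounded point evaluations. The bound `exists_evaluation_bound` comes from the Cauchy–Pompeiu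
  formula with cutoff functions that vary only in a collar of the boundary, integrated in normal
  coordinates. For closedness (`IsHardy.of_tendsto`) the `L²` norms on all parallel curves near the
  boundary have to be bounded by the norm of the boundary values; this follows from a convexity
  property of the energy of a holomorphic function on parallel curves
  (`IsCollar.parallelEnergy_le_max`), which reflects that `|h|²` is subharmonic.
* Properness gives `‖f‖ → 1` at the boundary. Comparison of `f` with `r / (z - c)` near an exterior
  tangent disc improves this to `1 - ‖f‖ ≤ C dist` (`exists_one_sub_norm_le`), hence `f` is
  Lipschitz along the normals near the boundary and has unimodular boundary values there
  (`exists_boundary_values`). No smoothness of `f` up to the boundary is used.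
* Bounded factors with boundary values along the normals are multipliers of Hardy functions
  (`IsHardy.mul`), which applies to `f` and, near the boundary, to `1 / f`. In this way
  `IsHardy.of_mul_eq` shows that division by `f` preserves the Hardy space.
-/

/-! ### Parallel curves and collars of the boundary -/

namespace SmoothDomain

variable {n : ℕ} (Ω : SmoothDomain n)

/-- The speed `|z_j'(t)|` of the `j`-th boundary curve. -/
noncomputable def speed (j : Fin n) (t : ℝ) : ℝ := ‖deriv (Ω.curve j) t‖

/-- The rate of turning `θ` of the `j`-th boundary curve (curvature times speed): `T' = θ i T`. -/
noncomputable def turning (j : Fin n) (t : ℝ) : ℝ :=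
  (deriv (Ω.tangent j) t * conj (Ω.tangent j t)).im

/-- Normal coordinates: the point at signed distance `ν` from `z_j(t)` along the inner normal. -/
noncomputable def normalPoint (j : Fin n) (t ν : ℝ) : ℂ :=
  Ω.curve j t + ν * (Complex.I * Ω.tangent j t)

theorem speed_pos (j : Fin n) (t : ℝ) : 0 < Ω.speed j t := norm_pos_iff.2 (Ω.regular j t)

theorem contDiff_deriv_curve (j : Fin n) : ContDiff ℝ ∞ (deriv (Ω.curve j)) :=
  (contDiff_infty_iff_deriv.1 (Ω.smooth j)).2

theorem hasDerivAt_curve (j : Fin n) (t : ℝ) :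
    HasDerivAt (Ω.curve j) (deriv (Ω.curve j) t) t :=
  ((Ω.smooth j).differentiable (by simp)).differentiableAt.hasDerivAt

theorem contDiff_speed (j : Fin n) : ContDiff ℝ ∞ (Ω.speed j) :=
  (Ω.contDiff_deriv_curve j).norm ℝ (Ω.regular j)

theorem contDiff_tangent (j : Fin n) : ContDiff ℝ ∞ (Ω.tangent j) := by
  have h : Ω.tangent j = fun t => (Ω.speed j t)⁻¹ • deriv (Ω.curve j) t := by
    ext t; simp [tangent, speed, div_eq_inv_mul]
  rw [h]
  exact ((Ω.contDiff_speed j).inv fun t => (Ω.speed_pos j t).ne').smul (Ω.contDiff_deriv_curve j)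

theorem norm_tangent (j : Fin n) (t : ℝ) : ‖Ω.tangent j t‖ = 1 := by
  have := norm_ne_zero_iff.2 (Ω.regular j t)
  simp [tangent, this]

theorem deriv_curve_eq (j : Fin n) (t : ℝ) :
    deriv (Ω.curve j) t = Ω.speed j t * Ω.tangent j t := by
  have : (‖deriv (Ω.curve j) t‖ : ℂ) ≠ 0 := by exact_mod_cast norm_ne_zero_iff.2 (Ω.regular j t)
  simp only [tangent, speed]; field_simp

theorem tangent_mul_conj (j : Fin n) (t : ℝ) : Ω.tangent j t * conj (Ω.tangent j t) = 1 := by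
  rw [Complex.mul_conj, Complex.normSq_eq_norm_sq, Ω.norm_tangent]; simp

theorem hasDerivAt_tangent (j : Fin n) (t : ℝ) :
    HasDerivAt (Ω.tangent j) (Ω.turning j t * (Complex.I * Ω.tangent j t)) t := by
  have h : HasDerivAt (Ω.tangent j) (deriv (Ω.tangent j) t) t :=
    ((Ω.contDiff_tangent j).differentiable (by simp)).differentiableAt.hasDerivAt
  have h1 := h.mul h.star
  have h2 : (Ω.tangent j * fun y => star (Ω.tangent j y)) = fun _ => (1 : ℂ) :=
    funext fun s => Ω.tangent_mul_conj j s
  rw [h2] at h1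
  have h3 := h1.unique (hasDerivAt_const t (1 : ℂ))
  have h4 : (deriv (Ω.tangent j) t * conj (Ω.tangent j t)).re = 0 := by
    have := congrArg Complex.re h3
    simp only [Complex.star_def, Complex.add_re, Complex.mul_re, Complex.conj_re, Complex.conj_im,
      Complex.zero_re] at this ⊢
    linarith
  have h5 : deriv (Ω.tangent j) t * conj (Ω.tangent j t) = Ω.turning j t * Complex.I := by
    apply Complex.ext <;> simp [h4, turning]
  convert h using 1
  calc _ = deriv (Ω.tangent j) t * conj (Ω.tangent j t) * Ω.tangent j t := by rw [h5]; ring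
    _ = deriv (Ω.tangent j) t * (Ω.tangent j t * conj (Ω.tangent j t)) := by ring
    _ = _ := by rw [tangent_mul_conj, mul_one]

@[fun_prop]
theorem continuous_curve (j : Fin n) : Continuous (Ω.curve j) := (Ω.smooth j).continuous

@[fun_prop]
theorem continuous_tangent (j : Fin n) : Continuous (Ω.tangent j) := (Ω.contDiff_tangent j).continuous

@[fun_prop]
theorem continuous_speed (j : Fin n) : Continuous (Ω.speed j) := (Ω.contDiff_speed j).continuous

@[fun_prop]
theorem continuous_turning (j : Fin n) : Continuous (Ω.turning j) :=
  Complex.continuous_im.comp (((contDiff_infty_iff_deriv.1 (Ω.contDiff_tangent j)).2.continuous).mul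
    (Complex.continuous_conj.comp (Ω.continuous_tangent j)))

theorem periodic_deriv_curve (j : Fin n) : Function.Periodic (deriv (Ω.curve j)) 1 := by
  intro t
  rw [← deriv_comp_add_const]
  congr 1
  exact funext (Ω.periodic j)

theorem periodic_tangent (j : Fin n) : Function.Periodic (Ω.tangent j) 1 := by
  intro t
  simp only [tangent, Ω.periodic_deriv_curve j t]

theorem periodic_normalPoint (j : Fin n) (ν : ℝ) :
    Function.Periodic (fun t => Ω.normalPoint j t ν) 1 := by
  intro t
  simp only [normalPoint, Ω.periodic j t, Ω.periodic_tangent j t]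

@[simp] theorem normalPoint_zero (j : Fin n) (t : ℝ) : Ω.normalPoint j t 0 = Ω.curve j t := by
  simp [normalPoint]

theorem continuous_normalPoint (j : Fin n) :
    Continuous fun p : ℝ × ℝ => Ω.normalPoint j p.1 p.2 := by
  have := Ω.continuous_curve j
  have := Ω.continuous_tangent j
  unfold normalPoint
  fun_prop

theorem contDiff_normalPoint (j : Fin n) :
    ContDiff ℝ ∞ fun p : ℝ × ℝ => Ω.normalPoint j p.1 p.2 := by
  have h1 := (Ω.smooth j).comp (contDiff_fst (𝕜 := ℝ) (E := ℝ) (F := ℝ))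
  have h2 := (Ω.contDiff_tangent j).comp (contDiff_fst (𝕜 := ℝ) (E := ℝ) (F := ℝ))
  exact h1.add ((Complex.ofRealCLM.contDiff.comp contDiff_snd).mul (contDiff_const.mul h2))

/-- The derivative of the normal coordinates. -/
noncomputable def normalDeriv (j : Fin n) (t ν : ℝ) : ℝ × ℝ →L[ℝ] ℂ :=
  (ContinuousLinearMap.fst ℝ ℝ ℝ).smulRight (((Ω.speed j t - ν * Ω.turning j t : ℝ) : ℂ) *
      Ω.tangent j t) +
    (ContinuousLinearMap.snd ℝ ℝ ℝ).smulRight (Complex.I * Ω.tangent j t)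

theorem hasDerivAt_normalPoint_left (j : Fin n) (t ν : ℝ) :
    HasDerivAt (fun t => Ω.normalPoint j t ν)
      (((Ω.speed j t - ν * Ω.turning j t : ℝ) : ℂ) * Ω.tangent j t) t := by
  have h := (Ω.hasDerivAt_curve j t).add
    (((Ω.hasDerivAt_tangent j t).const_mul Complex.I).const_mul (ν : ℂ))
  refine h.congr_deriv ?_
  rw [deriv_curve_eq]
  push_cast
  linear_combination (ν * Ω.turning j t * Ω.tangent j t : ℂ) * Complex.I_mul_I

theorem hasDerivAt_normalPoint_right (j : Fin n) (t ν : ℝ) :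
    HasDerivAt (fun ν => Ω.normalPoint j t ν) (Complex.I * Ω.tangent j t) ν := by
  have h := ((hasDerivAt_id ν).ofReal_comp.mul_const (Complex.I * Ω.tangent j t)).const_add
    (Ω.curve j t)
  exact h.congr_deriv (by simp)

theorem hasFDerivAt_normalPoint (j : Fin n) (p : ℝ × ℝ) :
    HasFDerivAt (fun p : ℝ × ℝ => Ω.normalPoint j p.1 p.2) (Ω.normalDeriv j p.1 p.2) p := by
  have h := ((Ω.contDiff_normalPoint j).differentiable (by simp)).differentiableAt.hasFDerivAt (x := p)
  refine h.congr_fderiv ?_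
  have h1 := h.comp_hasDerivAt p.1 ((hasDerivAt_id p.1).prodMk (hasDerivAt_const p.1 p.2))
  have h2 := h.comp_hasDerivAt p.2 ((hasDerivAt_const p.2 p.1).prodMk (hasDerivAt_id p.2))
  have h1' := h1.unique (Ω.hasDerivAt_normalPoint_left j p.1 p.2)
  have h2' := h2.unique (Ω.hasDerivAt_normalPoint_right j p.1 p.2)
  refine ContinuousLinearMap.ext fun v => ?_
  have hv : v = v.1 • ((1 : ℝ), (0 : ℝ)) + v.2 • ((0 : ℝ), (1 : ℝ)) := by ext <;> simp
  conv_lhs => rw [hv]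
  rw [map_add, map_smul, map_smul, h1', h2']
  simp [normalDeriv]

theorem hasStrictFDerivAt_normalPoint (j : Fin n) (p : ℝ × ℝ) :
    HasStrictFDerivAt (fun p : ℝ × ℝ => Ω.normalPoint j p.1 p.2) (Ω.normalDeriv j p.1 p.2) p :=
  ((Ω.contDiff_normalPoint j).contDiffAt).hasStrictFDerivAt' (Ω.hasFDerivAt_normalPoint j p)
    (by simp)

theorem norm_normalDeriv_zero (j : Fin n) (t : ℝ) (v : ℝ × ℝ) :
    min (Ω.speed j t) 1 * ‖v‖ ≤ ‖Ω.normalDeriv j t 0 v‖ := by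
  have h : Ω.normalDeriv j t 0 v = ((Ω.speed j t * v.1 : ℝ) + (v.2 : ℝ) * Complex.I) *
      Ω.tangent j t := by
    simp [normalDeriv]; ring
  rw [h, norm_mul, norm_tangent, mul_one, Prod.norm_def]
  have h1 := Complex.abs_re_le_norm ((Ω.speed j t * v.1 : ℝ) + (v.2 : ℝ) * Complex.I)
  have h2 := Complex.abs_im_le_norm ((Ω.speed j t * v.1 : ℝ) + (v.2 : ℝ) * Complex.I)
  have hs := Ω.speed_pos j t
  simp only [Complex.add_re, Complex.ofReal_re, Complex.re_ofReal_mul, Complex.I_re, mul_zero, add_zero,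
    Complex.add_im, Complex.ofReal_im, Complex.im_ofReal_mul, Complex.I_im, mul_one, zero_add, abs_mul,
    abs_of_pos hs] at h1 h2
  rcases max_cases ‖v.1‖ ‖v.2‖ with ⟨h3, -⟩ | ⟨h3, -⟩ <;> rw [h3]
  · refine le_trans ?_ h1
    exact mul_le_mul_of_nonneg_right (min_le_left _ _) (norm_nonneg _)
  · refine le_trans ?_ h2
    calc _ ≤ 1 * ‖v.2‖ := mul_le_mul_of_nonneg_right (min_le_right _ _) (norm_nonneg _)
      _ = |v.2| := one_mul _

/-- Local injectivity of the normal coordinates, from strict differentiability with an injective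
derivative. -/
theorem eventually_normalPoint_injective (j : Fin n) (t : ℝ) :
    ∀ᶠ p : (ℝ × ℝ) × (ℝ × ℝ) in 𝓝 ((t, 0), (t, 0)),
      Ω.normalPoint j p.1.1 p.1.2 = Ω.normalPoint j p.2.1 p.2.2 → p.1 = p.2 := by
  have h := (Ω.hasStrictFDerivAt_normalPoint j (t, 0)).isLittleO
  have hc : 0 < min (Ω.speed j t) 1 := lt_min (Ω.speed_pos j t) one_pos
  filter_upwards [h.def (half_pos hc)] with p hp heq
  rw [heq, sub_self, zero_sub, norm_neg] at hp
  have h1 := (Ω.norm_normalDeriv_zero j t (p.1 - p.2)).trans hp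
  have h2 : ‖p.1 - p.2‖ ≤ 0 := by nlinarith [norm_nonneg (p.1 - p.2)]
  exact sub_eq_zero.1 (norm_le_zero_iff.1 h2)

theorem curve_int_shift {j : Fin n} {t s : ℝ} (h : Ω.curve j t = Ω.curve j s) :
    ∃ m : ℤ, t = s + m := by
  have key (x : ℝ) : Ω.curve j (Int.fract x) = Ω.curve j x := by
    have := (Ω.periodic j).sub_zsmul_eq (x := x) ⌊x⌋
    rwa [zsmul_eq_mul, mul_one] at this
  have h1 : Int.fract t = Int.fract s :=
    Ω.simple j ⟨Int.fract_nonneg _, Int.fract_lt_one _⟩ ⟨Int.fract_nonneg _, Int.fract_lt_one _⟩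
      (by rw [key, key, h])
  obtain ⟨m, hm⟩ := Int.fract_eq_fract.1 h1
  exact ⟨m, by linarith⟩

theorem normalPoint_add_int (j : Fin n) (t ν : ℝ) (m : ℤ) :
    Ω.normalPoint j (t + m) ν = Ω.normalPoint j t ν := by
  simpa using (Ω.periodic_normalPoint j ν).int_mul m t

theorem index_eq_of_curve_eq {j k : Fin n} {t s : ℝ} (h : Ω.curve j t = Ω.curve k s) : j = k := by
  by_contra hjk
  exact (Set.disjoint_left.1 (Ω.disjoint j k hjk)) ⟨t, rfl⟩ ⟨s, h.symm⟩

theorem eventually_normalPoint_unique (j k : Fin n) (t s : ℝ) :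
    ∀ᶠ p : (ℝ × ℝ) × (ℝ × ℝ) in 𝓝 ((0, 0), (t, s)),
      Ω.normalPoint j p.2.1 p.1.1 = Ω.normalPoint k p.2.2 p.1.2 →
        Ω.curve j p.2.1 = Ω.curve k p.2.2 ∧ p.1.1 = p.1.2 := by
  have c1 : Continuous fun p : (ℝ × ℝ) × (ℝ × ℝ) => Ω.normalPoint j p.2.1 p.1.1 :=
    (Ω.continuous_normalPoint j).comp
      (by fun_prop : Continuous fun p : (ℝ × ℝ) × (ℝ × ℝ) => (p.2.1, p.1.1))
  have c2 : Continuous fun p : (ℝ × ℝ) × (ℝ × ℝ) => Ω.normalPoint k p.2.2 p.1.2 :=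
    (Ω.continuous_normalPoint k).comp
      (by fun_prop : Continuous fun p : (ℝ × ℝ) × (ℝ × ℝ) => (p.2.2, p.1.2))
  by_cases h : Ω.curve j t = Ω.curve k s
  · obtain rfl := Ω.index_eq_of_curve_eq h
    obtain ⟨m, rfl⟩ := Ω.curve_int_shift h
    have ht : Tendsto (fun p : (ℝ × ℝ) × (ℝ × ℝ) => ((p.2.1, p.1.1), (p.2.2 + (m : ℝ), p.1.2)))
        (𝓝 ((0, 0), (s + m, s))) (𝓝 ((s + m, 0), (s + m, 0))) :=
      Continuous.tendsto (by fun_prop) ((0, 0), (s + m, s))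
    filter_upwards [ht.eventually (Ω.eventually_normalPoint_injective j (s + m))] with p hp heq
    have := hp (by simpa only [normalPoint_add_int] using heq)
    simp only [Prod.mk.injEq] at this
    refine ⟨?_, this.2⟩
    rw [this.1, ← normalPoint_zero, normalPoint_add_int, normalPoint_zero]
  · have : ∀ᶠ p : (ℝ × ℝ) × (ℝ × ℝ) in 𝓝 ((0, 0), (t, s)),
        Ω.normalPoint j p.2.1 p.1.1 ≠ Ω.normalPoint k p.2.2 p.1.2 :=
      (isOpen_ne_fun c1 c2).mem_nhds (by simpa using h)
    filter_upwards [this] with p hp heq using absurd heq hp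

/-- **Tubular neighbourhood.** Normal coordinates are injective up to the period, with a uniform
width. -/
theorem exists_normalPoint_unique : ∃ ε > 0, ∀ j k t s ν μ, |ν| ≤ ε → |μ| ≤ ε →
    Ω.normalPoint j t ν = Ω.normalPoint k s μ → Ω.curve j t = Ω.curve k s ∧ ν = μ := by
  have h1 : ∀ᶠ e : ℝ × ℝ in 𝓝 (0, 0), ∀ j k, ∀ x ∈ Icc (0 : ℝ) 1 ×ˢ Icc (0 : ℝ) 1,
      Ω.normalPoint j x.1 e.1 = Ω.normalPoint k x.2 e.2 →
        Ω.curve j x.1 = Ω.curve k x.2 ∧ e.1 = e.2 := by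
    refine eventually_all.2 fun j => eventually_all.2 fun k => ?_
    refine (isCompact_Icc.prod isCompact_Icc).eventually_forall_of_forall_eventually ?_
    intro x _
    exact Ω.eventually_normalPoint_unique j k x.1 x.2
  obtain ⟨ε, hε, h2⟩ := Metric.eventually_nhds_iff_ball.1 h1
  refine ⟨ε / 2, half_pos hε, fun j k t s ν μ hν hμ heq => ?_⟩
  have key (j : Fin n) (x ν : ℝ) :
      Ω.normalPoint j (Int.fract x) ν = Ω.normalPoint j x ν := by
    conv_rhs => rw [← Int.fract_add_floor x, normalPoint_add_int]
  have mem (x : ℝ) : Int.fract x ∈ Icc (0 : ℝ) 1 := ⟨Int.fract_nonneg _, (Int.fract_lt_one _).le⟩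
  have hb : (ν, μ) ∈ Metric.ball ((0 : ℝ), (0 : ℝ)) ε := by
    rw [Metric.mem_ball, dist_eq_norm, Prod.norm_def]
    simp only [Prod.fst_sub, Prod.snd_sub, sub_zero, Real.norm_eq_abs]
    exact max_lt (by linarith) (by linarith)
  have := h2 _ hb j k (Int.fract t, Int.fract s) ⟨mem t, mem s⟩ (by simpa only [key] using heq)
  have k2 := key j t 0
  have k3 := key k s 0
  simp only [normalPoint_zero] at k2 k3
  simpa only [k2, k3] using this

theorem curve_mem_frontier (j : Fin n) (t : ℝ) : Ω.curve j t ∈ frontier Ω.carrier := by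
  rw [Ω.frontier_eq]; exact mem_iUnion.2 ⟨j, t, rfl⟩

theorem exists_curve_Ico {p : ℂ} (hp : p ∈ frontier Ω.carrier) :
    ∃ j, ∃ t ∈ Ico (0 : ℝ) 1, Ω.curve j t = p := by
  rw [Ω.frontier_eq] at hp
  obtain ⟨j, t, rfl⟩ := mem_iUnion.1 hp
  refine ⟨j, Int.fract t, ⟨Int.fract_nonneg _, Int.fract_lt_one _⟩, ?_⟩
  have := Ω.normalPoint_add_int j (Int.fract t) 0 ⌊t⌋
  simpa using this.symm

theorem notMem_of_mem_frontier {p : ℂ} (hp : p ∈ frontier Ω.carrier) : p ∉ Ω.carrier := by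
  rw [Ω.isOpen.frontier_eq] at hp; exact hp.2

theorem _root_.IsPreconnected.subset_of_disjoint_frontier {X : Type*} [TopologicalSpace X]
    {s u : Set X} (hs : IsPreconnected s) (hd : Disjoint s (frontier u))
    (hn : (s ∩ closure u).Nonempty) :
    s ⊆ interior u := by
  have hcl : s ∩ closure u ⊆ interior u := fun x hx => by
    by_contra h
    exact Set.disjoint_left.1 hd hx.1 ⟨hx.2, h⟩
  refine hs.subset_left_of_subset_union isOpen_interior (isClosed_closure (s := u)).isOpen_compl ?_ ?_ ?_
  · exact Set.disjoint_left.2 fun x hx h => h (subset_closure (interior_subset hx))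
  · intro x hx
    by_cases h : x ∈ closure u
    · exact Or.inl (hcl ⟨hx, h⟩)
    · exact Or.inr h
  · obtain ⟨x, hx⟩ := hn
    exact ⟨x, hx.1, hcl hx⟩

/-- The inner normal segments of a uniform length lie in the domain, the outer ones outside. -/
theorem exists_normalPoint_mem : ∃ ε > 0,
    (∀ j k t s ν μ, |ν| ≤ ε → |μ| ≤ ε →
      Ω.normalPoint j t ν = Ω.normalPoint k s μ → Ω.curve j t = Ω.curve k s ∧ ν = μ) ∧
    ∀ j t ν, 0 < ν → ν ≤ ε →
      Ω.normalPoint j t ν ∈ Ω.carrier ∧ Ω.normalPoint j t (-ν) ∉ closure Ω.carrier := by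
  obtain ⟨ε, hε, hinj⟩ := Ω.exists_normalPoint_unique
  refine ⟨ε, hε, hinj, fun j t ν hν hνε => ?_⟩
  have hfr (μ : ℝ) (h0 : μ ≠ 0) (hμ : |μ| ≤ ε) : Ω.normalPoint j t μ ∉ frontier Ω.carrier := by
    intro h
    obtain ⟨k, s, -, hs⟩ := Ω.exists_curve_Ico h
    rw [← normalPoint_zero] at hs
    exact h0 (hinj k j s t 0 μ (by simpa using hε.le) hμ hs).2.symm
  have hspeed := Ω.speed_pos j t
  have hcont : Continuous fun μ => Ω.normalPoint j t μ := by unfold normalPoint; fun_prop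
  -- The orientation condition, at some small distance along this normal.
  obtain ⟨e, he, he0⟩ : ∃ e : ℝ, (Ω.normalPoint j t e ∈ Ω.carrier ∧
      Ω.normalPoint j t (-e) ∉ closure Ω.carrier) ∧ (0 < e ∧ e ≤ ε) := by
    have h1 : Tendsto (fun e : ℝ => e * Ω.speed j t) (𝓝[>] 0) (𝓝[>] 0) := by
      refine tendsto_nhdsWithin_iff.2 ⟨?_, ?_⟩
      · have : Tendsto (fun e : ℝ => e * Ω.speed j t) (𝓝 0) (𝓝 (0 * Ω.speed j t)) :=
          (continuous_id.mul continuous_const).tendsto 0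
        rw [zero_mul] at this
        exact this.mono_left nhdsWithin_le_nhds
      · filter_upwards [self_mem_nhdsWithin] with e he using mul_pos he hspeed
    have h3 : ∀ᶠ e : ℝ in 𝓝[>] 0, e * Ω.speed j t ∈ Ioc 0 ε := h1 (Ioc_mem_nhdsGT hε)
    obtain ⟨e, h2, h4⟩ := ((Ω.orientation j t).and h3).exists
    refine ⟨e * Ω.speed j t, ?_, h4⟩
    have h5 : Ω.normalPoint j t (e * Ω.speed j t) =
        Ω.curve j t + e * (Complex.I * deriv (Ω.curve j) t) := by
      rw [deriv_curve_eq, normalPoint]; push_cast; ring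
    have h6 : Ω.normalPoint j t (-(e * Ω.speed j t)) =
        Ω.curve j t - e * (Complex.I * deriv (Ω.curve j) t) := by
      rw [deriv_curve_eq, normalPoint]; push_cast; ring
    rwa [h5, h6]
  constructor
  · have hpre : IsPreconnected (Ω.normalPoint j t '' Ioc 0 ε) :=
      isPreconnected_Ioc.image _ hcont.continuousOn
    have := hpre.subset_of_disjoint_frontier (u := Ω.carrier)
      (Set.disjoint_left.2 (by
        rintro _ ⟨μ, hμ, rfl⟩
        exact hfr μ hμ.1.ne' (by rw [abs_of_pos hμ.1]; exact hμ.2)))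
      ⟨_, mem_image_of_mem _ he0, subset_closure he.1⟩
    exact interior_subset (this (mem_image_of_mem _ ⟨hν, hνε⟩))
  · intro hcl
    have hpre : IsPreconnected ((fun μ => Ω.normalPoint j t (-μ)) '' Ioc 0 ε) :=
      isPreconnected_Ioc.image _ (hcont.comp continuous_neg).continuousOn
    have := hpre.subset_of_disjoint_frontier (u := Ω.carrier)
      (Set.disjoint_left.2 (by
        rintro _ ⟨μ, hμ, rfl⟩
        exact hfr (-μ) (neg_ne_zero.2 hμ.1.ne') (by rw [abs_neg, abs_of_pos hμ.1]; exact hμ.2)))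
      ⟨_, mem_image_of_mem _ ⟨hν, hνε⟩, hcl⟩
    exact he.2 (subset_closure (interior_subset (this (mem_image_of_mem _ he0))))

theorem isCompact_frontier : IsCompact (frontier Ω.carrier) :=
  Ω.isBounded.isCompact_closure.of_isClosed_subset isClosed_frontier frontier_subset_closure

theorem frontier_nonempty : (frontier Ω.carrier).Nonempty := by
  by_contra h
  rw [not_nonempty_iff_eq_empty] at h
  have h1 : IsClopen Ω.carrier := isClopen_iff_frontier_eq_empty.2 h
  rcases isClopen_iff.1 h1 with h2 | h2
  · exact Ω.isConnected.nonempty.ne_empty h2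
  · have := Ω.isBounded
    rw [h2] at this
    exact NormedSpace.unbounded_univ ℝ ℂ this

/-- A nearest boundary point is the foot of a normal. -/
theorem exists_foot (z : ℂ) : ∃ j, ∃ t ∈ Ico (0 : ℝ) 1, ∃ ν : ℝ,
    |ν| = Metric.infDist z (frontier Ω.carrier) ∧ z = Ω.normalPoint j t ν := by
  obtain ⟨p, hp, hd⟩ := Ω.isCompact_frontier.exists_infDist_eq_dist Ω.frontier_nonempty z
  obtain ⟨j, t, ht, rfl⟩ := Ω.exists_curve_Ico hp
  have hmin : IsLocalMin (fun s => ‖z - Ω.curve j s‖ ^ 2) t := by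
    refine Eventually.of_forall fun s => ?_
    have h1 := Metric.infDist_le_dist_of_mem (x := z) (Ω.curve_mem_frontier j s)
    rw [hd, dist_eq_norm, dist_eq_norm] at h1
    exact pow_le_pow_left₀ (norm_nonneg _) h1 2
  have hder := ((Ω.hasDerivAt_curve j t).const_sub z).norm_sq
  have h0 := hmin.hasDerivAt_eq_zero hder
  rw [Complex.inner, deriv_curve_eq] at h0
  set q := z - Ω.curve j t with hq
  set T := Ω.tangent j t with hT
  have h1 : (q * conj T).re = 0 := by
    have hs := Ω.speed_pos j t
    have : 2 * (conj q * -(↑(Ω.speed j t) * T)).re = -2 * Ω.speed j t * (q * conj T).re := by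
      simp; ring
    rw [mul_comm (-(↑(Ω.speed j t) * T)) (conj q)] at h0
    rw [this] at h0
    rcases mul_eq_zero.1 h0 with h | h
    · exact absurd h (by nlinarith)
    · exact h
  have h2 : q = ((q * conj T).im : ℂ) * (Complex.I * T) := by
    have h3 : q * conj T = (q * conj T).im * Complex.I := by
      apply Complex.ext <;> simp [h1]
    calc q = q * (T * conj T) := by rw [hT, tangent_mul_conj, mul_one]
      _ = q * conj T * T := by ring
      _ = _ := by rw [h3]; simp; ring
  refine ⟨j, t, ht, (q * conj T).im, ?_, ?_⟩
  · rw [hd, dist_eq_norm, ← hq]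
    conv_rhs => rw [h2]
    rw [norm_mul, norm_mul, Complex.norm_I, hT, norm_tangent, mul_one, mul_one, Complex.norm_real,
      Real.norm_eq_abs]
  · rw [normalPoint, ← hT, ← h2, hq]; ring

theorem norm_normalPoint_sub_curve (j : Fin n) (t ν : ℝ) :
    ‖Ω.normalPoint j t ν - Ω.curve j t‖ = |ν| := by
  simp [normalPoint, norm_tangent]

theorem infDist_pos {z : ℂ} (hz : z ∈ Ω.carrier) : 0 < Metric.infDist z (frontier Ω.carrier) :=
  (isClosed_frontier.notMem_iff_infDist_pos Ω.frontier_nonempty).1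
    fun h => Ω.notMem_of_mem_frontier h hz

/-- A width `ε` for which the normal coordinates of the boundary describe a two-sided collar: they
are injective, positive values of the coordinate are inside and negative ones outside, and the
Jacobian `ρ = |z'| - ν θ` is comparable to the speed. -/
structure IsCollar (ε : ℝ) : Prop where
  pos : 0 < ε
  unique : ∀ j k t s ν μ, |ν| ≤ ε → |μ| ≤ ε →
    Ω.normalPoint j t ν = Ω.normalPoint k s μ → Ω.curve j t = Ω.curve k s ∧ ν = μ
  inside : ∀ j t ν, 0 < ν → ν ≤ ε → Ω.normalPoint j t ν ∈ Ω.carrier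
  outside : ∀ j t ν, 0 < ν → ν ≤ ε → Ω.normalPoint j t (-ν) ∉ closure Ω.carrier
  jacobian : ∀ j t ν, |ν| ≤ ε → |ν * Ω.turning j t| ≤ Ω.speed j t / 2

theorem periodic_speed (j : Fin n) : Function.Periodic (Ω.speed j) 1 := by
  intro t; simp only [speed, Ω.periodic_deriv_curve j t]

theorem periodic_turning (j : Fin n) : Function.Periodic (Ω.turning j) 1 := by
  intro t
  have h : deriv (Ω.tangent j) (t + 1) = deriv (Ω.tangent j) t := by
    rw [← deriv_comp_add_const]
    congr 1
    exact funext (Ω.periodic_tangent j)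
  simp only [turning, h, Ω.periodic_tangent j t]

theorem _root_.Function.Periodic.exists_bound {g : ℝ → ℝ} (hp : Function.Periodic g 1)
    (hc : Continuous g) :
    ∃ C, 0 < C ∧ ∀ t, |g t| ≤ C := by
  obtain ⟨C, hC⟩ :=
    (isCompact_Icc (a := (0 : ℝ)) (b := 1)).exists_bound_of_continuousOn hc.continuousOn
  refine ⟨max C 1, by positivity, fun t => ?_⟩
  have h1 : g (Int.fract t) = g t := by
    have := hp.sub_zsmul_eq (x := t) ⌊t⌋
    rwa [zsmul_eq_mul, mul_one] at this
  rw [← h1]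
  exact (hC _ ⟨Int.fract_nonneg _, (Int.fract_lt_one _).le⟩).trans (le_max_left _ _)

theorem exists_speed_lower : ∃ c > 0, ∀ j t, c ≤ Ω.speed j t := by
  have h (j : Fin n) : ∃ C, 0 < C ∧ ∀ t, |(Ω.speed j t)⁻¹| ≤ C :=
    Function.Periodic.exists_bound (fun t => by simp only [Ω.periodic_speed j t])
      ((Ω.continuous_speed j).inv₀ fun t => (Ω.speed_pos j t).ne')
  choose C hC0 hC using h
  have hS : 0 < ∑ j, C j + 1 := by
    have := Finset.sum_nonneg fun j (_ : j ∈ Finset.univ) => (hC0 j).le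
    linarith
  refine ⟨(∑ j, C j + 1)⁻¹, inv_pos.2 hS, fun j t => ?_⟩
  rw [inv_le_comm₀ hS (Ω.speed_pos j t)]
  have h1 := Finset.single_le_sum (f := C) (fun j _ => (hC0 j).le) (Finset.mem_univ j)
  linarith [(le_abs_self _).trans (hC j t)]

theorem exists_turning_bound : ∃ C > 0, ∀ j t, |Ω.turning j t| ≤ C := by
  have h (j : Fin n) := (Ω.periodic_turning j).exists_bound (Ω.continuous_turning j)
  choose C hC0 hC using h
  refine ⟨∑ j, C j + 1, ?_, fun j t => ?_⟩
  · have := Finset.sum_nonneg fun j (_ : j ∈ Finset.univ) => (hC0 j).le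
    linarith
  · have h1 := Finset.single_le_sum (f := C) (fun j _ => (hC0 j).le) (Finset.mem_univ j)
    linarith [hC j t]

theorem exists_isCollar : ∃ ε, Ω.IsCollar ε := by
  obtain ⟨ε, hε, hinj, hmem⟩ := Ω.exists_normalPoint_mem
  obtain ⟨c, hc, hsp⟩ := Ω.exists_speed_lower
  obtain ⟨C, hC, htu⟩ := Ω.exists_turning_bound
  have hm : 0 < min ε (c / (2 * C)) := lt_min hε (by positivity)
  refine ⟨min ε (c / (2 * C)), hm, ?_, ?_, ?_, ?_⟩
  · intro j k t s ν μ hν hμ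
    exact hinj j k t s ν μ (hν.trans (min_le_left _ _)) (hμ.trans (min_le_left _ _))
  · exact fun j t ν h0 h => (hmem j t ν h0 (h.trans (min_le_left _ _))).1
  · exact fun j t ν h0 h => (hmem j t ν h0 (h.trans (min_le_left _ _))).2
  · intro j t ν hν
    have h1 := hν.trans (min_le_right _ _)
    rw [abs_mul]
    calc |ν| * |Ω.turning j t| ≤ c / (2 * C) * C := by gcongr; exact htu j t
      _ = c / 2 := by field_simp
      _ ≤ _ := by linarith [hsp j t]

variable {Ω} {ε : ℝ}

theorem IsCollar.mono (hε : Ω.IsCollar ε) {η : ℝ} (h0 : 0 < η) (h : η ≤ ε) : Ω.IsCollar η where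
  pos := h0
  unique j k t s ν μ hν hμ := hε.unique j k t s ν μ (hν.trans h) (hμ.trans h)
  inside j t ν hν hν' := hε.inside j t ν hν (hν'.trans h)
  outside j t ν hν hν' := hε.outside j t ν hν (hν'.trans h)
  jacobian j t ν hν := hε.jacobian j t ν (hν.trans h)

theorem IsCollar.exists_eq (hε : Ω.IsCollar ε) {z : ℂ} (hz : z ∈ Ω.carrier)
    (hd : Metric.infDist z (frontier Ω.carrier) ≤ ε) :
    ∃ j, ∃ t ∈ Ico (0 : ℝ) 1, z = Ω.normalPoint j t (Metric.infDist z (frontier Ω.carrier)) := by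
  obtain ⟨j, t, ht, ν, hν, h⟩ := Ω.exists_foot z
  refine ⟨j, t, ht, ?_⟩
  have hp := Ω.infDist_pos hz
  rcases abs_cases ν with ⟨h1, -⟩ | ⟨h1, h2⟩
  · rw [← hν, h1]; exact h
  · exfalso
    refine hε.outside j t (-ν) (by linarith) (by linarith) ?_
    rw [neg_neg, ← h]
    exact subset_closure hz

/-- The domain has exterior tangent discs of a uniform radius. -/
theorem IsCollar.ball_disjoint (hε : Ω.IsCollar ε) (j : Fin n) (t : ℝ) :
    Disjoint (Metric.ball (Ω.normalPoint j t (-ε)) ε) Ω.carrier := by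
  set c := Ω.normalPoint j t (-ε) with hc
  have hout := hε.outside j t ε hε.pos le_rfl
  rw [← hc] at hout
  have hdist : ε ≤ Metric.infDist c (frontier Ω.carrier) := by
    by_contra hlt
    push Not at hlt
    obtain ⟨k, s, -, ν, hν, h⟩ := Ω.exists_foot c
    have := (hε.unique j k t s (-ε) ν (by rw [abs_neg, abs_of_pos hε.pos])
      (by rw [hν]; exact hlt.le) (by rw [← hc, h])).2
    rw [← this, abs_neg, abs_of_pos hε.pos] at hν
    exact hlt.ne hν.symm
  have hb : Disjoint (Metric.ball c ε) (frontier Ω.carrier) := by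
    refine Set.disjoint_left.2 fun x hx hxf => ?_
    have := Metric.infDist_le_dist_of_mem (x := c) hxf
    rw [Metric.mem_ball, dist_comm] at hx
    linarith
  refine Set.disjoint_left.2 fun x hx hxΩ => hout ?_
  have := (convex_ball c ε).isPreconnected.subset_of_disjoint_frontier hb
    ⟨x, hx, subset_closure hxΩ⟩
  exact subset_closure (interior_subset (this (Metric.mem_ball_self hε.pos)))

end SmoothDomain

/-! ### Hardy functions on the parallel curves -/

/-- Differentiation under the integral sign for a continuous derivative on a compact interval. -/
theorem hasDerivAt_intervalIntegral_of_continuousOn {g g' : ℝ → ℝ → ℝ} {a b ν : ℝ}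
    (hν : ν ∈ Ioo a b) (hg : ∀ s ∈ Ioo a b, Continuous (g s))
    (hder : ∀ s ∈ Ioo a b, ∀ t, HasDerivAt (fun s => g s t) (g' s t) s)
    (hcont : ContinuousOn (fun p : ℝ × ℝ => g' p.1 p.2) (Ioo a b ×ˢ univ)) :
    HasDerivAt (fun s => ∫ t in (0 : ℝ)..1, g s t) (∫ t in (0 : ℝ)..1, g' ν t) ν := by
  obtain ⟨δ, hδ, hsub⟩ := Metric.nhds_basis_closedBall.mem_iff.1 (isOpen_Ioo.mem_nhds hν)
  have hK : IsCompact (Metric.closedBall ν δ ×ˢ Icc (0 : ℝ) 1) :=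
    (isCompact_closedBall _ _).prod isCompact_Icc
  obtain ⟨B, hB⟩ := hK.exists_bound_of_continuousOn
    (hcont.mono (prod_mono hsub (subset_univ _)))
  refine (intervalIntegral.hasDerivAt_integral_of_dominated_loc_of_deriv_le
    (bound := fun _ => B) (s := Metric.closedBall ν δ) (Metric.closedBall_mem_nhds ν hδ)
    ?_ ?_ ?_ ?_ ?_ ?_).2
  · filter_upwards [isOpen_Ioo.mem_nhds hν] with s hs using (hg s hs).aestronglyMeasurable
  · exact (hg ν hν).intervalIntegrable _ _
  · refine Continuous.aestronglyMeasurable ?_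
    exact continuousOn_univ.1 (hcont.comp (f := fun t : ℝ => (ν, t)) (by fun_prop)
      fun t _ => ⟨hν, mem_univ t⟩)
  · refine Eventually.of_forall fun t ht s hs => hB (s, t) ⟨hs, ?_⟩
    rw [uIoc_of_le zero_le_one] at ht
    exact ⟨ht.1.le, ht.2⟩
  · exact intervalIntegrable_const
  · exact Eventually.of_forall fun t _ s hs => hder s (hsub hs) t

namespace SmoothDomain

variable {n : ℕ} {Ω : SmoothDomain n} {ε : ℝ} {h : ℂ → ℂ}

theorem IsCollar.mapsTo (hε : Ω.IsCollar ε) (j : Fin n) :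
    MapsTo (fun p : ℝ × ℝ => Ω.normalPoint j p.2 p.1) (Ioo 0 ε ×ˢ univ) Ω.carrier :=
  fun p hp => hε.inside j p.2 p.1 hp.1.1 hp.1.2.le

theorem IsCollar.continuousOn_comp (hε : Ω.IsCollar ε) (j : Fin n) {g : ℂ → ℂ}
    (hg : ContinuousOn g Ω.carrier) :
    ContinuousOn (fun p : ℝ × ℝ => g (Ω.normalPoint j p.2 p.1)) (Ioo 0 ε ×ˢ univ) :=
  hg.comp ((Ω.continuous_normalPoint j).comp continuous_swap).continuousOn (hε.mapsTo j)

theorem IsCollar.continuous_comp (hε : Ω.IsCollar ε) (j : Fin n) {g : ℂ → ℂ}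
    (hg : ContinuousOn g Ω.carrier) {ν : ℝ} (hν : ν ∈ Ioo 0 ε) :
    Continuous fun t => g (Ω.normalPoint j t ν) :=
  continuousOn_univ.1 ((hε.continuousOn_comp j hg).comp (f := fun t : ℝ => (ν, t)) (by fun_prop)
      fun t _ => ⟨hν, mem_univ t⟩)

theorem continuous_slice {G : ℝ × ℝ → ℝ} (hG : ContinuousOn G (Ioo 0 ε ×ˢ univ)) {ν : ℝ}
    (hν : ν ∈ Ioo 0 ε) : Continuous fun t => G (ν, t) :=
  continuousOn_univ.1 (hG.comp (f := fun t : ℝ => (ν, t)) (by fun_prop) fun t _ => ⟨hν, mem_univ t⟩)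

theorem IsCollar.hasDerivAt_comp_right (hε : Ω.IsCollar ε) (j : Fin n) {g : ℂ → ℂ}
    (hg : DifferentiableOn ℂ g Ω.carrier) {ν : ℝ} (hν : ν ∈ Ioo 0 ε) (t : ℝ) :
    HasDerivAt (fun ν => g (Ω.normalPoint j t ν))
      (deriv g (Ω.normalPoint j t ν) * (Complex.I * Ω.tangent j t)) ν := by
  have h1 := (hg.differentiableAt
    (Ω.isOpen.mem_nhds (hε.inside j t ν hν.1 hν.2.le))).hasDerivAt
  exact h1.comp ν (Ω.hasDerivAt_normalPoint_right j t ν)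

theorem IsCollar.hasDerivAt_comp_left (hε : Ω.IsCollar ε) (j : Fin n) {g : ℂ → ℂ}
    (hg : DifferentiableOn ℂ g Ω.carrier) {ν : ℝ} (hν : ν ∈ Ioo 0 ε) (t : ℝ) :
    HasDerivAt (fun t => g (Ω.normalPoint j t ν))
      (deriv g (Ω.normalPoint j t ν) *
        (((Ω.speed j t - ν * Ω.turning j t : ℝ) : ℂ) * Ω.tangent j t)) t := by
  have h1 := (hg.differentiableAt
    (Ω.isOpen.mem_nhds (hε.inside j t ν hν.1 hν.2.le))).hasDerivAt
  exact h1.comp t (Ω.hasDerivAt_normalPoint_left j t ν)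

theorem differentiableOn_deriv (Ω : SmoothDomain n) (hh : DifferentiableOn ℂ h Ω.carrier) :
    DifferentiableOn ℂ (deriv h) Ω.carrier := hh.deriv Ω.isOpen

theorem _root_.HasDerivAt.im {f : ℝ → ℂ} {f' : ℂ} {x : ℝ} (hf : HasDerivAt f f' x) :
    HasDerivAt (fun x => (f x).im) f'.im x :=
  Complex.imCLM.hasFDerivAt.comp_hasDerivAt x hf

/-- The energy `∫ |h|² ds` of `h` on the parallel curve at distance `ν` from the boundary; the
factor `|z'| - ν θ` is the speed of the parallel curve. -/
noncomputable def parallelEnergy (Ω : SmoothDomain n) (h : ℂ → ℂ) (j : Fin n) (ν : ℝ) : ℝ :=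
  ∫ t in (0 : ℝ)..1, (Ω.speed j t - ν * Ω.turning j t) * ‖h (Ω.normalPoint j t ν)‖ ^ 2

/-- Minus one half of the flux of `∇|h|²` through the parallel curve at distance `ν` from the
boundary, in the direction of the inner normal. -/
noncomputable def parallelFlux (Ω : SmoothDomain n) (h : ℂ → ℂ) (j : Fin n) (ν : ℝ) : ℝ :=
  ∫ t in (0 : ℝ)..1, (deriv h (Ω.normalPoint j t ν) *
    (((Ω.speed j t - ν * Ω.turning j t : ℝ) : ℂ) * Ω.tangent j t) *
      conj (h (Ω.normalPoint j t ν))).im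

theorem IsCollar.continuousOn_flux (hε : Ω.IsCollar ε) (hh : DifferentiableOn ℂ h Ω.carrier)
    (j : Fin n) :
    ContinuousOn (fun p : ℝ × ℝ => (deriv h (Ω.normalPoint j p.2 p.1) *
      (((Ω.speed j p.2 - p.1 * Ω.turning j p.2 : ℝ) : ℂ) * Ω.tangent j p.2) *
        conj (h (Ω.normalPoint j p.2 p.1))).im) (Ioo 0 ε ×ˢ univ) := by
  have c0 := hε.continuousOn_comp j hh.continuousOn
  have c1 := hε.continuousOn_comp j (Ω.differentiableOn_deriv hh).continuousOn
  have cR : Continuous fun p : ℝ × ℝ =>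
      ((Ω.speed j p.2 - p.1 * Ω.turning j p.2 : ℝ) : ℂ) * Ω.tangent j p.2 := by fun_prop
  exact Complex.continuous_im.comp_continuousOn ((c1.mul cR.continuousOn).mul
    (Complex.continuous_conj.comp_continuousOn c0))

theorem IsCollar.continuousOn_energy (hε : Ω.IsCollar ε) {g : ℂ → ℂ} (hg : ContinuousOn g Ω.carrier)
    (j : Fin n) :
    ContinuousOn (fun p : ℝ × ℝ => (Ω.speed j p.2 - p.1 * Ω.turning j p.2) *
      ‖g (Ω.normalPoint j p.2 p.1)‖ ^ 2) (Ioo 0 ε ×ˢ univ) := by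
  have c0 := hε.continuousOn_comp j hg
  have cR : Continuous fun p : ℝ × ℝ => Ω.speed j p.2 - p.1 * Ω.turning j p.2 := by fun_prop
  exact cR.continuousOn.mul (c0.norm.pow 2)

/-- The rate of change of the flux, by the divergence theorem and `Δ|h|² = 4 |h'|²`. -/
theorem IsCollar.hasDerivAt_parallelFlux (hε : Ω.IsCollar ε) (hh : DifferentiableOn ℂ h Ω.carrier)
    (j : Fin n) {ν : ℝ} (hν : ν ∈ Ioo 0 ε) :
    HasDerivAt (Ω.parallelFlux h j) (-2 * ∫ t in (0 : ℝ)..1,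
      (Ω.speed j t - ν * Ω.turning j t) * ‖deriv h (Ω.normalPoint j t ν)‖ ^ 2) ν := by
  have hh1 := Ω.differentiableOn_deriv hh
  have hh2 := Ω.differentiableOn_deriv hh1
  -- The normal derivative of the integrand is `A - 2 B`, with `B` the energy density of `h'`.
  set A : ℝ → ℝ → ℝ := fun ν t => (((deriv (deriv h) (Ω.normalPoint j t ν) *
      (((Ω.speed j t - ν * Ω.turning j t : ℝ) : ℂ) * Ω.tangent j t)) * (Complex.I * Ω.tangent j t) +
      deriv h (Ω.normalPoint j t ν) *
        (Complex.I * (Ω.turning j t * (Complex.I * Ω.tangent j t)))) *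
      conj (h (Ω.normalPoint j t ν)) + deriv h (Ω.normalPoint j t ν) * (Complex.I * Ω.tangent j t) *
      conj (deriv h (Ω.normalPoint j t ν) *
        (((Ω.speed j t - ν * Ω.turning j t : ℝ) : ℂ) * Ω.tangent j t))).im with hA
  set B : ℝ → ℝ → ℝ := fun ν t =>
    (Ω.speed j t - ν * Ω.turning j t) * ‖deriv h (Ω.normalPoint j t ν)‖ ^ 2 with hB
  have cA : ContinuousOn (fun p : ℝ × ℝ => A p.1 p.2) (Ioo 0 ε ×ˢ univ) := by
    have c0 := hε.continuousOn_comp j hh.continuousOn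
    have c1 := hε.continuousOn_comp j hh1.continuousOn
    have c2 := hε.continuousOn_comp j hh2.continuousOn
    have cR : Continuous fun p : ℝ × ℝ =>
        ((Ω.speed j p.2 - p.1 * Ω.turning j p.2 : ℝ) : ℂ) * Ω.tangent j p.2 := by fun_prop
    have cI : Continuous fun p : ℝ × ℝ => Complex.I * Ω.tangent j p.2 := by fun_prop
    have cθ : Continuous fun p : ℝ × ℝ =>
        Complex.I * ((Ω.turning j p.2 : ℂ) * (Complex.I * Ω.tangent j p.2)) := by fun_prop
    exact Complex.continuous_im.comp_continuousOn
      (((((c2.mul cR.continuousOn).mul cI.continuousOn).add (c1.mul cθ.continuousOn)).mul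
        (Complex.continuous_conj.comp_continuousOn c0)).add ((c1.mul cI.continuousOn).mul
          (Complex.continuous_conj.comp_continuousOn (c1.mul cR.continuousOn))))
  have cB : ContinuousOn (fun p : ℝ × ℝ => B p.1 p.2) (Ioo 0 ε ×ˢ univ) :=
    hε.continuousOn_energy hh1.continuousOn j
  have key : HasDerivAt (Ω.parallelFlux h j) (∫ t in (0 : ℝ)..1, (A ν t - 2 * B ν t)) ν := by
    refine hasDerivAt_intervalIntegral_of_continuousOn
      (g' := fun ν t => A ν t - 2 * B ν t) hν ?_ ?_ (cA.sub (cB.const_mul 2))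
    · exact fun s hs => continuous_slice (hε.continuousOn_flux hh j) hs
    · intro s hs t
      have d0 := hε.hasDerivAt_comp_right j hh hs t
      have d1 := hε.hasDerivAt_comp_right j hh1 hs t
      have d2 : HasDerivAt (fun s : ℝ => ((Ω.speed j t - s * Ω.turning j t : ℝ) : ℂ) * Ω.tangent j t)
          (((-Ω.turning j t : ℝ) : ℂ) * Ω.tangent j t) s := by
        have := ((((hasDerivAt_id s).mul_const (Ω.turning j t)).const_sub
          (Ω.speed j t)).ofReal_comp).mul_const (Ω.tangent j t)
        exact this.congr_deriv (by simp)
      refine ((d1.mul d2).mul d0.star).im.congr_deriv ?_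
      simp only [hA, hB, Complex.star_def, Pi.mul_apply]
      set r := Ω.speed j t - s * Ω.turning j t
      set T := Ω.tangent j t with hT
      set D := deriv h (Ω.normalPoint j t s)
      set D2 := deriv (deriv h) (Ω.normalPoint j t s)
      set H := h (Ω.normalPoint j t s)
      have hTT : T * conj T = 1 := Ω.tangent_mul_conj j t
      have hDD : D * conj D = ((‖D‖ ^ 2 : ℝ) : ℂ) := by
        rw [Complex.mul_conj, Complex.normSq_eq_norm_sq]
      have hre : 2 * (r * ‖D‖ ^ 2) = (2 * Complex.I * (r : ℂ) * (D * conj D) * (T * conj T)).im := by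
        rw [hDD, hTT]
        have : (2 * Complex.I * (r : ℂ) * ((‖D‖ ^ 2 : ℝ) : ℂ) * 1) =
          ((2 * (r * ‖D‖ ^ 2) : ℝ) : ℂ) * Complex.I := by push_cast; ring
        rw [this, Complex.im_ofReal_mul]; simp
      rw [hre, ← Complex.sub_im]
      congr 1
      simp only [map_mul, Complex.conj_I, Complex.conj_ofReal]
      push_cast
      linear_combination (-D * Ω.turning j t * T * conj H) * Complex.I_mul_I
  -- `A` is also a tangential derivative, so its integral over the period vanishes.
  have hAint : ∫ t in (0 : ℝ)..1, A ν t = 0 := by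
    have : ∀ t, HasDerivAt (fun t => (deriv h (Ω.normalPoint j t ν) * (Complex.I * Ω.tangent j t) *
        conj (h (Ω.normalPoint j t ν))).im) (A ν t) t := by
      intro t
      have d0 := hε.hasDerivAt_comp_left j hh hν t
      have d1 := hε.hasDerivAt_comp_left j hh1 hν t
      exact ((d1.mul ((Ω.hasDerivAt_tangent j t).const_mul Complex.I)).mul d0.star).im
    rw [intervalIntegral.integral_eq_sub_of_hasDerivAt (fun t _ => this t)
      ((continuous_slice cA hν).intervalIntegrable _ _)]
    have p1 := Ω.periodic_normalPoint j ν 0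
    have p2 := Ω.periodic_tangent j 0
    simp only [zero_add] at p1 p2
    rw [p1, p2, sub_self]
  convert key using 1
  rw [intervalIntegral.integral_sub ((continuous_slice cA hν).intervalIntegrable _ _)
    (((continuous_slice cB hν).intervalIntegrable _ _).const_mul 2), hAint,
    intervalIntegral.integral_const_mul]
  ring

theorem IsCollar.jacobian_le (hε : Ω.IsCollar ε) (j : Fin n) (t : ℝ) {ν : ℝ} (hν : ν ∈ Ioo 0 ε) :
    Ω.speed j t / 2 ≤ Ω.speed j t - ν * Ω.turning j t ∧
      Ω.speed j t - ν * Ω.turning j t ≤ 3 / 2 * Ω.speed j t := by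
  have := abs_le.1 (hε.jacobian j t ν (by rw [abs_of_pos hν.1]; exact hν.2.le))
  constructor <;> linarith

theorem IsCollar.abs_turning_le (hε : Ω.IsCollar ε) (j : Fin n) (t : ℝ) {ν : ℝ}
    (hν : ν ∈ Ioo 0 ε) : |Ω.turning j t| ≤ ε⁻¹ * (Ω.speed j t - ν * Ω.turning j t) := by
  have h1 := hε.jacobian j t ε (by rw [abs_of_pos hε.pos])
  rw [abs_mul, abs_of_pos hε.pos] at h1
  rw [le_inv_mul_iff₀ hε.pos]
  exact h1.trans (hε.jacobian_le j t hν).1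

theorem IsCollar.antitoneOn_parallelFlux (hε : Ω.IsCollar ε)
    (hh : DifferentiableOn ℂ h Ω.carrier) (j : Fin n) :
    AntitoneOn (Ω.parallelFlux h j) (Ioo 0 ε) := by
  refine antitoneOn_of_deriv_nonpos (convex_Ioo 0 ε)
    (fun ν hν => (hε.hasDerivAt_parallelFlux hh j hν).continuousAt.continuousWithinAt)
    (fun ν hν => ?_) (fun ν hν => ?_) <;> rw [interior_Ioo] at hν
  · exact (hε.hasDerivAt_parallelFlux hh j hν).differentiableAt.differentiableWithinAt
  · rw [(hε.hasDerivAt_parallelFlux hh j hν).deriv]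
    have : 0 ≤ ∫ t in (0 : ℝ)..1,
        (Ω.speed j t - ν * Ω.turning j t) * ‖deriv h (Ω.normalPoint j t ν)‖ ^ 2 :=
      intervalIntegral.integral_nonneg zero_le_one fun t _ => mul_nonneg
        ((half_pos (Ω.speed_pos j t)).le.trans (hε.jacobian_le j t hν).1) (by positivity)
    linarith

/-- The rate of change of the energy is the flux, up to a curvature term bounded by the energy. -/
theorem IsCollar.hasDerivAt_parallelEnergy (hε : Ω.IsCollar ε)
    (hh : DifferentiableOn ℂ h Ω.carrier) (j : Fin n) {ν : ℝ} (hν : ν ∈ Ioo 0 ε) :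
    ∃ e, |e| ≤ ε⁻¹ * Ω.parallelEnergy h j ν ∧
      HasDerivAt (Ω.parallelEnergy h j) (e - 2 * Ω.parallelFlux h j ν) ν := by
  have hh1 := Ω.differentiableOn_deriv hh
  have c0 := hε.continuousOn_comp j hh.continuousOn
  have cθ : ContinuousOn (fun p : ℝ × ℝ => -Ω.turning j p.2 * ‖h (Ω.normalPoint j p.2 p.1)‖ ^ 2)
      (Ioo 0 ε ×ˢ univ) :=
    (by fun_prop : Continuous fun p : ℝ × ℝ => -Ω.turning j p.2).continuousOn.mul (c0.norm.pow 2)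
  have cF := hε.continuousOn_flux hh j
  have cE := hε.continuousOn_energy hh.continuousOn j
  have i1 : IntervalIntegrable (fun t => -Ω.turning j t * ‖h (Ω.normalPoint j t ν)‖ ^ 2) volume 0 1 :=
    (continuous_slice cθ hν).intervalIntegrable _ _
  have i2 : IntervalIntegrable (fun t => (deriv h (Ω.normalPoint j t ν) *
    (((Ω.speed j t - ν * Ω.turning j t : ℝ) : ℂ) * Ω.tangent j t) *
      conj (h (Ω.normalPoint j t ν))).im) volume 0 1 :=
    (continuous_slice cF hν).intervalIntegrable _ _
  have i3 : IntervalIntegrable (fun t => (Ω.speed j t - ν * Ω.turning j t) *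
      ‖h (Ω.normalPoint j t ν)‖ ^ 2) volume 0 1 :=
    (continuous_slice cE hν).intervalIntegrable _ _
  refine ⟨∫ t in (0 : ℝ)..1, -Ω.turning j t * ‖h (Ω.normalPoint j t ν)‖ ^ 2, ?_, ?_⟩
  · rw [parallelEnergy, ← intervalIntegral.integral_const_mul, ← Real.norm_eq_abs]
    refine intervalIntegral.norm_integral_le_of_norm_le zero_le_one ?_ (i3.const_mul _)
    refine Eventually.of_forall fun t _ => ?_
    rw [norm_mul, norm_neg, Real.norm_eq_abs, Real.norm_of_nonneg (by positivity), ← mul_assoc]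
    gcongr
    exact hε.abs_turning_le j t hν
  · have key : HasDerivAt (Ω.parallelEnergy h j) (∫ t in (0 : ℝ)..1,
        (-Ω.turning j t * ‖h (Ω.normalPoint j t ν)‖ ^ 2 - 2 * (deriv h (Ω.normalPoint j t ν) *
    (((Ω.speed j t - ν * Ω.turning j t : ℝ) : ℂ) * Ω.tangent j t) *
      conj (h (Ω.normalPoint j t ν))).im)) ν := by
      refine hasDerivAt_intervalIntegral_of_continuousOn (g' := fun ν t =>
        (-Ω.turning j t * ‖h (Ω.normalPoint j t ν)‖ ^ 2 - 2 * (deriv h (Ω.normalPoint j t ν) *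
    (((Ω.speed j t - ν * Ω.turning j t : ℝ) : ℂ) * Ω.tangent j t) *
      conj (h (Ω.normalPoint j t ν))).im)) hν ?_ ?_ ?_
      · exact fun s hs => continuous_slice cE hs
      · intro s hs t
        have d0 := (hε.hasDerivAt_comp_right j hh hs t).norm_sq
        have d2 := ((hasDerivAt_id s).mul_const (Ω.turning j t)).const_sub (Ω.speed j t)
        refine (d2.mul d0).congr_deriv ?_
        simp only [Complex.inner, id_eq, one_mul]
        generalize deriv h (Ω.normalPoint j t s) = D
        generalize h (Ω.normalPoint j t s) = H
        generalize Ω.tangent j t = T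
        have : D * (((Ω.speed j t - s * Ω.turning j t : ℝ) : ℂ) * T) * conj H =
          ((Ω.speed j t - s * Ω.turning j t : ℝ) : ℂ) * (D * T * conj H) := by ring
        rw [this, Complex.im_ofReal_mul,
          show D * (Complex.I * T) * conj H = Complex.I * (D * T * conj H) by ring,
          Complex.I_mul_re]
        ring
      · exact cθ.sub (cF.const_mul 2)
    refine key.congr_deriv ?_
    rw [intervalIntegral.integral_sub i1 (i2.const_mul 2), intervalIntegral.integral_const_mul]
    rfl

/-- **Hardy convexity.** Since the flux of `∇|h|²` is monotone, the energy on a parallel curve is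
dominated by the energies on two curves that enclose it. -/
theorem IsCollar.parallelEnergy_le_max (hε : Ω.IsCollar ε) (hh : DifferentiableOn ℂ h Ω.carrier)
    (j : Fin n) {μ ν ν₁ : ℝ} (hμ : 0 < μ) (hμν : μ ≤ ν) (hν : ν ≤ ν₁) (hν₁ : ν₁ < ε) :
    Ω.parallelEnergy h j ν ≤
      Real.exp 1 * max (Ω.parallelEnergy h j μ) (Ω.parallelEnergy h j ν₁) := by
  have hεp := hε.pos
  have hnn {s : ℝ} (hs : s ∈ Ioo 0 ε) : 0 ≤ Ω.parallelEnergy h j s :=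
    intervalIntegral.integral_nonneg zero_le_one fun t _ => mul_nonneg
      ((half_pos (Ω.speed_pos j t)).le.trans (hε.jacobian_le j t hs).1) (by positivity)
  have hexp (c : ℝ) (s : ℝ) : HasDerivAt (fun s => Real.exp (c * s)) (c * Real.exp (c * s)) s :=
    (((hasDerivAt_id s).const_mul c).exp).congr_deriv (by simp [mul_comm])
  have hanti := hε.antitoneOn_parallelFlux hh j
  have mem {s a b : ℝ} (ha : 0 < a) (hb : b < ε) (hs : s ∈ Icc a b) : s ∈ Ioo 0 ε :=
    ⟨ha.trans_le hs.1, hs.2.trans_lt hb⟩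
  have hνp : 0 < ν := hμ.trans_le hμν
  have hνε : ν < ε := hν.trans_lt hν₁
  have hνm : ν ∈ Ioo 0 ε := ⟨hνp, hνε⟩
  choose! e he hder using fun s hs => hε.hasDerivAt_parallelEnergy hh j (ν := s) hs
  have hd (c : ℝ) (s : ℝ) (hs : s ∈ Ioo 0 ε) :
      HasDerivAt (fun s => Ω.parallelEnergy h j s * Real.exp (c * s))
        ((e s - 2 * Ω.parallelFlux h j s) * Real.exp (c * s) +
          Ω.parallelEnergy h j s * (c * Real.exp (c * s))) s := (hder s hs).mul (hexp c s)
  have fin {x a b : ℝ} (hx : 0 ≤ x) (hab : Real.exp a * Ω.parallelEnergy h j ν ≤ Real.exp b * x)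
      (hba : b ≤ a + 1) : Ω.parallelEnergy h j ν ≤ Real.exp 1 * x := by
    have : Real.exp b ≤ Real.exp a * Real.exp 1 := by
      rw [← Real.exp_add]; exact Real.exp_le_exp.2 hba
    have h3 : Real.exp b * x ≤ Real.exp a * Real.exp 1 * x := mul_le_mul_of_nonneg_right this hx
    have h4 := hab.trans h3
    rw [mul_assoc] at h4
    exact le_of_mul_le_mul_left h4 (Real.exp_pos a)
  -- If the flux at `ν` is nonpositive, then the energy times `exp (s / ε)` increases from `ν` to
  -- `ν₁`; otherwise the energy times `exp (-s / ε)` decreases from `μ` to `ν`.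
  rcases le_total (Ω.parallelFlux h j ν) 0 with h0 | h0
  · have hmono : MonotoneOn (fun s => Ω.parallelEnergy h j s * Real.exp (ε⁻¹ * s)) (Icc ν ν₁) := by
      refine monotoneOn_of_deriv_nonneg (convex_Icc _ _)
        (fun s hs => (hd ε⁻¹ s (mem hνp hν₁ hs)).continuousAt.continuousWithinAt)
        (fun s hs => ?_) (fun s hs => ?_)
      · exact (hd ε⁻¹ s (mem hνp hν₁ (interior_subset hs))).differentiableAt.differentiableWithinAt
      · have hs' := interior_subset hs
        have hm := mem hνp hν₁ hs'
        rw [(hd ε⁻¹ s hm).deriv]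
        have h1 := (hanti hνm hm hs'.1).trans h0
        have h2 := (abs_le.1 (he s hm)).1
        have : 0 ≤ (e s - 2 * Ω.parallelFlux h j s + ε⁻¹ * Ω.parallelEnergy h j s) *
          Real.exp (ε⁻¹ * s) := mul_nonneg (by linarith) (Real.exp_pos _).le
        linarith
    have h1 := hmono ⟨le_rfl, hν⟩ ⟨hν, le_rfl⟩ hν
    simp only at h1
    rw [mul_comm, mul_comm (Ω.parallelEnergy h j ν₁)] at h1
    have h2 := fin (hnn ⟨hνp.trans_le hν, hν₁⟩) h1 (by
      have : ε⁻¹ * ν₁ ≤ 1 := by rw [inv_mul_le_one₀ hεp]; exact hν₁.le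
      have : 0 ≤ ε⁻¹ * ν := by positivity
      linarith)
    exact h2.trans (mul_le_mul_of_nonneg_left (le_max_right _ _) (Real.exp_pos 1).le)
  · have hmono : AntitoneOn (fun s => Ω.parallelEnergy h j s * Real.exp (-ε⁻¹ * s)) (Icc μ ν) := by
      refine antitoneOn_of_deriv_nonpos (convex_Icc _ _)
        (fun s hs => (hd (-ε⁻¹) s (mem hμ hνε hs)).continuousAt.continuousWithinAt)
        (fun s hs => ?_) (fun s hs => ?_)
      · exact (hd (-ε⁻¹) s (mem hμ hνε (interior_subset hs))).differentiableAt.differentiableWithinAt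
      · have hs' := interior_subset hs
        have hm := mem hμ hνε hs'
        rw [(hd (-ε⁻¹) s hm).deriv]
        have h1 := h0.trans (hanti hm hνm hs'.2)
        have h2 := (abs_le.1 (he s hm)).2
        have : 0 ≤ (-e s + 2 * Ω.parallelFlux h j s + ε⁻¹ * Ω.parallelEnergy h j s) *
          Real.exp (-ε⁻¹ * s) := mul_nonneg (by linarith) (Real.exp_pos _).le
        linarith
    have h1 := hmono ⟨le_rfl, hμν⟩ ⟨hμν, le_rfl⟩ hμν
    simp only at h1
    rw [mul_comm, mul_comm (Ω.parallelEnergy h j μ)] at h1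
    have h2 := fin (hnn ⟨hμ, hμν.trans_lt hνε⟩) h1 (by
      have : ε⁻¹ * ν ≤ 1 := by rw [inv_mul_le_one₀ hεp]; exact hνε.le
      have : 0 ≤ ε⁻¹ * μ := by positivity
      linarith)
    exact h2.trans (mul_le_mul_of_nonneg_left (le_max_left _ _) (Real.exp_pos 1).le)

theorem eLpNorm_arcLength_sq (Ω : SmoothDomain n) (j : Fin n) {g : ℝ → ℂ} (hg : Continuous g) :
    eLpNorm g 2 (Ω.arcLength j) ^ 2 =
      ENNReal.ofReal (∫ t in (0 : ℝ)..1, Ω.speed j t * ‖g t‖ ^ 2) := by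
  have cs := Ω.continuous_speed j
  have hi : IntegrableOn (fun t => Ω.speed j t * ‖g t‖ ^ 2) (Ico 0 1) :=
    (Continuous.integrableOn_Icc (by fun_prop)).mono_set Ico_subset_Icc_self
  rw [intervalIntegral.integral_of_le zero_le_one, ← integral_Ico_eq_integral_Ioc,
    ofReal_integral_eq_lintegral_ofReal hi
      (Eventually.of_forall fun t => mul_nonneg (Ω.speed_pos j t).le (by positivity)),
    eLpNorm_eq_lintegral_rpow_enorm_toReal (by norm_num) (by norm_num)]
  have hm : Measurable fun t => ENNReal.ofReal ‖deriv (Ω.curve j) t‖ :=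
    ENNReal.measurable_ofReal.comp cs.measurable
  rw [arcLength, lintegral_withDensity_eq_lintegral_mul _ hm
    (g := fun x => ‖g x‖ₑ ^ (2 : ENNReal).toReal) ((ENNReal.continuous_rpow_const.comp hg.enorm).measurable)]
  rw [← ENNReal.rpow_two, ← ENNReal.rpow_mul]
  simp only [ENNReal.toReal_ofNat]
  rw [show (1 / 2 * 2 : ℝ) = 1 by norm_num, ENNReal.rpow_one]
  refine lintegral_congr fun t => ?_
  rw [ENNReal.ofReal_mul (Ω.speed_pos j t).le, Pi.mul_apply, ENNReal.rpow_two,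
    ENNReal.ofReal_pow (norm_nonneg _), ofReal_norm (g t)]
  rfl

/-- Hardy convexity in terms of the arc length of the boundary itself. -/
theorem IsCollar.eLpNorm_le_max (hε : Ω.IsCollar ε) (hh : DifferentiableOn ℂ h Ω.carrier)
    (j : Fin n) {μ ν ν₁ : ℝ} (hμ : 0 < μ) (hμν : μ ≤ ν) (hν : ν ≤ ν₁) (hν₁ : ν₁ < ε) :
    eLpNorm (fun t => h (Ω.normalPoint j t ν)) 2 (Ω.arcLength j) ≤
      3 * max (eLpNorm (fun t => h (Ω.normalPoint j t μ)) 2 (Ω.arcLength j))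
        (eLpNorm (fun t => h (Ω.normalPoint j t ν₁)) 2 (Ω.arcLength j)) := by
  have cE {s : ℝ} (hs : s ∈ Ioo 0 ε) : Continuous fun t =>
      (Ω.speed j t - s * Ω.turning j t) * ‖h (Ω.normalPoint j t s)‖ ^ 2 :=
    continuous_slice (hε.continuousOn_energy hh.continuousOn j) hs
  have cS {s : ℝ} (hs : s ∈ Ioo 0 ε) :
      Continuous fun t => Ω.speed j t * ‖h (Ω.normalPoint j t s)‖ ^ 2 :=
    (Ω.continuous_speed j).mul ((hε.continuous_comp j hh.continuousOn hs).norm.pow 2)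
  have bounds {s : ℝ} (hs : s ∈ Ioo 0 ε) :
      (∫ t in (0 : ℝ)..1, Ω.speed j t * ‖h (Ω.normalPoint j t s)‖ ^ 2) ≤
          2 * Ω.parallelEnergy h j s ∧
        Ω.parallelEnergy h j s ≤
          3 / 2 * ∫ t in (0 : ℝ)..1, Ω.speed j t * ‖h (Ω.normalPoint j t s)‖ ^ 2 := by
    rw [parallelEnergy, ← intervalIntegral.integral_const_mul, ← intervalIntegral.integral_const_mul]
    constructor
    · refine intervalIntegral.integral_mono_on zero_le_one ((cS hs).intervalIntegrable _ _)
        (((cE hs).const_mul 2).intervalIntegrable _ _) fun t _ => ?_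
      rw [← mul_assoc]
      gcongr
      linarith [(hε.jacobian_le j t hs).1]
    · refine intervalIntegral.integral_mono_on zero_le_one ((cE hs).intervalIntegrable _ _)
        (((cS hs).const_mul (3 / 2)).intervalIntegrable _ _) fun t _ => ?_
      rw [← mul_assoc]
      gcongr
      exact (hε.jacobian_le j t hs).2
  have mν : ν ∈ Ioo 0 ε := ⟨hμ.trans_le hμν, hν.trans_lt hν₁⟩
  have mμ : μ ∈ Ioo 0 ε := ⟨hμ, hμν.trans_lt mν.2⟩
  have mν₁ : ν₁ ∈ Ioo 0 ε := ⟨mν.1.trans_le hν, hν₁⟩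
  have h1 := hε.parallelEnergy_le_max hh j hμ hμν hν hν₁
  -- The constant comes from `2 * exp 1 * (3 / 2) ≤ 9`.
  have h2 : (∫ t in (0 : ℝ)..1, Ω.speed j t * ‖h (Ω.normalPoint j t ν)‖ ^ 2) ≤ 9 * max
      (∫ t in (0 : ℝ)..1, Ω.speed j t * ‖h (Ω.normalPoint j t μ)‖ ^ 2)
      (∫ t in (0 : ℝ)..1, Ω.speed j t * ‖h (Ω.normalPoint j t ν₁)‖ ^ 2) := by
    have h3 := max_le_max (bounds mμ).2 (bounds mν₁).2
    rw [← mul_max_of_nonneg _ _ (by norm_num : (0 : ℝ) ≤ 3 / 2)] at h3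
    have h4 := Real.exp_one_lt_d9.le.trans (by norm_num : (2.7182818286 : ℝ) ≤ 3)
    have h5 : 0 ≤ max (∫ t in (0 : ℝ)..1, Ω.speed j t * ‖h (Ω.normalPoint j t μ)‖ ^ 2)
      (∫ t in (0 : ℝ)..1, Ω.speed j t * ‖h (Ω.normalPoint j t ν₁)‖ ^ 2) :=
      le_max_of_le_left (intervalIntegral.integral_nonneg zero_le_one
        fun t _ => mul_nonneg (Ω.speed_pos j t).le (by positivity))
    have h6 := mul_le_mul h4 h3 ((by
      refine le_max_of_le_left (intervalIntegral.integral_nonneg zero_le_one fun t _ => mul_nonneg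
      ((half_pos (Ω.speed_pos j t)).le.trans (hε.jacobian_le j t mμ).1) (by positivity)) :
        0 ≤ max (Ω.parallelEnergy h j μ) (Ω.parallelEnergy h j ν₁))) (by norm_num)
    linarith [(bounds mν).1]
  refine (ENNReal.pow_le_pow_left_iff two_ne_zero).1 ?_
  rw [mul_pow,
    (pow_left_mono 2 : Monotone fun x : ENNReal => x ^ 2).map_max,
    Ω.eLpNorm_arcLength_sq j (hε.continuous_comp j hh.continuousOn mν),
    Ω.eLpNorm_arcLength_sq j (hε.continuous_comp j hh.continuousOn mμ),
    Ω.eLpNorm_arcLength_sq j (hε.continuous_comp j hh.continuousOn mν₁),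
    ← ENNReal.ofReal_mono.map_max]
  refine (ENNReal.ofReal_le_ofReal h2).trans ?_
  rw [ENNReal.ofReal_mul (by norm_num)]
  norm_num

theorem IsHardy.tendsto_eLpNorm {u : ℂ → ℂ} (hh : Ω.IsHardy h u) (j : Fin n) :
    Tendsto (fun ν => eLpNorm (fun t => h (Ω.normalPoint j t ν)) 2 (Ω.arcLength j)) (𝓝[>] 0)
      (𝓝 (eLpNorm (fun t => u (Ω.curve j t)) 2 (Ω.arcLength j))) := by
  obtain ⟨ε, hε⟩ := Ω.exists_isCollar
  have ht : Tendsto (fun ν => eLpNorm (fun t => h (Ω.normalPoint j t ν) - u (Ω.curve j t)) 2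
    (Ω.arcLength j)) (𝓝[>] 0) (𝓝 0) := hh.tendsto j
  have hm : ∀ᶠ ν in 𝓝[>] (0 : ℝ), Continuous fun t => h (Ω.normalPoint j t ν) := by
    filter_upwards [Ioo_mem_nhdsGT hε.pos] with ν hν
    exact hε.continuous_comp j hh.holomorphic.continuousOn hν
  have hu := (hh.memL2 j).aestronglyMeasurable
  have hufin := (hh.memL2 j).eLpNorm_lt_top
  refine tendsto_of_tendsto_of_tendsto_of_le_of_le'
    (g := fun ν => eLpNorm (fun t => u (Ω.curve j t)) 2 (Ω.arcLength j) -
      eLpNorm (fun t => h (Ω.normalPoint j t ν) - u (Ω.curve j t)) 2 (Ω.arcLength j))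
    (h := fun ν => eLpNorm (fun t => u (Ω.curve j t)) 2 (Ω.arcLength j) +
      eLpNorm (fun t => h (Ω.normalPoint j t ν) - u (Ω.curve j t)) 2 (Ω.arcLength j)) ?_ ?_ ?_ ?_
  · simpa using ENNReal.Tendsto.sub tendsto_const_nhds ht (Or.inl hufin.ne)
  · simpa using tendsto_const_nhds.add ht
  · filter_upwards [hm] with ν hν
    rw [tsub_le_iff_right]
    have h1 := eLpNorm_sub_le (μ := Ω.arcLength j) (p := 2) hν.aestronglyMeasurable
      (hν.aestronglyMeasurable.sub hu) (by norm_num)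
    rwa [sub_sub_cancel] at h1
  · filter_upwards [hm] with ν hν
    have h1 := eLpNorm_add_le (μ := Ω.arcLength j) (p := 2) hu
      (hν.aestronglyMeasurable.sub hu) (by norm_num)
    rwa [add_sub_cancel] at h1

/-- The norms of a Hardy function on the parallel curves are controlled by its boundary values and
its values on one curve inside. -/
theorem IsHardy.eLpNorm_le_max {u : ℂ → ℂ} (hh : Ω.IsHardy h u) (hε : Ω.IsCollar ε)
    (j : Fin n) {ν ν₁ : ℝ} (hν0 : 0 < ν) (hν : ν ≤ ν₁) (hν₁ : ν₁ < ε) :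
    eLpNorm (fun t => h (Ω.normalPoint j t ν)) 2 (Ω.arcLength j) ≤
      3 * max (eLpNorm (fun t => u (Ω.curve j t)) 2 (Ω.arcLength j))
        (eLpNorm (fun t => h (Ω.normalPoint j t ν₁)) 2 (Ω.arcLength j)) := by
  refine ge_of_tendsto (ENNReal.Tendsto.const_mul
    ((hh.tendsto_eLpNorm j).max tendsto_const_nhds) (Or.inr (by norm_num))) ?_
  filter_upwards [Ioc_mem_nhdsGT hν0] with μ hμ
  exact hε.eLpNorm_le_max hh.holomorphic j hμ.1 hμ.2 hν hν₁

end SmoothDomain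

/-! ### The Cauchy–Pompeiu formula -/

/-- The Wirtinger derivative `2 ∂χ/∂z̄ = ∂χ/∂x + i ∂χ/∂y` of a real-valued function. -/
noncomputable def dbar (χ : ℂ → ℝ) (z : ℂ) : ℂ :=
  fderiv ℝ χ z 1 + Complex.I * fderiv ℝ χ z Complex.I

theorem norm_dbar_le {χ : ℂ → ℝ} {C : ℝ} {z : ℂ} (h : ‖fderiv ℝ χ z‖ ≤ C) :
    ‖dbar χ z‖ ≤ 2 * C := by
  have h1 : ‖fderiv ℝ χ z 1‖ ≤ C := by
    simpa using ((fderiv ℝ χ z).le_opNorm 1).trans (mul_le_mul_of_nonneg_right h (norm_nonneg _))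
  have h2 : ‖fderiv ℝ χ z Complex.I‖ ≤ C := by
    simpa using
      ((fderiv ℝ χ z).le_opNorm Complex.I).trans (mul_le_mul_of_nonneg_right h (norm_nonneg _))
  calc ‖dbar χ z‖ ≤ ‖(fderiv ℝ χ z 1 : ℂ)‖ + ‖Complex.I * (fderiv ℝ χ z Complex.I : ℂ)‖ :=
        norm_add_le _ _
    _ ≤ 2 * C := by
      rw [norm_mul, Complex.norm_I, one_mul, Complex.norm_real, Complex.norm_real]; linarith

theorem continuous_dbar {χ : ℂ → ℝ} (hχ : ContDiff ℝ 1 χ) : Continuous (dbar χ) := by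
  have h := hχ.continuous_fderiv one_ne_zero
  unfold dbar
  fun_prop

theorem dbar_eq_zero_of_eventuallyEq {χ : ℂ → ℝ} {z : ℂ} {c : ℝ} (h : χ =ᶠ[𝓝 z] fun _ => c) :
    dbar χ z = 0 := by
  have : fderiv ℝ χ z = 0 := by rw [h.fderiv_eq]; simp
  simp [dbar, this]

theorem support_dbar_subset {χ : ℂ → ℝ} : Function.support (dbar χ) ⊆ tsupport χ := by
  intro z hz
  by_contra h
  exact hz (dbar_eq_zero_of_eventuallyEq (c := 0) (notMem_tsupport_iff_eventuallyEq.1 h))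

theorem integral_fderiv_apply_eq_zero {G : ℂ → ℂ} (hG : ContDiff ℝ 1 G) (hc : HasCompactSupport G)
    (v : ℂ) : ∫ z, fderiv ℝ G z v = 0 := by
  have h := integral_mul_fderiv_eq_neg_fderiv_mul_of_integrable (𝕜 := ℂ) (μ := (volume : Measure ℂ))
    (f := fun _ => (1 : ℂ)) (g := G) (v := v) (by simp) ?_ ?_ (fun _ _ => differentiableAt_const _)
    (fun x _ => hG.differentiable one_ne_zero x)
  · simpa using h
  · simp only [one_mul]
    exact ((hG.continuous_fderiv one_ne_zero).clm_apply continuous_const).integrable_of_hasCompactSupport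
      ((hc.fderiv_apply (𝕜 := ℝ) v))
  · simpa using hG.continuous.integrable_of_hasCompactSupport hc

/-- Stokes' theorem for a holomorphic function and a compactly supported cutoff. -/
theorem integral_dbar_mul_eq_zero {χ : ℂ → ℝ} (hχ : ContDiff ℝ ∞ χ) (hc : HasCompactSupport χ)
    {U : Set ℂ} (hU : IsOpen U) (hsub : tsupport χ ⊆ U) {g : ℂ → ℂ} (hg : DifferentiableOn ℂ g U) :
    ∫ z, dbar χ z * g z = 0 := by
  set G : ℂ → ℂ := fun z => (χ z : ℂ) * g z with hGdef
  have hsupp : tsupport G ⊆ tsupport χ := by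
    refine closure_mono fun z hz => ?_
    simp only [hGdef, Function.mem_support] at hz ⊢
    intro h; apply hz; simp [h]
  have hg1 : ContDiffOn ℝ 1 g U := (hg.contDiffOn hU).restrict_scalars ℝ
  have hGc : ContDiff ℝ 1 G := by
    refine contDiff_iff_contDiffAt.2 fun z => ?_
    by_cases hz : z ∈ tsupport G
    swap
    · exact contDiffAt_const.congr_of_eventuallyEq (notMem_tsupport_iff_eventuallyEq.1 hz)
    have hz' := hsub (hsupp hz)
    exact (Complex.ofRealCLM.contDiff.comp (hχ.of_le (by exact_mod_cast le_top))).contDiffAt.mul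
      (hg1.contDiffAt (hU.mem_nhds hz'))
  have hcG : HasCompactSupport G := hc.of_isClosed_subset (isClosed_tsupport G) hsupp
  have key (z : ℂ) : dbar χ z * g z = fderiv ℝ G z 1 + Complex.I * fderiv ℝ G z Complex.I := by
    by_cases hz : z ∈ tsupport χ
    · have hz' := hsub hz
      have h1 : HasFDerivAt (fun z => (χ z : ℂ)) (Complex.ofRealCLM.comp (fderiv ℝ χ z)) z :=
        Complex.ofRealCLM.hasFDerivAt.comp z (hχ.differentiable (by simp) z).hasFDerivAt
      have h2 : HasFDerivAt g
          ((ContinuousLinearMap.toSpanSingleton ℂ (deriv g z)).restrictScalars ℝ) z :=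
        ((hg.differentiableAt (hU.mem_nhds hz')).hasDerivAt.hasFDerivAt).restrictScalars ℝ
      have h3 : HasFDerivAt G _ z := h1.mul h2
      rw [h3.fderiv]
      simp [dbar]
      linear_combination (-(χ z : ℂ) * deriv g z) * Complex.I_mul_I
    · have h0 := notMem_tsupport_iff_eventuallyEq.1 hz
      have hG0 : G =ᶠ[𝓝 z] fun _ => 0 := notMem_tsupport_iff_eventuallyEq.1 fun h => hz (hsupp h)
      rw [dbar_eq_zero_of_eventuallyEq h0, hG0.fderiv_eq]
      simp
  have hint (v : ℂ) : Integrable fun z => fderiv ℝ G z v :=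
    ((hGc.continuous_fderiv one_ne_zero).clm_apply continuous_const).integrable_of_hasCompactSupport
      (hcG.fderiv_apply (𝕜 := ℝ) v)
  simp_rw [key]
  rw [integral_add (hint 1) ((hint Complex.I).const_mul _), integral_const_mul,
    integral_fderiv_apply_eq_zero hGc hcG, integral_fderiv_apply_eq_zero hGc hcG]
  simp

/-- A radial cutoff function: it is `1` on the unit disc and has compact support. -/
noncomputable def radialCutoff (z : ℂ) : ℝ := Real.smoothTransition (2 - Complex.normSq z)

theorem contDiff_radialCutoff : ContDiff ℝ ∞ radialCutoff := by
  refine Real.smoothTransition.contDiff.comp (contDiff_const.sub ?_)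
  have : (⇑Complex.normSq : ℂ → ℝ) = fun z : ℂ => z.re * z.re + z.im * z.im :=
    funext Complex.normSq_apply
  rw [this]
  exact (Complex.reCLM.contDiff.mul Complex.reCLM.contDiff).add
    (Complex.imCLM.contDiff.mul Complex.imCLM.contDiff)

theorem hasCompactSupport_radialCutoff : HasCompactSupport radialCutoff := by
  refine HasCompactSupport.intro (isCompact_closedBall (0 : ℂ) 2) fun z hz => ?_
  refine Real.smoothTransition.zero_of_nonpos ?_
  simp only [Metric.mem_closedBall, dist_zero_right, not_le] at hz
  rw [Complex.normSq_eq_norm_sq]; nlinarith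

theorem radialCutoff_eventuallyEq : radialCutoff =ᶠ[𝓝 0] fun _ => 1 := by
  filter_upwards [Metric.ball_mem_nhds (0 : ℂ) one_pos] with z hz
  refine Real.smoothTransition.one_of_one_le ?_
  rw [mem_ball_zero_iff] at hz
  rw [Complex.normSq_eq_norm_sq]; nlinarith [norm_nonneg z]

theorem dbar_radialCutoff_div (z : ℂ) : dbar radialCutoff z / z =
    if z = 0 then 0 else ((-2 * deriv Real.smoothTransition (2 - Complex.normSq z) : ℝ) : ℂ) := by
  split_ifs with h
  · simp [h]
  have hd : HasFDerivAt (fun z : ℂ => 2 - Complex.normSq z)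
      (-((2 * z.re) • Complex.reCLM + (2 * z.im) • Complex.imCLM)) z := by
    have h1 := (Complex.reCLM.hasFDerivAt (x := z)).mul (Complex.reCLM.hasFDerivAt (x := z))
    have h2 := (Complex.imCLM.hasFDerivAt (x := z)).mul (Complex.imCLM.hasFDerivAt (x := z))
    refine ((h1.add h2).const_sub 2).congr_fderiv ?_
    ext
    simp
    ring
  have h1 := ((Real.smoothTransition.contDiff (n := 1)).differentiable one_ne_zero
    (2 - Complex.normSq z)).hasDerivAt.comp_hasFDerivAt z hd
  have h2 : fderiv ℝ radialCutoff z = _ := h1.fderiv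
  rw [dbar, h2, div_eq_iff h]
  simp
  apply Complex.ext <;> simp <;> ring

/-- The constant in the Cauchy–Pompeiu formula. Its value is `-2π`, but only that it does not vanish
is needed. -/
theorem integral_dbar_radialCutoff_div_ne_zero : ∫ z, dbar radialCutoff z / z ≠ 0 := by
  set η : ℂ → ℝ := fun z => 2 * deriv Real.smoothTransition (2 - Complex.normSq z) with hη
  have hS : ContDiff ℝ 1 Real.smoothTransition := Real.smoothTransition.contDiff
  have hηc : Continuous η := by
    have := hS.continuous_deriv le_rfl
    have := Complex.continuous_normSq
    fun_prop
  have hηs : HasCompactSupport η := by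
    refine HasCompactSupport.intro (isCompact_closedBall (0 : ℂ) 2) fun z hz => ?_
    simp only [Metric.mem_closedBall, dist_zero_right, not_le] at hz
    have h1 : 2 - Complex.normSq z < 0 := by rw [Complex.normSq_eq_norm_sq]; nlinarith
    have h2 : Real.smoothTransition =ᶠ[𝓝 (2 - Complex.normSq z)] fun _ => 0 := by
      filter_upwards [Iio_mem_nhds h1] with x hx
      exact Real.smoothTransition.zero_of_nonpos hx.le
    simp [hη, h2.deriv_eq]
  have hη0 : 0 ≤ η := fun z => mul_nonneg zero_le_two (Real.smoothTransition.monotone.deriv_nonneg)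
  obtain ⟨s, hs, hs'⟩ := exists_deriv_eq_slope Real.smoothTransition one_pos
    Real.smoothTransition.continuous.continuousOn
    (hS.differentiable one_ne_zero).differentiableOn
  rw [Real.smoothTransition.one, Real.smoothTransition.zero] at hs'
  have hx : η (Real.sqrt (2 - s) : ℂ) ≠ 0 := by
    have : Complex.normSq (Real.sqrt (2 - s) : ℂ) = 2 - s := by
      rw [Complex.normSq_ofReal, Real.mul_self_sqrt]; linarith [hs.2]
    simp [hη, this, hs']
  have hpos := hηc.integral_pos_of_hasCompactSupport_nonneg_nonzero (μ := volume) hηs hη0 hx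
  have heq : ∫ z, dbar radialCutoff z / z = ((-∫ z, η z : ℝ) : ℂ) := by
    rw [← integral_neg, ← integral_complex_ofReal]
    refine integral_congr_ae ?_
    have h0 : ∀ᵐ z : ℂ, z ≠ 0 := by simp [ae_iff]
    filter_upwards [h0] with z hz
    rw [dbar_radialCutoff_div, if_neg hz]
    simp [hη]
  rw [heq]
  exact_mod_cast (neg_lt_zero.2 hpos).ne

/-- **Cauchy–Pompeiu.** A holomorphic function is reproduced by the derivative of a cutoff. -/
theorem integral_dbar_mul_div {χ : ℂ → ℝ} (hχ : ContDiff ℝ ∞ χ) (hc : HasCompactSupport χ)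
    {U : Set ℂ} (hU : IsOpen U) (hsub : tsupport χ ⊆ U) {h : ℂ → ℂ} (hh : DifferentiableOn ℂ h U)
    {w : ℂ} (hw : χ =ᶠ[𝓝 w] fun _ => 1) :
    ∫ z, dbar χ z * (h z / (z - w)) = h w * ∫ z, dbar radialCutoff z / z := by
  have hwU : w ∈ U := by
    refine hsub (subset_tsupport _ ?_)
    simp [hw.eq_of_nhds]
  have hsupp {χ : ℂ → ℝ} (hχ : ContDiff ℝ ∞ χ) (hc : HasCompactSupport χ) {c : ℝ}
      (hw : χ =ᶠ[𝓝 w] fun _ => c) :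
      Integrable fun z => dbar χ z / (z - w) := by
    refine Continuous.integrable_of_hasCompactSupport ?_ ?_
    · refine continuous_iff_continuousAt.2 fun z => ?_
      by_cases hz : z = w
      · subst hz
        have : (fun z' => dbar χ z' / (z' - z)) =ᶠ[𝓝 z] fun _ => 0 := by
          filter_upwards [hw.eventuallyEq_nhds] with z' hz'
          rw [dbar_eq_zero_of_eventuallyEq hz', zero_div]
        exact continuousAt_const.congr this.symm
      · have := (continuous_dbar (hχ.of_le (by exact_mod_cast le_top))).continuousAt (x := z)
        exact this.div (by fun_prop) (sub_ne_zero.2 hz)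
    · refine HasCompactSupport.intro hc fun z hz => ?_
      have : dbar χ z = 0 := by
        by_contra h
        exact hz (support_dbar_subset h)
      rw [this, zero_div]
  -- The integral against the Cauchy kernel does not depend on the cutoff.
  have hconst : ∫ z, dbar χ z / (z - w) = ∫ z, dbar radialCutoff z / z := by
    set ψ : ℂ → ℝ := fun z => radialCutoff (z - w) with hψ
    have hψc : ContDiff ℝ ∞ ψ := contDiff_radialCutoff.comp (contDiff_id.sub contDiff_const)
    have hψs : HasCompactSupport ψ :=
      hasCompactSupport_radialCutoff.comp_homeomorph (Homeomorph.subRight w)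
    have hψw : ψ =ᶠ[𝓝 w] fun _ => 1 := by
      have : Tendsto (fun z => z - w) (𝓝 w) (𝓝 0) := by
        simpa using (continuous_sub_right w).tendsto w
      exact this.eventually radialCutoff_eventuallyEq
    have hdψ (z : ℂ) : dbar ψ z = dbar radialCutoff (z - w) := by
      simp only [dbar, hψ, fderiv_comp_sub]
    have h1 : ∫ z, dbar ψ z / (z - w) = ∫ z, dbar radialCutoff z / z := by
      simp_rw [hdψ]
      exact integral_sub_right_eq_self (fun z => dbar radialCutoff z / z) w
    rw [← h1, ← sub_eq_zero, ← integral_sub (hsupp hχ hc hw) (hsupp hψc hψs hψw)]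
    have h2 := integral_dbar_mul_eq_zero (χ := χ - ψ) (U := {w}ᶜ) (g := fun z => (z - w)⁻¹)
      (hχ.sub hψc) (hc.sub hψs) isOpen_compl_singleton ?_ ?_
    · rw [← h2]
      refine integral_congr_ae (Eventually.of_forall fun z => ?_)
      have : dbar (χ - ψ) z = dbar χ z - dbar ψ z := by
        simp only [dbar]
        rw [fderiv_sub (hχ.differentiable (by simp) z) (hψc.differentiable (by simp) z)]
        simp
        ring
      simp only [this]
      ring
    · intro z hz hzw
      rw [mem_singleton_iff.1 hzw] at hz
      refine (notMem_tsupport_iff_eventuallyEq.2 ?_) hz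
      filter_upwards [hw, hψw] with z h1 h2
      simp [h1, h2]
    · exact fun z hz => ((differentiableAt_id.sub_const w).inv (sub_ne_zero.2 hz)).differentiableWithinAt
  -- It remains to split `h z = h w + (z - w) dslope h w z`; the last term integrates to `0`.
  have hslope : DifferentiableOn ℂ (dslope h w) U :=
    (Complex.differentiableOn_dslope (hU.mem_nhds hwU)).2 hh
  have h0 := integral_dbar_mul_eq_zero hχ hc hU hsub hslope
  have hi1 : Integrable fun z => dbar χ z * dslope h w z := by
    refine Continuous.integrable_of_hasCompactSupport ?_ ?_
    · refine continuous_iff_continuousAt.2 fun z => ?_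
      by_cases hz : z ∈ tsupport χ
      · exact (continuous_dbar (hχ.of_le (by exact_mod_cast le_top))).continuousAt.mul
          ((hslope.continuousOn).continuousAt (hU.mem_nhds (hsub hz)))
      · have : (fun z => dbar χ z * dslope h w z) =ᶠ[𝓝 z] fun _ => 0 := by
          filter_upwards [(notMem_tsupport_iff_eventuallyEq.1 hz).eventuallyEq_nhds] with z' hz'
          rw [dbar_eq_zero_of_eventuallyEq (c := 0) hz', zero_mul]
        exact continuousAt_const.congr this.symm
    · refine HasCompactSupport.intro hc fun z hz => ?_
      have : dbar χ z = 0 := by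
        by_contra h
        exact hz (support_dbar_subset h)
      rw [this, zero_mul]
  have hsplit : ∀ z, dbar χ z * (h z / (z - w)) =
      dbar χ z * dslope h w z + h w * (dbar χ z / (z - w)) := by
    intro z
    by_cases hz : z = w
    · subst hz
      simp [dbar_eq_zero_of_eventuallyEq hw]
    · rw [dslope_of_ne _ hz, slope_def_field]
      have := sub_ne_zero.2 hz
      field_simp
      ring
  simp_rw [hsplit]
  rw [integral_add hi1 ((hsupp hχ hc hw).const_mul _), h0, integral_const_mul, hconst, zero_add]

/-- A smooth cutoff function of an open set with a gradient bound. -/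
theorem exists_cutoff {U : Set ℂ} (hUb : Bornology.IsBounded U) {ε : ℝ} (hε : 0 < ε) :
    ∃ χ : ℂ → ℝ, ContDiff ℝ ∞ χ ∧ HasCompactSupport χ ∧
      tsupport χ ⊆ U ∧ (∀ z, ‖fderiv ℝ χ z‖ ≤ ε⁻¹) ∧
      (∀ z, 3 * ε ≤ Metric.infDist z Uᶜ → χ =ᶠ[𝓝 z] fun _ => 1) := by
  set d : ℂ → ℝ := fun z => Metric.infDist z Uᶜ with hd
  -- A Lipschitz cutoff in terms of the distance, to be mollified at the scale `ε / 2`.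
  set c : ℂ → ℝ := fun z => min 1 (max 0 (ε⁻¹ * d z - 1)) with hc
  have hdl : LipschitzWith 1 d := Metric.lipschitz_infDist_pt _
  have hcl : ∀ x y, |c x - c y| ≤ ε⁻¹ * dist x y := by
    intro x y
    have h1 : |c x - c y| ≤ |(ε⁻¹ * d x - 1) - (ε⁻¹ * d y - 1)| := by
      refine (abs_min_sub_min_le_max _ _ _ _).trans ?_
      refine max_le (by simp) ?_
      refine (abs_max_sub_max_le_max _ _ _ _).trans ?_
      exact max_le (by simp) le_rfl
    have h2 := hdl.dist_le_mul x y
    rw [NNReal.coe_one, one_mul, Real.dist_eq] at h2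
    refine h1.trans ?_
    rw [show ε⁻¹ * d x - 1 - (ε⁻¹ * d y - 1) = ε⁻¹ * (d x - d y) by ring, abs_mul,
      abs_of_pos (inv_pos.2 hε)]
    gcongr
  have hcc : Continuous c := by
    have := hdl.continuous
    fun_prop
  let φ : ContDiffBump (0 : ℂ) := ⟨ε / 4, ε / 2, by positivity, by linarith⟩
  set χ : ℂ → ℝ := MeasureTheory.convolution (φ.normed volume) c
    (ContinuousLinearMap.lsmul ℝ ℝ) volume with hχ
  have hφc : HasCompactSupport (φ.normed (volume : Measure ℂ)) := φ.hasCompactSupport_normed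
  have hsm : ContDiff ℝ ∞ χ := hφc.contDiff_convolution_left _ φ.contDiff_normed hcc.locallyIntegrable
  have hball {x z : ℂ} (hx : x ∈ Metric.ball z φ.rOut) : |d x - d z| ≤ ε / 2 := by
    have h2 := hdl.dist_le_mul x z
    rw [NNReal.coe_one, one_mul, Real.dist_eq] at h2
    exact h2.trans (Metric.mem_ball.1 hx).le
  have hzero {z : ℂ} (hz : d z ≤ ε / 2) : χ z = 0 := by
    have hval {x : ℂ} (hx : d x ≤ ε) : c x = 0 := by
      have : ε⁻¹ * d x - 1 ≤ 0 := by
        rw [sub_nonpos, inv_mul_le_one₀ hε]; exact hx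
      simp [hc, max_eq_left this]
    have := φ.normed_convolution_eq_right (μ := (volume : Measure ℂ)) (g := c) (x₀ := z) fun x hx => by
      have := (abs_le.1 (hball hx)).2
      rw [hval (by linarith), hval (by linarith)]
    rw [hχ, this, hval (by linarith)]
  have hone {z : ℂ} (hz : 5 / 2 * ε ≤ d z) : χ z = 1 := by
    have hval {x : ℂ} (hx : 2 * ε ≤ d x) : c x = 1 := by
      have : 1 ≤ ε⁻¹ * d x - 1 := by
        have : ε⁻¹ * (2 * ε) ≤ ε⁻¹ * d x := by gcongr
        rw [show ε⁻¹ * (2 * ε) = 2 by field_simp] at this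
        linarith
      simp only [hc]
      exact min_eq_left (this.trans (le_max_right _ _))
    have := φ.normed_convolution_eq_right (μ := (volume : Measure ℂ)) (g := c) (x₀ := z) fun x hx => by
      have := (abs_le.1 (hball hx)).1
      rw [hval (by linarith), hval (by linarith)]
    rw [hχ, this, hval (by linarith)]
  have hts : tsupport χ ⊆ {z | ε / 2 ≤ d z} := by
    refine closure_minimal (fun z hz => ?_) (isClosed_le continuous_const hdl.continuous)
    by_contra h
    exact hz (hzero (not_le.1 h).le)
  have htsU : tsupport χ ⊆ U := fun z hz => by
    by_contra h
    have h1 : ε / 2 ≤ d z := hts hz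
    rw [hd] at h1
    simp only [Metric.infDist_zero_of_mem (show z ∈ Uᶜ from h)] at h1
    linarith
  refine ⟨χ, hsm, ?_, htsU, fun z => ?_, fun z hz => ?_⟩
  · exact (hUb.isCompact_closure).of_isClosed_subset (isClosed_tsupport _) (htsU.trans subset_closure)
  · have hL : LipschitzWith (Real.toNNReal ε⁻¹) χ := by
      refine LipschitzWith.of_dist_le_mul fun x y => ?_
      rw [Real.coe_toNNReal _ (inv_pos.2 hε).le, dist_eq_norm]
      have hi (x : ℂ) : Integrable fun t => φ.normed volume t * c (x - t) :=
        (φ.continuous_normed.mul (hcc.comp (continuous_const.sub continuous_id))).integrable_of_hasCompactSupport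
          hφc.mul_right
      have e1 : χ x - χ y = ∫ t, φ.normed volume t * (c (x - t) - c (y - t)) := by
        simp only [hχ, MeasureTheory.convolution, ContinuousLinearMap.lsmul_apply, smul_eq_mul]
        rw [← integral_sub (hi x) (hi y)]
        simp only [mul_sub]
      rw [e1]
      calc ‖∫ t, φ.normed volume t * (c (x - t) - c (y - t))‖
          ≤ ∫ t, φ.normed volume t * (ε⁻¹ * dist x y) := by
            refine norm_integral_le_of_norm_le (φ.integrable_normed.mul_const _)
              (Eventually.of_forall fun t => ?_)
            rw [norm_mul, Real.norm_of_nonneg (φ.nonneg_normed t)]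
            refine mul_le_mul_of_nonneg_left ?_ (φ.nonneg_normed t)
            simpa using hcl (x - t) (y - t)
        _ = ε⁻¹ * dist x y := by
          rw [integral_mul_const, φ.integral_normed, one_mul]
    have := norm_fderiv_le_of_lipschitz ℝ hL (x₀ := z)
    rwa [Real.coe_toNNReal _ (inv_pos.2 hε).le] at this
  · have : {x | 5 / 2 * ε < d x} ∈ 𝓝 z :=
      (isOpen_lt continuous_const hdl.continuous).mem_nhds (by
        change 5 / 2 * ε < d z
        have : 3 * ε ≤ d z := hz
        linarith)
    filter_upwards [this] with x hx using hone (le_of_lt hx)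

/-! ### Point evaluations are bounded -/

namespace SmoothDomain

variable {n : ℕ} {Ω : SmoothDomain n} {ε : ℝ} {h u : ℂ → ℂ}

theorem abs_det_normalDeriv (Ω : SmoothDomain n) (j : Fin n) (t ν : ℝ) :
    |((Ω.normalDeriv j t ν).comp
      (Complex.equivRealProdCLM : ℂ →L[ℝ] ℝ × ℝ)).det| = |Ω.speed j t - ν * Ω.turning j t| := by
  have hT : (Ω.tangent j t).re * (Ω.tangent j t).re + (Ω.tangent j t).im * (Ω.tangent j t).im = 1 := by
    have := congrArg Complex.re (Ω.tangent_mul_conj j t)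
    simpa using this
  rw [ContinuousLinearMap.det, ← LinearMap.det_toMatrix Complex.basisOneI, Matrix.det_fin_two]
  simp only [LinearMap.toMatrix_apply, Complex.coe_basisOneI_repr, Complex.coe_basisOneI]
  congr 1
  simp [normalDeriv]
  linear_combination (Ω.speed j t - ν * Ω.turning j t) * hT

/-- Integration over the collar in normal coordinates. -/
theorem IsCollar.lintegral_collar_le (hε : Ω.IsCollar ε) {g : ℂ → ℂ}
    (hg : ContinuousOn g Ω.carrier) :
    ∫⁻ z in {z | z ∈ Ω.carrier ∧ Metric.infDist z (frontier Ω.carrier) < ε}, ‖g z‖ₑ ≤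
      ∑ j, ∫⁻ ν in Ioo 0 ε, ∫⁻ t in Ico 0 1,
        ENNReal.ofReal (Ω.speed j t - ν * Ω.turning j t) * ‖g (Ω.normalPoint j t ν)‖ₑ := by
  set S : Set ℂ := Ico 0 1 ×ℂ Ioo 0 ε with hS
  have hSm : MeasurableSet S :=
    (Complex.measurable_re measurableSet_Ico).inter (Complex.measurable_im measurableSet_Ioo)
  set Ψ : Fin n → ℂ → ℂ := fun j w => Ω.normalPoint j w.re w.im with hΨ
  have hder (j : Fin n) (w : ℂ) : HasFDerivAt (Ψ j) ((Ω.normalDeriv j w.re w.im).comp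
      (Complex.equivRealProdCLM : ℂ →L[ℝ] ℝ × ℝ)) w :=
    HasFDerivAt.comp (g := fun p : ℝ × ℝ => Ω.normalPoint j p.1 p.2) w
      (Ω.hasFDerivAt_normalPoint j (w.re, w.im))
      (Complex.equivRealProdCLM : ℂ →L[ℝ] ℝ × ℝ).hasFDerivAt
  have hinj (j : Fin n) : InjOn (Ψ j) S := by
    intro w hw w' hw' heq
    rw [hS, Complex.mem_reProdIm] at hw hw'
    obtain ⟨h1, h2⟩ := hε.unique j j w.re w'.re w.im w'.im
      (by rw [abs_of_pos hw.2.1]; exact hw.2.2.le)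
      (by rw [abs_of_pos hw'.2.1]; exact hw'.2.2.le) heq
    exact Complex.ext (Ω.simple j hw.1 hw'.1 h1) h2
  have hcover : {z | z ∈ Ω.carrier ∧ Metric.infDist z (frontier Ω.carrier) < ε} ⊆
      ⋃ j, Ψ j '' S := by
    rintro z ⟨hz, hd⟩
    obtain ⟨j, t, ht, heq⟩ := hε.exists_eq hz hd.le
    refine mem_iUnion.2 ⟨j, ⟨t, Metric.infDist z (frontier Ω.carrier)⟩, ?_, ?_⟩
    · rw [hS, Complex.mem_reProdIm]
      exact ⟨ht, Ω.infDist_pos hz, hd⟩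
    · exact heq.symm
  refine (lintegral_mono_set hcover).trans ((lintegral_iUnion_le _ _).trans ?_)
  rw [tsum_fintype]
  refine Finset.sum_le_sum fun j _ => ?_
  rw [lintegral_image_eq_lintegral_abs_det_fderiv_mul volume hSm
    (fun w _ => (hder j w).hasFDerivWithinAt) (hinj j)]
  simp only [abs_det_normalDeriv]
  set F : ℝ × ℝ → ENNReal := fun p =>
    ENNReal.ofReal (Ω.speed j p.1 - p.2 * Ω.turning j p.1) * ‖g (Ω.normalPoint j p.1 p.2)‖ₑ with hF
  have e1 : ∫⁻ w in S, ENNReal.ofReal |Ω.speed j w.re - w.im * Ω.turning j w.re| * ‖g (Ψ j w)‖ₑ =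
      ∫⁻ w in S, F (Complex.measurableEquivRealProd w) := by
    refine setLIntegral_congr_fun hSm fun w hw => ?_
    rw [hS, Complex.mem_reProdIm] at hw
    have h1 := (hε.jacobian_le j w.re hw.2).1
    have h2 := Ω.speed_pos j w.re
    simp only [hF, hΨ, Complex.measurableEquivRealProd_apply]
    rw [abs_of_nonneg (by linarith)]
  have e2 : S = Complex.measurableEquivRealProd ⁻¹' (Ico 0 1 ×ˢ Ioo 0 ε) := by
    ext w; simp [hS, Complex.mem_reProdIm]
  have hFc : ContinuousOn F (Ico 0 1 ×ˢ Ioo 0 ε) := by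
    have c1 : Continuous fun p : ℝ × ℝ => Ω.speed j p.1 - p.2 * Ω.turning j p.1 := by fun_prop
    have c2 : ContinuousOn (fun p : ℝ × ℝ => ‖g (Ω.normalPoint j p.1 p.2)‖ₑ) (Ico 0 1 ×ˢ Ioo 0 ε) :=
      (hg.comp (Ω.continuous_normalPoint j).continuousOn
        fun p hp => hε.inside j p.1 p.2 hp.2.1 hp.2.2.le).enorm
    refine fun p hp => ENNReal.Tendsto.mul
      ((ENNReal.continuous_ofReal.comp c1).continuousWithinAt) ?_ (c2 p hp) ?_
    · exact Or.inr enorm_ne_top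
    · exact Or.inr ENNReal.ofReal_ne_top
  rw [e1, e2, Complex.volume_preserving_equiv_real_prod.setLIntegral_comp_preimage_emb
    Complex.measurableEquivRealProd.measurableEmbedding, Measure.volume_eq_prod,
    ← Measure.prod_restrict, lintegral_prod_symm]
  have := hFc.aemeasurable (μ := volume) (measurableSet_Ico.prod measurableSet_Ioo)
  rwa [Measure.volume_eq_prod, ← Measure.prod_restrict] at this

instance (Ω : SmoothDomain n) (j : Fin n) : IsFiniteMeasure (Ω.arcLength j) := by
  refine isFiniteMeasure_withDensity_ofReal ?_
  have : IntegrableOn (Ω.speed j) (Ico 0 1) :=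
    (Ω.continuous_speed j).integrableOn_Icc.mono_set Ico_subset_Icc_self
  exact this.2

theorem lintegral_arcLength (Ω : SmoothDomain n) (j : Fin n) {g : ℝ → ENNReal} (hg : Measurable g) :
    ∫⁻ t, g t ∂Ω.arcLength j = ∫⁻ t in Ico 0 1, ENNReal.ofReal (Ω.speed j t) * g t := by
  have hm : Measurable fun t => ENNReal.ofReal ‖deriv (Ω.curve j) t‖ :=
    ENNReal.measurable_ofReal.comp (Ω.continuous_speed j).measurable
  rw [arcLength, lintegral_withDensity_eq_lintegral_mul _ hm hg]
  rfl

theorem infDist_frontier_le (Ω : SmoothDomain n) {z : ℂ} (hz : z ∈ Ω.carrier) :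
    Metric.infDist z (frontier Ω.carrier) ≤ Metric.infDist z Ω.carrierᶜ := by
  have hne : (Ω.carrierᶜ).Nonempty := by
    obtain ⟨p, hp⟩ := Ω.frontier_nonempty
    exact ⟨p, Ω.notMem_of_mem_frontier hp⟩
  refine (Metric.le_infDist hne).2 fun y hy => ?_
  have : ¬ Disjoint (segment ℝ z y) (frontier Ω.carrier) := fun hd => by
    have h1 := (convex_segment z y).isPreconnected.subset_of_disjoint_frontier hd
      ⟨z, left_mem_segment ℝ z y, subset_closure hz⟩
    exact hy (interior_subset (h1 (right_mem_segment ℝ z y)))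
  obtain ⟨p, hp, hpf⟩ := Set.not_disjoint_iff.1 this
  refine (Metric.infDist_le_dist_of_mem hpf).trans ?_
  have := dist_add_dist_of_mem_segment hp
  linarith [dist_nonneg (x := p) (y := y)]

/-- The Cauchy–Pompeiu formula with a cutoff that varies only in the collar of width `3 ε`. -/
theorem enorm_mul_le_lintegral_collar (Ω : SmoothDomain n) (hh : DifferentiableOn ℂ h Ω.carrier)
    (hε : 0 < ε) {w : ℂ} (hw : w ∈ Ω.carrier)
    (hd : 6 * ε ≤ Metric.infDist w (frontier Ω.carrier)) :
    ‖h w‖ₑ * ‖∫ z, dbar radialCutoff z / z‖ₑ ≤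
      ENNReal.ofReal (4 * ε⁻¹ * (Metric.infDist w (frontier Ω.carrier))⁻¹) *
      ∫⁻ z in {z | z ∈ Ω.carrier ∧ Metric.infDist z (frontier Ω.carrier) < 3 * ε}, ‖h z‖ₑ := by
  obtain ⟨χ, hχ, hχc, hχs, hχd, hχ1⟩ := exists_cutoff Ω.isBounded hε
  set D := Metric.infDist w (frontier Ω.carrier) with hD
  have hDpos : 0 < D := by linarith
  have hone {z : ℂ} (hz : z ∈ Ω.carrier) (h3 : 3 * ε ≤ Metric.infDist z (frontier Ω.carrier)) :
      χ =ᶠ[𝓝 z] fun _ => 1 :=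
    hχ1 z (h3.trans (Ω.infDist_frontier_le hz))
  have hf := integral_dbar_mul_div hχ hχc Ω.isOpen hχs hh (hone hw (by linarith))
  rw [← enorm_mul, ← hf]
  refine (enorm_integral_le_lintegral_enorm _).trans ?_
  set C := {z | z ∈ Ω.carrier ∧ Metric.infDist z (frontier Ω.carrier) < 3 * ε} with hC
  have hCm : MeasurableSet C := (Ω.isOpen.inter
    (isOpen_lt (Metric.continuous_infDist_pt _) continuous_const)).measurableSet
  have hsupp : ∀ z ∉ C, dbar χ z = 0 := by
    intro z hz
    by_cases hzΩ : z ∈ Ω.carrier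
    · exact dbar_eq_zero_of_eventuallyEq (hone hzΩ (by
        by_contra hlt
        exact hz ⟨hzΩ, not_le.1 hlt⟩))
    · by_contra hne
      exact hzΩ (hχs (support_dbar_subset hne))
  rw [← lintegral_const_mul' _ _ ENNReal.ofReal_ne_top, ← lintegral_indicator hCm]
  refine lintegral_mono fun z => ?_
  by_cases hz : z ∈ C
  · rw [indicator_of_mem hz, div_eq_mul_inv, mul_comm (h z), ← mul_assoc, enorm_mul]
    refine mul_le_mul_left ?_ _
    have hdist : D / 2 ≤ ‖z - w‖ := by
      have h1 := Metric.infDist_le_infDist_add_dist (s := frontier Ω.carrier) (x := w) (y := z)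
      rw [dist_comm, dist_eq_norm] at h1
      have := hz.2
      linarith
    rw [← ofReal_norm, norm_mul, norm_inv]
    refine ENNReal.ofReal_le_ofReal ?_
    calc ‖dbar χ z‖ * ‖z - w‖⁻¹ ≤ (2 * ε⁻¹) * (D / 2)⁻¹ := by
          gcongr
          exact norm_dbar_le (hχd z)
      _ = 4 * ε⁻¹ * D⁻¹ := by field_simp; norm_num
  · rw [indicator_of_notMem hz, hsupp z hz, zero_mul, enorm_zero]

/-- **Evaluation bound.** Point evaluations are bounded on the Hardy space, uniformly away from the
boundary. In the Cauchy–Pompeiu formula with a cutoff at scale `ε` the gradient contributes `ε⁻¹`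
and the collar a width `3 ε`, so the bound survives the limit `ε → 0`, in which the parallel curves
approach the boundary. -/
theorem exists_evaluation_bound (Ω : SmoothDomain n) : ∃ C : NNReal, ∀ h u, Ω.IsHardy h u →
    ∀ w ∈ Ω.carrier, ‖h w‖ₑ * ENNReal.ofReal (Metric.infDist w (frontier Ω.carrier)) ≤
      C * ∑ j, eLpNorm (fun t => u (Ω.curve j t)) 2 (Ω.arcLength j) := by
  obtain ⟨ε₀, hε₀⟩ := Ω.exists_isCollar
  set c₀ := ‖∫ z, dbar radialCutoff z / z‖ₑ with hc₀
  have hc₀0 : c₀ ≠ 0 := by rw [hc₀, Ne, enorm_eq_zero]; exact integral_dbar_radialCutoff_div_ne_zero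
  have hc₀t : c₀ ≠ ⊤ := enorm_ne_top
  set A : Fin n → ENNReal := fun j => (Ω.arcLength j univ) ^ (1 / 2 : ℝ) with hA
  have hAt (j : Fin n) : A j ≠ ⊤ := ENNReal.rpow_ne_top_of_nonneg (by norm_num) (measure_ne_top _ _)
  set B : ENNReal := ∑ j, A j with hB
  have hBt : B ≠ ⊤ := ENNReal.sum_ne_top.2 fun j _ => hAt j
  have hCt : 18 * B / c₀ ≠ ⊤ := ENNReal.div_ne_top (ENNReal.mul_ne_top (by norm_num) hBt) hc₀0
  refine ⟨(18 * B / c₀).toNNReal, fun h u hh w hw => ?_⟩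
  rw [ENNReal.coe_toNNReal hCt]
  set D := Metric.infDist w (frontier Ω.carrier) with hD
  have hDpos : 0 < D := Ω.infDist_pos hw
  set N : Fin n → ENNReal := fun j => eLpNorm (fun t => u (Ω.curve j t)) 2 (Ω.arcLength j) with hN
  have hNt (j : Fin n) : N j ≠ ⊤ := (hh.memL2 j).eLpNorm_ne_top
  -- It suffices to allow an arbitrarily small error.
  have main : ∀ τ : NNReal, 0 < τ → ‖h w‖ₑ * c₀ * ENNReal.ofReal D ≤ 18 * ∑ j, A j * (N j + τ) := by
    intro τ hτ
    have hev : ∀ᶠ ν in 𝓝[>] (0 : ℝ), ∀ j,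
        eLpNorm (fun t => h (Ω.normalPoint j t ν)) 2 (Ω.arcLength j) ≤ N j + τ := by
      refine eventually_all.2 fun j => ?_
      refine ((hh.tendsto_eLpNorm j).eventually_lt_const ?_).mono fun ν hν => hν.le
      exact ENNReal.lt_add_right (hNt j) (by exact_mod_cast hτ.ne')
    obtain ⟨r, hr, hr'⟩ := mem_nhdsGT_iff_exists_Ioo_subset.1 hev
    set ε := min (r / 3) (min (ε₀ / 3) (D / 6)) with hεdef
    have hr0 : 0 < r := hr
    have hεpos : 0 < ε := lt_min (by linarith) (lt_min (by linarith [hε₀.pos]) (by linarith))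
    have h3r : 3 * ε ≤ r := by linarith [min_le_left (r / 3) (min (ε₀ / 3) (D / 6))]
    have h3ε : 3 * ε ≤ ε₀ := by
      linarith [(min_le_right (r / 3) (min (ε₀ / 3) (D / 6))).trans (min_le_left _ _)]
    have h6 : 6 * ε ≤ D := by
      linarith [(min_le_right (r / 3) (min (ε₀ / 3) (D / 6))).trans (min_le_right _ _)]
    have hcol := hε₀.mono (by linarith : 0 < 3 * ε) h3ε
    have h1 := Ω.enorm_mul_le_lintegral_collar hh.holomorphic hεpos hw h6
    have h2 := hcol.lintegral_collar_le hh.holomorphic.continuousOn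
    have h3 (j : Fin n) : ∫⁻ ν in Ioo 0 (3 * ε), ∫⁻ t in Ico 0 1,
        ENNReal.ofReal (Ω.speed j t - ν * Ω.turning j t) * ‖h (Ω.normalPoint j t ν)‖ₑ ≤
        ENNReal.ofReal (3 * ε) * (ENNReal.ofReal (3 / 2) * (A j * (N j + τ))) := by
      have h4 : ∀ ν ∈ Ioo 0 (3 * ε), ∫⁻ t in Ico 0 1,
          ENNReal.ofReal (Ω.speed j t - ν * Ω.turning j t) * ‖h (Ω.normalPoint j t ν)‖ₑ ≤
          ENNReal.ofReal (3 / 2) * (A j * (N j + τ)) := by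
        intro ν hν
        have hc := hcol.continuous_comp j hh.holomorphic.continuousOn hν
        calc ∫⁻ t in Ico 0 1,
              ENNReal.ofReal (Ω.speed j t - ν * Ω.turning j t) * ‖h (Ω.normalPoint j t ν)‖ₑ
            ≤ ∫⁻ t in Ico 0 1, ENNReal.ofReal (3 / 2) *
              (ENNReal.ofReal (Ω.speed j t) * ‖h (Ω.normalPoint j t ν)‖ₑ) := by
              refine lintegral_mono fun t => ?_
              rw [← mul_assoc, ← ENNReal.ofReal_mul (by norm_num)]
              exact mul_le_mul_left (ENNReal.ofReal_le_ofReal (hcol.jacobian_le j t hν).2) _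
          _ = ENNReal.ofReal (3 / 2) *
              eLpNorm (fun t => h (Ω.normalPoint j t ν)) 1 (Ω.arcLength j) := by
              rw [lintegral_const_mul' _ _ ENNReal.ofReal_ne_top, eLpNorm_one_eq_lintegral_enorm,
                Ω.lintegral_arcLength j hc.enorm.measurable]
          _ ≤ _ := by
              gcongr
              refine (eLpNorm_le_eLpNorm_mul_rpow_measure_univ (q := 2) (by norm_num)
                hc.aestronglyMeasurable).trans ?_
              rw [mul_comm]
              have e : (1 / (1 : ENNReal).toReal - 1 / (2 : ENNReal).toReal) = (1 / 2 : ℝ) := by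
                norm_num
              rw [e]
              gcongr
              exact hr' ⟨hν.1, hν.2.trans_le h3r⟩ j
      refine (setLIntegral_mono' measurableSet_Ioo h4).trans ?_
      rw [setLIntegral_const, Real.volume_Ioo, sub_zero, mul_comm]
    calc ‖h w‖ₑ * c₀ * ENNReal.ofReal D
        ≤ ENNReal.ofReal (4 * ε⁻¹ * D⁻¹) * (∑ j, ENNReal.ofReal (3 * ε) *
          (ENNReal.ofReal (3 / 2) * (A j * (N j + τ)))) * ENNReal.ofReal D := by
          refine mul_le_mul_left (h1.trans ?_) _
          gcongr
          exact h2.trans (Finset.sum_le_sum fun j _ => h3 j)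
      _ = _ := by
          rw [← Finset.mul_sum, ← Finset.mul_sum]
          generalize ∑ j, A j * (N j + τ) = X
          have e : ENNReal.ofReal (4 * ε⁻¹ * D⁻¹) * ENNReal.ofReal (3 * ε) * ENNReal.ofReal (3 / 2) *
              ENNReal.ofReal D = 18 := by
            rw [← ENNReal.ofReal_mul (by positivity), ← ENNReal.ofReal_mul (by positivity),
              ← ENNReal.ofReal_mul (by positivity)]
            have : 4 * ε⁻¹ * D⁻¹ * (3 * ε) * (3 / 2) * D = 18 := by
              field_simp; norm_num
            rw [this]; norm_num
          rw [← e]; ring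
  have lim : ‖h w‖ₑ * c₀ * ENNReal.ofReal D ≤ 18 * ∑ j, A j * N j := by
    have ht : Tendsto (fun τ : NNReal => 18 * ∑ j, A j * (N j + (τ : ENNReal))) (𝓝[>] 0)
        (𝓝 (18 * ∑ j, A j * (N j + (0 : NNReal)))) := by
      refine (Tendsto.mono_left ?_ nhdsWithin_le_nhds)
      refine ENNReal.Tendsto.const_mul ?_ (Or.inr (by norm_num))
      refine tendsto_finsetSum _ fun j _ => ENNReal.Tendsto.const_mul ?_ (Or.inr (hAt j))
      exact tendsto_const_nhds.add (ENNReal.tendsto_coe.2 tendsto_id)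
    simp only [ENNReal.coe_zero, add_zero] at ht
    refine ge_of_tendsto ht ?_
    filter_upwards [self_mem_nhdsWithin] with τ hτ using main τ hτ
  have fin : ∑ j, A j * N j ≤ B * ∑ j, N j := by
    rw [Finset.mul_sum]
    refine Finset.sum_le_sum fun j hj => ?_
    gcongr
    exact Finset.single_le_sum (fun j _ => zero_le) hj
  rw [div_eq_mul_inv, show 18 * B * c₀⁻¹ * ∑ j, N j = (18 * (B * ∑ j, N j)) / c₀ by
    rw [div_eq_mul_inv]; ring, ENNReal.le_div_iff_mul_le (Or.inl hc₀0) (Or.inl hc₀t)]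
  calc ‖h w‖ₑ * ENNReal.ofReal D * c₀ = ‖h w‖ₑ * c₀ * ENNReal.ofReal D := by ring
    _ ≤ _ := lim.trans (by gcongr)

end SmoothDomain

/-! ### The Hardy space is closed -/

namespace SmoothDomain

variable {n : ℕ} {Ω : SmoothDomain n} {ε : ℝ} {h h' u u' : ℂ → ℂ}

theorem IsHardy.tendsto_normalPoint (hh : Ω.IsHardy h u) (j : Fin n) :
    Tendsto (fun ν => eLpNorm (fun t => h (Ω.normalPoint j t ν) - u (Ω.curve j t)) 2
      (Ω.arcLength j)) (𝓝[>] 0) (𝓝 0) := hh.tendsto j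

theorem eventually_continuous_comp (Ω : SmoothDomain n) (hh : ContinuousOn h Ω.carrier)
    (j : Fin n) : ∀ᶠ ν in 𝓝[>] (0 : ℝ), Continuous fun t => h (Ω.normalPoint j t ν) := by
  obtain ⟨ε, hε⟩ := Ω.exists_isCollar
  filter_upwards [Ioo_mem_nhdsGT hε.pos] with ν hν
  exact hε.continuous_comp j hh hν

theorem IsHardy.eventually_aestronglyMeasurable (hh : Ω.IsHardy h u) (j : Fin n) :
    ∀ᶠ ν in 𝓝[>] (0 : ℝ), AEStronglyMeasurable
      (fun t => h (Ω.normalPoint j t ν) - u (Ω.curve j t)) (Ω.arcLength j) := by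
  filter_upwards [Ω.eventually_continuous_comp hh.holomorphic.continuousOn j] with ν hν
  exact hν.aestronglyMeasurable.sub (hh.memL2 j).aestronglyMeasurable

theorem IsHardy.add (hh : Ω.IsHardy h u) (hh' : Ω.IsHardy h' u') : Ω.IsHardy (h + h') (u + u') where
  holomorphic := hh.holomorphic.add hh'.holomorphic
  memL2 j := (hh.memL2 j).add (hh'.memL2 j)
  tendsto j := by
    have h1 := (hh.tendsto_normalPoint j).add (hh'.tendsto_normalPoint j)
    rw [add_zero] at h1
    refine tendsto_of_tendsto_of_tendsto_of_le_of_le' tendsto_const_nhds h1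
      (Eventually.of_forall fun _ => zero_le) ?_
    filter_upwards [hh.eventually_aestronglyMeasurable j, hh'.eventually_aestronglyMeasurable j]
      with ν m1 m2
    refine le_trans (le_of_eq ?_) (eLpNorm_add_le m1 m2 (by norm_num))
    congr 1
    ext t
    simp only [Pi.add_apply, normalPoint]
    ring

theorem IsHardy.const_smul (hh : Ω.IsHardy h u) (c : ℂ) : Ω.IsHardy (c • h) (c • u) where
  holomorphic := hh.holomorphic.const_smul c
  memL2 j := (hh.memL2 j).const_smul c
  tendsto j := by
    have h1 := ENNReal.Tendsto.const_mul (a := ‖c‖ₑ) (hh.tendsto_normalPoint j)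
      (Or.inr enorm_ne_top)
    rw [mul_zero] at h1
    refine h1.congr fun ν => ?_
    rw [← eLpNorm_const_smul]
    congr 1
    ext t
    simp only [Pi.smul_apply, normalPoint, smul_eq_mul]
    ring

theorem IsHardy.sub (hh : Ω.IsHardy h u) (hh' : Ω.IsHardy h' u') :
    Ω.IsHardy (h - h') (u - u') := by
  have := hh.add (hh'.const_smul (-1))
  simpa only [neg_smul, one_smul, ← sub_eq_add_neg] using this

theorem IsHardy.zero (Ω : SmoothDomain n) : Ω.IsHardy 0 0 where
  holomorphic := differentiableOn_const 0
  memL2 j := MemLp.zero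
  tendsto j := by simp

theorem IsHardy.sum {ι : Type*} (s : Finset ι) {H U : ι → ℂ → ℂ}
    (hh : ∀ i ∈ s, Ω.IsHardy (H i) (U i)) : Ω.IsHardy (∑ i ∈ s, H i) (∑ i ∈ s, U i) := by
  classical
  induction s using Finset.induction_on with
  | empty => simpa using IsHardy.zero Ω
  | insert i s hi ih =>
    rw [Finset.sum_insert hi, Finset.sum_insert hi]
    exact (hh i (Finset.mem_insert_self _ _)).add
      (ih fun k hk => hh k (Finset.mem_insert_of_mem hk))

theorem ae_arcLength (Ω : SmoothDomain n) (j : Fin n) {P : ℝ → Prop}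
    (hP : ∀ t ∈ Ico (0 : ℝ) 1, P t) : ∀ᵐ t ∂Ω.arcLength j, P t := by
  refine (withDensity_absolutelyContinuous _ _).ae_le ?_
  filter_upwards [ae_restrict_mem measurableSet_Ico] with t ht using hP t ht

/-- Boundary functions may be replaced on null sets. -/
theorem IsHardy.congr (hh : Ω.IsHardy h u) (hhh : ∀ z ∈ Ω.carrier, h' z = h z)
    (hu : ∀ j, (fun t => u' (Ω.curve j t)) =ᵐ[Ω.arcLength j] fun t => u (Ω.curve j t)) :
    Ω.IsHardy h' u' where
  holomorphic := hh.holomorphic.congr hhh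
  memL2 j := (memLp_congr_ae (hu j)).2 (hh.memL2 j)
  tendsto j := by
    obtain ⟨ε, hε⟩ := Ω.exists_isCollar
    refine (hh.tendsto_normalPoint j).congr' ?_
    filter_upwards [Ioo_mem_nhdsGT hε.pos] with ν hν
    refine eLpNorm_congr_ae ?_
    filter_upwards [hu j] with t ht
    change _ = h' (Ω.normalPoint j t ν) - u' (Ω.curve j t)
    rw [ht, hhh _ (hε.inside j t ν hν.1 hν.2.le)]

/-- The sum of the `L²` norms of a boundary function over the boundary curves. -/
noncomputable def boundaryNorm (Ω : SmoothDomain n) (u : ℂ → ℂ) : ENNReal :=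
  ∑ j, eLpNorm (fun t => u (Ω.curve j t)) 2 (Ω.arcLength j)

theorem eLpNorm_le_boundaryNorm (Ω : SmoothDomain n) (u : ℂ → ℂ) (j : Fin n) :
    eLpNorm (fun t => u (Ω.curve j t)) 2 (Ω.arcLength j) ≤ Ω.boundaryNorm u :=
  Finset.single_le_sum (f := fun j => eLpNorm (fun t => u (Ω.curve j t)) 2 (Ω.arcLength j))
    (fun _ _ => zero_le) (Finset.mem_univ j)

theorem boundaryNorm_ne_top (hu : Ω.MemL2 u) : Ω.boundaryNorm u ≠ ⊤ :=
  ENNReal.sum_ne_top.2 fun j _ => (hu j).eLpNorm_ne_top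

theorem boundaryNorm_add_le (hu : Ω.MemL2 u) (hu' : Ω.MemL2 u') :
    Ω.boundaryNorm (u + u') ≤ Ω.boundaryNorm u + Ω.boundaryNorm u' := by
  rw [boundaryNorm, boundaryNorm, boundaryNorm, ← Finset.sum_add_distrib]
  refine Finset.sum_le_sum fun j _ => ?_
  exact eLpNorm_add_le (hu j).aestronglyMeasurable (hu' j).aestronglyMeasurable (by norm_num)

theorem boundaryNorm_neg (Ω : SmoothDomain n) (u : ℂ → ℂ) :
    Ω.boundaryNorm (-u) = Ω.boundaryNorm u := by
  unfold boundaryNorm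
  refine Finset.sum_congr rfl fun j _ => ?_
  exact eLpNorm_neg (fun t => u (Ω.curve j t)) _ _

theorem MemL2.sub (hu : Ω.MemL2 u) (hu' : Ω.MemL2 u') : Ω.MemL2 (u - u') :=
  fun j => (hu j).sub (hu' j)

theorem boundaryNorm_sub_le {u'' : ℂ → ℂ} (hu : Ω.MemL2 u) (hu' : Ω.MemL2 u')
    (hu'' : Ω.MemL2 u'') :
    Ω.boundaryNorm (u - u') ≤ Ω.boundaryNorm (u - u'') + Ω.boundaryNorm (u' - u'') := by
  have h1 := boundaryNorm_add_le (hu.sub hu'') (hu''.sub hu')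
  rw [sub_add_sub_cancel, ← boundaryNorm_neg Ω (u'' - u'), neg_sub] at h1
  exact h1

/-- A Hardy function is determined inside the domain by its boundary values. -/
theorem IsHardy.eq_zero_of_boundaryNorm (hh : Ω.IsHardy h u) (h0 : Ω.boundaryNorm u = 0) {w : ℂ}
    (hw : w ∈ Ω.carrier) : h w = 0 := by
  obtain ⟨C, hC⟩ := Ω.exists_evaluation_bound
  have := hC h u hh w hw
  rw [← boundaryNorm, h0, mul_zero, nonpos_iff_eq_zero, mul_eq_zero] at this
  rcases this with h1 | h1
  · simpa using h1
  · rw [ENNReal.ofReal_eq_zero] at h1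
    exact absurd (Ω.infDist_pos hw) (not_lt.2 h1)

/-- **Uniform collar bound.** The `L²` norms of a Hardy function on all parallel curves near the
boundary are controlled by the norm of its boundary values. -/
theorem exists_collar_bound (Ω : SmoothDomain n) : ∃ C : NNReal, ∃ ε > 0, ∀ h u, Ω.IsHardy h u →
    ∀ j, ∀ ν ∈ Ioc 0 ε, eLpNorm (fun t => h (Ω.normalPoint j t ν)) 2 (Ω.arcLength j) ≤
      C * Ω.boundaryNorm u := by
  obtain ⟨ε₀, hε₀⟩ := Ω.exists_isCollar
  obtain ⟨C, hC⟩ := Ω.exists_evaluation_bound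
  set ν₁ := ε₀ / 2 with hν₁
  have hν₁0 : 0 < ν₁ := half_pos hε₀.pos
  have hν₁ε : ν₁ < ε₀ := half_lt_self hε₀.pos
  -- The parallel curves at distance `ν₁` stay away from the boundary.
  have hd (j : Fin n) : ∃ c > 0, ∀ t, c ≤ Metric.infDist (Ω.normalPoint j t ν₁) (frontier Ω.carrier) := by
    have hpos (t : ℝ) : 0 < Metric.infDist (Ω.normalPoint j t ν₁) (frontier Ω.carrier) :=
      Ω.infDist_pos (hε₀.inside j t ν₁ hν₁0 hν₁ε.le)
    have hcont : Continuous fun t => Metric.infDist (Ω.normalPoint j t ν₁) (frontier Ω.carrier) :=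
      (Metric.continuous_infDist_pt _).comp ((Ω.continuous_normalPoint j).comp
        (by fun_prop : Continuous fun t : ℝ => (t, ν₁)))
    obtain ⟨B, hB0, hB⟩ := Function.Periodic.exists_bound
      (g := fun t => (Metric.infDist (Ω.normalPoint j t ν₁) (frontier Ω.carrier))⁻¹)
      (fun t => by have := Ω.periodic_normalPoint j ν₁ t; simp only at this ⊢; rw [this])
      (hcont.inv₀ fun t => (hpos t).ne')
    refine ⟨B⁻¹, inv_pos.2 hB0, fun t => ?_⟩
    rw [inv_le_comm₀ hB0 (hpos t)]
    exact (le_abs_self _).trans (hB t)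
  choose c hc0 hc using hd
  set A : Fin n → ENNReal := fun j =>
    C / ENNReal.ofReal (c j) * Ω.arcLength j univ ^ (2 : ENNReal).toReal⁻¹ with hA
  have hAt (j : Fin n) : A j ≠ ⊤ := ENNReal.mul_ne_top
    (ENNReal.div_ne_top ENNReal.coe_ne_top (by simpa using hc0 j))
    (ENNReal.rpow_ne_top_of_nonneg (by positivity) (measure_ne_top _ _))
  have hAS : 3 * (1 + ∑ j, A j) ≠ ⊤ := ENNReal.mul_ne_top (by norm_num)
    (ENNReal.add_ne_top.2 ⟨ENNReal.one_ne_top, ENNReal.sum_ne_top.2 fun j _ => hAt j⟩)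
  refine ⟨(3 * (1 + ∑ j, A j)).toNNReal, ν₁, hν₁0, fun h u hh j ν hν => ?_⟩
  rw [ENNReal.coe_toNNReal hAS]
  refine (hh.eLpNorm_le_max hε₀ j hν.1 hν.2 hν₁ε).trans ?_
  rw [mul_assoc]
  gcongr
  have h1 : eLpNorm (fun t => h (Ω.normalPoint j t ν₁)) 2 (Ω.arcLength j) ≤
      A j * Ω.boundaryNorm u := by
    refine (eLpNorm_le_of_ae_enorm_bound (C := C * Ω.boundaryNorm u / ENNReal.ofReal (c j))
      (Eventually.of_forall fun t => ?_)).trans (le_of_eq ?_)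
    · rw [ENNReal.le_div_iff_mul_le (Or.inl (by simpa using hc0 j)) (Or.inl ENNReal.ofReal_ne_top)]
      refine le_trans ?_ (hC h u hh _ (hε₀.inside j t ν₁ hν₁0 hν₁ε.le))
      gcongr
      exact hc j t
    · rw [hA, smul_eq_mul]
      simp only [div_eq_mul_inv]
      ring
  have h2 : A j ≤ ∑ j, A j := Finset.single_le_sum (fun _ _ => zero_le) (Finset.mem_univ j)
  refine max_le ?_ (h1.trans ?_)
  · refine (Ω.eLpNorm_le_boundaryNorm u j).trans ?_
    conv_lhs => rw [← one_mul (Ω.boundaryNorm u)]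
    gcongr
    exact le_self_add
  · gcongr
    exact h2.trans le_add_self

/-- **The Hardy space is closed in `L²`.** -/
theorem IsHardy.of_tendsto {H U : ℕ → ℂ → ℂ} (hH : ∀ m, Ω.IsHardy (H m) (U m)) (hu : Ω.MemL2 u)
    (hlim : Tendsto (fun m => Ω.boundaryNorm (U m - u)) atTop (𝓝 0)) : ∃ h, Ω.IsHardy h u := by
  obtain ⟨C, hC⟩ := Ω.exists_evaluation_bound
  obtain ⟨B, ε₁, hε₁, hB⟩ := Ω.exists_collar_bound
  obtain ⟨ε₀, hε₀⟩ := Ω.exists_isCollar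
  have hdiff (m k : ℕ) : Ω.boundaryNorm (U m - U k) ≤
      Ω.boundaryNorm (U m - u) + Ω.boundaryNorm (U k - u) :=
    boundaryNorm_sub_le (hH m).memL2 (hH k).memL2 hu
  have hfin (m : ℕ) : Ω.boundaryNorm (U m - u) ≠ ⊤ := boundaryNorm_ne_top ((hH m).memL2.sub hu)
  have hev (m k : ℕ) {w : ℂ} (hw : w ∈ Ω.carrier) :
      ‖H m w - H k w‖ₑ * ENNReal.ofReal (Metric.infDist w (frontier Ω.carrier)) ≤
        C * (Ω.boundaryNorm (U m - u) + Ω.boundaryNorm (U k - u)) :=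
    (hC _ _ ((hH m).sub (hH k)) w hw).trans (by gcongr; exact hdiff m k)
  have hev' (m k : ℕ) {w : ℂ} (hw : w ∈ Ω.carrier) :
      edist (H m w) (H k w) ≤ (C * (Ω.boundaryNorm (U m - u) + Ω.boundaryNorm (U k - u))) /
        ENNReal.ofReal (Metric.infDist w (frontier Ω.carrier)) := by
    rw [edist_eq_enorm_sub, ENNReal.le_div_iff_mul_le (Or.inl (by simpa using Ω.infDist_pos hw))
      (Or.inl ENNReal.ofReal_ne_top)]
    exact hev m k hw
  have hptw (w : ℂ) (hw : w ∈ Ω.carrier) : ∃ y, Tendsto (fun m => H m w) atTop (𝓝 y) := by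
    refine cauchySeq_tendsto_of_complete (EMetric.cauchySeq_iff_le_tendsto_0.2 ?_)
    have hs : Tendsto (fun m => ⨆ k ≥ m, Ω.boundaryNorm (U k - u)) atTop (𝓝 0) := by
      have := hlim.limsup_eq
      rw [limsup_eq_iInf_iSup_of_nat] at this
      rw [← this]
      refine tendsto_atTop_iInf fun a b hab => ?_
      exact iSup₂_mono' fun k hk => ⟨k, le_trans hab hk, le_rfl⟩
    refine ⟨fun N => (C * ((⨆ k ≥ N, Ω.boundaryNorm (U k - u)) + ⨆ k ≥ N, Ω.boundaryNorm (U k - u))) /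
      ENNReal.ofReal (Metric.infDist w (frontier Ω.carrier)), fun p q N hp hq => ?_, ?_⟩
    · refine (hev' p q hw).trans ?_
      refine ENNReal.div_le_div_right (mul_le_mul_right (add_le_add ?_ ?_) _) _
      · exact le_iSup₂ (f := fun k (_ : k ≥ N) => Ω.boundaryNorm (U k - u)) p hp
      · exact le_iSup₂ (f := fun k (_ : k ≥ N) => Ω.boundaryNorm (U k - u)) q hq
    · have := ENNReal.Tendsto.div_const (b := ENNReal.ofReal (Metric.infDist w (frontier Ω.carrier)))
        (ENNReal.Tendsto.const_mul (a := C) (hs.add hs) (Or.inr ENNReal.coe_ne_top))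
        (Or.inr (by simpa using Ω.infDist_pos hw))
      simpa using this
  choose! h hh using hptw
  have hlimC (m : ℕ) : Tendsto (fun k => Ω.boundaryNorm (U m - u) + Ω.boundaryNorm (U k - u)) atTop
      (𝓝 (Ω.boundaryNorm (U m - u))) := by
    simpa using tendsto_const_nhds.add hlim
  have hevl (m : ℕ) {w : ℂ} (hw : w ∈ Ω.carrier) :
      edist (H m w) (h w) ≤ (C * Ω.boundaryNorm (U m - u)) /
        ENNReal.ofReal (Metric.infDist w (frontier Ω.carrier)) := by
    refine le_of_tendsto_of_tendsto' (tendsto_const_nhds.edist (hh w hw))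
      (ENNReal.Tendsto.div_const (ENNReal.Tendsto.const_mul (hlimC m)
        (Or.inr ENNReal.coe_ne_top)) (Or.inr (by simpa using Ω.infDist_pos hw))) fun k => hev' m k hw
  have hloc : TendstoLocallyUniformlyOn H h atTop Ω.carrier := by
    rw [EMetric.tendstoLocallyUniformlyOn_iff]
    intro τ hτ w hw
    have hd := Ω.infDist_pos hw
    set D := Metric.infDist w (frontier Ω.carrier) with hD
    have hnhds : {z | z ∈ Ω.carrier ∧ D / 2 < Metric.infDist z (frontier Ω.carrier)} ∈ 𝓝 w :=
      (Ω.isOpen.inter (isOpen_lt continuous_const (Metric.continuous_infDist_pt _))).mem_nhds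
        ⟨hw, half_lt_self hd⟩
    refine ⟨_, mem_nhdsWithin_of_mem_nhds hnhds, ?_⟩
    have ht : Tendsto (fun m => (C * Ω.boundaryNorm (U m - u)) / ENNReal.ofReal (D / 2)) atTop (𝓝 0) := by
      have := ENNReal.Tendsto.div_const (b := ENNReal.ofReal (D / 2))
        (ENNReal.Tendsto.const_mul (a := C) hlim (Or.inr ENNReal.coe_ne_top))
        (Or.inr (by simpa using hd))
      simpa using this
    filter_upwards [ht.eventually_lt_const hτ] with m hm z hz
    rw [edist_comm]
    refine ((hevl m hz.1).trans ?_).trans_lt hm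
    gcongr
    exact hz.2.le
  have hhol : DifferentiableOn ℂ h Ω.carrier :=
    hloc.differentiableOn (Eventually.of_forall fun m => (hH m).holomorphic) Ω.isOpen
  refine ⟨h, hhol, hu, fun j => ?_⟩
  -- By Fatou's lemma the collar bound passes to the limit.
  have hfatou (m : ℕ) {ν : ℝ} (hν : ν ∈ Ioo 0 (min ε₀ ε₁)) :
      eLpNorm (fun t => h (Ω.normalPoint j t ν) - H m (Ω.normalPoint j t ν)) 2 (Ω.arcLength j) ≤
        B * Ω.boundaryNorm (U m - u) := by
    have hν0 : ν ∈ Ioo 0 ε₀ := ⟨hν.1, hν.2.trans_le (min_le_left _ _)⟩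
    have hmeas (k : ℕ) : AEStronglyMeasurable
        (fun t => H k (Ω.normalPoint j t ν) - H m (Ω.normalPoint j t ν)) (Ω.arcLength j) :=
      ((hε₀.continuous_comp j (hH k).holomorphic.continuousOn hν0).sub
        (hε₀.continuous_comp j (hH m).holomorphic.continuousOn hν0)).aestronglyMeasurable
    refine (Lp.eLpNorm_lim_le_liminf_eLpNorm hmeas _ (Eventually.of_forall fun t =>
      (hh _ (hε₀.inside j t ν hν0.1 hν0.2.le)).sub_const _)).trans ?_
    have hb (k : ℕ) : eLpNorm (fun t => H k (Ω.normalPoint j t ν) - H m (Ω.normalPoint j t ν)) 2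
        (Ω.arcLength j) ≤ B * (Ω.boundaryNorm (U m - u) + Ω.boundaryNorm (U k - u)) := by
      refine (hB _ _ ((hH k).sub (hH m)) j ν ⟨hν.1, hν.2.le.trans (min_le_right _ _)⟩).trans ?_
      gcongr
      rw [add_comm]
      exact hdiff k m
    refine (liminf_le_liminf (Eventually.of_forall hb)).trans (le_of_eq ?_)
    exact (ENNReal.Tendsto.const_mul (hlimC m) (Or.inr ENNReal.coe_ne_top)).liminf_eq
  change Tendsto (fun ν => eLpNorm (fun t => h (Ω.normalPoint j t ν) - u (Ω.curve j t)) 2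
      (Ω.arcLength j)) (𝓝[>] 0) (𝓝 0)
  refine ENNReal.tendsto_nhds_zero.2 fun τ hτ => ?_
  have h1 : Tendsto (fun m => B * Ω.boundaryNorm (U m - u) + Ω.boundaryNorm (U m - u)) atTop
      (𝓝 0) := by
    simpa using (ENNReal.Tendsto.const_mul (a := B) hlim (Or.inr ENNReal.coe_ne_top)).add hlim
  have hτ2 : 0 < τ / 2 := ENNReal.half_pos hτ.ne'
  obtain ⟨m, hm⟩ := (h1.eventually_lt_const hτ2).exists
  filter_upwards [((hH m).tendsto_normalPoint j).eventually_lt_const hτ2,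
    Ioo_mem_nhdsGT (lt_min hε₀.pos hε₁)] with ν h2 hν
  have hν0 : ν ∈ Ioo 0 ε₀ := ⟨hν.1, hν.2.trans_le (min_le_left _ _)⟩
  have m1 := ((hε₀.continuous_comp j hhol.continuousOn hν0).sub
    (hε₀.continuous_comp j (hH m).holomorphic.continuousOn hν0)).aestronglyMeasurable
      (μ := Ω.arcLength j)
  have m2 := (hε₀.continuous_comp j (hH m).holomorphic.continuousOn hν0).aestronglyMeasurable.sub
    ((hH m).memL2 j).aestronglyMeasurable
  have m3 := (((hH m).memL2.sub hu) j).aestronglyMeasurable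
  have e : (fun t => h (Ω.normalPoint j t ν) - u (Ω.curve j t)) =
      (fun t => h (Ω.normalPoint j t ν) - H m (Ω.normalPoint j t ν)) +
        ((fun t => H m (Ω.normalPoint j t ν) - U m (Ω.curve j t)) +
          fun t => (U m - u) (Ω.curve j t)) := by
    ext t; simp
  rw [e]
  calc _ ≤ B * Ω.boundaryNorm (U m - u) + (τ / 2 + Ω.boundaryNorm (U m - u)) := by
        refine (eLpNorm_add_le m1 (m2.add m3) (by norm_num)).trans ?_
        refine add_le_add (hfatou m hν) ((eLpNorm_add_le m2 m3 (by norm_num)).trans ?_)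
        exact add_le_add h2.le (Ω.eLpNorm_le_boundaryNorm _ j)
    _ = (B * Ω.boundaryNorm (U m - u) + Ω.boundaryNorm (U m - u)) + τ / 2 := by ring
    _ ≤ τ / 2 + τ / 2 := by gcongr
    _ = τ := ENNReal.add_halves τ

end SmoothDomain

/-! ### Existence of the Szegő kernel -/

namespace SmoothDomain

variable {n : ℕ} {Ω : SmoothDomain n} {φ : ℂ → ℝ} {h h' u u' v : ℂ → ℂ}

/-- A family of functions of the parameters, one on each period interval, descends to a function on
the boundary, because the curves are simple and disjoint. -/
theorem exists_boundary_extension (Ω : SmoothDomain n) (g : Fin n → ℝ → ℂ) :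
    ∃ u : ℂ → ℂ, ∀ j, ∀ t ∈ Ico (0 : ℝ) 1, u (Ω.curve j t) = g j t := by
  classical
  refine ⟨fun z => if h : ∃ j, ∃ t ∈ Ico (0 : ℝ) 1, Ω.curve j t = z then
    g h.choose h.choose_spec.choose else 0, fun j t ht => ?_⟩
  have hex : ∃ k, ∃ s ∈ Ico (0 : ℝ) 1, Ω.curve k s = Ω.curve j t := ⟨j, t, ht, rfl⟩
  simp only [dif_pos hex]
  obtain ⟨hs, heq⟩ := hex.choose_spec.choose_spec
  have h1 := Ω.index_eq_of_curve_eq heq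
  generalize hex.choose_spec.choose = s at *
  generalize hex.choose = k at *
  subst h1
  rw [Ω.simple k hs ht heq]

/-- The square root of the weight along a boundary curve. Multiplication by it carries the weighted
inner product to the inner product of `L²(ds)`. -/
noncomputable def weightRoot (Ω : SmoothDomain n) (φ : ℂ → ℝ) (j : Fin n) (t : ℝ) : ℝ :=
  Real.sqrt (φ (Ω.curve j t))

theorem weightRoot_pos (hφ : Ω.IsWeight φ) (j : Fin n) (t : ℝ) : 0 < Ω.weightRoot φ j t :=
  Real.sqrt_pos.2 (hφ.pos _ (Ω.curve_mem_frontier j t))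

theorem weightRoot_mul_self (hφ : Ω.IsWeight φ) (j : Fin n) (t : ℝ) :
    Ω.weightRoot φ j t * Ω.weightRoot φ j t = φ (Ω.curve j t) :=
  Real.mul_self_sqrt (hφ.pos _ (Ω.curve_mem_frontier j t)).le

theorem continuous_weightRoot (hφ : Ω.IsWeight φ) (j : Fin n) : Continuous (Ω.weightRoot φ j) :=
  Real.continuous_sqrt.comp (hφ.smooth j).continuous

theorem periodic_weightRoot (Ω : SmoothDomain n) (φ : ℂ → ℝ) (j : Fin n) :
    Function.Periodic (Ω.weightRoot φ j) 1 := fun t => by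
  simp only [weightRoot, Ω.periodic j t]

theorem exists_weightRoot_bound (hφ : Ω.IsWeight φ) : ∃ Q > 0, ∀ j t,
    Ω.weightRoot φ j t ≤ Q ∧ (Ω.weightRoot φ j t)⁻¹ ≤ Q := by
  have h1 (j : Fin n) := (Ω.periodic_weightRoot φ j).exists_bound (continuous_weightRoot hφ j)
  have h2 (j : Fin n) : ∃ C, 0 < C ∧ ∀ t, |(Ω.weightRoot φ j t)⁻¹| ≤ C :=
    Function.Periodic.exists_bound (fun t => by simp only [Ω.periodic_weightRoot φ j t])
      ((continuous_weightRoot hφ j).inv₀ fun t => (weightRoot_pos hφ j t).ne')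
  choose A hA0 hA using h1
  choose B hB0 hB using h2
  have sA := fun j => Finset.single_le_sum (f := A) (fun j _ => (hA0 j).le) (Finset.mem_univ j)
  have sB := fun j => Finset.single_le_sum (f := B) (fun j _ => (hB0 j).le) (Finset.mem_univ j)
  have pA := Finset.sum_nonneg fun j (_ : j ∈ Finset.univ) => (hA0 j).le
  have pB := Finset.sum_nonneg fun j (_ : j ∈ Finset.univ) => (hB0 j).le
  refine ⟨∑ j, A j + ∑ j, B j + 1, by linarith, fun j t => ⟨?_, ?_⟩⟩
  · linarith [(le_abs_self _).trans (hA j t), sA j]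
  · linarith [(le_abs_self _).trans (hB j t), sB j]

theorem memLp_mul_of_bound {μ : Measure ℝ} {g : ℝ → ℂ} (hg : MemLp g 2 μ) {q : ℝ → ℝ}
    (hq : Continuous q) {Q : ℝ} (hQ : ∀ t, |q t| ≤ Q) : MemLp (fun t => (q t : ℂ) * g t) 2 μ := by
  refine MemLp.of_le_mul (c := Q) hg
    ((Complex.continuous_ofReal.comp hq).aestronglyMeasurable.mul hg.aestronglyMeasurable)
    (Eventually.of_forall fun t => ?_)
  rw [norm_mul, Complex.norm_real, Real.norm_eq_abs]
  exact mul_le_mul_of_nonneg_right (hQ t) (norm_nonneg _)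

theorem memLp_weightRoot_mul (hφ : Ω.IsWeight φ) (hu : Ω.MemL2 u) (j : Fin n) :
    MemLp (fun t => (Ω.weightRoot φ j t : ℂ) * u (Ω.curve j t)) 2 (Ω.arcLength j) := by
  obtain ⟨Q, -, hQ⟩ := exists_weightRoot_bound hφ
  refine memLp_mul_of_bound (hu j) (continuous_weightRoot hφ j) (Q := Q) fun t => ?_
  rw [abs_of_pos (weightRoot_pos hφ j t)]
  exact (hQ j t).1

theorem weighted_eq_inner (hφ : Ω.IsWeight φ) (u v : ℂ → ℂ) (j : Fin n) (t : ℝ) :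
    u (Ω.curve j t) * conj (v (Ω.curve j t)) * (φ (Ω.curve j t) : ℂ) =
      inner ℂ ((Ω.weightRoot φ j t : ℂ) * v (Ω.curve j t))
        ((Ω.weightRoot φ j t : ℂ) * u (Ω.curve j t)) := by
  rw [← weightRoot_mul_self hφ, RCLike.inner_apply, map_mul, Complex.conj_ofReal]
  push_cast
  ring

theorem integrable_weighted (hφ : Ω.IsWeight φ) (hu : Ω.MemL2 u) (hv : Ω.MemL2 v) (j : Fin n) :
    Integrable (fun t => u (Ω.curve j t) * conj (v (Ω.curve j t)) * (φ (Ω.curve j t) : ℂ))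
      (Ω.arcLength j) := by
  simp_rw [weighted_eq_inner hφ, RCLike.inner_apply]
  exact (memLp_weightRoot_mul hφ hu j).integrable_mul (memLp_weightRoot_mul hφ hv j).star

theorem weightedInner_add_left (hφ : Ω.IsWeight φ) (hu : Ω.MemL2 u) (hu' : Ω.MemL2 u')
    (hv : Ω.MemL2 v) :
    Ω.weightedInner φ (u + u') v = Ω.weightedInner φ u v + Ω.weightedInner φ u' v := by
  unfold weightedInner
  rw [← Finset.sum_add_distrib]
  refine Finset.sum_congr rfl fun j _ => ?_
  rw [← integral_add (integrable_weighted hφ hu hv j) (integrable_weighted hφ hu' hv j)]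
  congr 1; ext t; simp only [Pi.add_apply]; ring

theorem weightedInner_smul_left (Ω : SmoothDomain n) (φ : ℂ → ℝ) (c : ℂ) (u v : ℂ → ℂ) :
    Ω.weightedInner φ (c • u) v = c * Ω.weightedInner φ u v := by
  unfold weightedInner
  rw [Finset.mul_sum]
  refine Finset.sum_congr rfl fun j _ => ?_
  rw [← integral_const_mul]
  congr 1; ext t; simp only [Pi.smul_apply, smul_eq_mul]; ring

theorem weightedInner_smul_right (Ω : SmoothDomain n) (φ : ℂ → ℝ) (c : ℂ) (u v : ℂ → ℂ) :
    Ω.weightedInner φ u (c • v) = conj c * Ω.weightedInner φ u v := by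
  rw [← conj_weightedInner, weightedInner_smul_left, map_mul, conj_weightedInner]

theorem weightedInner_add_right (hφ : Ω.IsWeight φ) (hv : Ω.MemL2 v) (hu : Ω.MemL2 u)
    (hu' : Ω.MemL2 u') :
    Ω.weightedInner φ v (u + u') = Ω.weightedInner φ v u + Ω.weightedInner φ v u' := by
  rw [← conj_weightedInner, weightedInner_add_left hφ hu hu' hv, map_add, conj_weightedInner,
    conj_weightedInner]

theorem weightedInner_sub_right (hφ : Ω.IsWeight φ) (hv : Ω.MemL2 v) (hu : Ω.MemL2 u)
    (hu' : Ω.MemL2 u') :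
    Ω.weightedInner φ v (u - u') = Ω.weightedInner φ v u - Ω.weightedInner φ v u' := by
  have e : u - u' = u + (-1 : ℂ) • u' := by rw [neg_smul, one_smul, sub_eq_add_neg]
  have h1 : Ω.MemL2 ((-1 : ℂ) • u') := fun j => (hu' j).const_smul (-1 : ℂ)
  rw [e, weightedInner_add_right hφ hv hu h1, weightedInner_smul_right]
  simp [sub_eq_add_neg]

theorem MemL2.sum {ι : Type*} (s : Finset ι) {U : ι → ℂ → ℂ} (hU : ∀ i ∈ s, Ω.MemL2 (U i)) :
    Ω.MemL2 (∑ i ∈ s, U i) := fun j => by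
  have := memLp_finsetSum s fun i hi => hU i hi j
  simpa only [Finset.sum_apply] using this

theorem weightedInner_sum_right {ι : Type*} (hφ : Ω.IsWeight φ) (hv : Ω.MemL2 v) (s : Finset ι)
    {U : ι → ℂ → ℂ} (hU : ∀ i ∈ s, Ω.MemL2 (U i)) :
    Ω.weightedInner φ v (∑ i ∈ s, U i) = ∑ i ∈ s, Ω.weightedInner φ v (U i) := by
  classical
  induction s using Finset.induction_on with
  | empty => simp [weightedInner]
  | insert i s hi ih =>
    have h1 : ∀ k ∈ s, Ω.MemL2 (U k) := fun k hk => hU k (Finset.mem_insert_of_mem hk)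
    rw [Finset.sum_insert hi, Finset.sum_insert hi,
      weightedInner_add_right hφ hv (hU i (Finset.mem_insert_self _ _)) (MemL2.sum s h1), ih h1]

theorem eLpNorm_le_weightRoot_mul (hφ : Ω.IsWeight φ) {Q : ℝ}
    (hQ : ∀ j t, Ω.weightRoot φ j t ≤ Q ∧ (Ω.weightRoot φ j t)⁻¹ ≤ Q) (g : ℝ → ℂ) (j : Fin n) :
    eLpNorm g 2 (Ω.arcLength j) ≤ ENNReal.ofReal Q *
      eLpNorm (fun t => (Ω.weightRoot φ j t : ℂ) * g t) 2 (Ω.arcLength j) := by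
  refine eLpNorm_le_mul_eLpNorm_of_ae_le_mul (Eventually.of_forall fun t => ?_) 2
  have hp := weightRoot_pos hφ j t
  rw [norm_mul, Complex.norm_real, Real.norm_of_nonneg hp.le, ← mul_assoc]
  refine le_mul_of_one_le_left (norm_nonneg _) ?_
  calc (1 : ℝ) = (Ω.weightRoot φ j t)⁻¹ * Ω.weightRoot φ j t := by field_simp
    _ ≤ _ := mul_le_mul_of_nonneg_right (hQ j t).2 hp.le

theorem boundaryNorm_eq_zero_of_weightedInner_self (hφ : Ω.IsWeight φ) (hu : Ω.MemL2 u)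
    (h0 : Ω.weightedInner φ u u = 0) : Ω.boundaryNorm u = 0 := by
  obtain ⟨Q, -, hQ⟩ := exists_weightRoot_bound hφ
  have h1 (j : Fin n) : ∫ t, u (Ω.curve j t) * conj (u (Ω.curve j t)) * (φ (Ω.curve j t) : ℂ)
      ∂(Ω.arcLength j) = ((∫ t, ‖(Ω.weightRoot φ j t : ℂ) * u (Ω.curve j t)‖ ^ 2
        ∂(Ω.arcLength j) : ℝ) : ℂ) := by
    rw [← integral_complex_ofReal]
    congr 1; ext t
    rw [weighted_eq_inner hφ, inner_self_eq_norm_sq_to_K]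
    simp
  have h2 : ∑ j, ∫ t, ‖(Ω.weightRoot φ j t : ℂ) * u (Ω.curve j t)‖ ^ 2 ∂(Ω.arcLength j) = 0 := by
    have : Ω.weightedInner φ u u = _ := Finset.sum_congr rfl fun j _ => h1 j
    rw [h0, ← Complex.ofReal_sum] at this
    exact_mod_cast this.symm
  rw [Finset.sum_eq_zero_iff_of_nonneg fun j _ => integral_nonneg fun t => by positivity] at h2
  refine Finset.sum_eq_zero fun j hj => ?_
  have hm := memLp_weightRoot_mul hφ hu j
  have h3 : eLpNorm (fun t => (Ω.weightRoot φ j t : ℂ) * u (Ω.curve j t)) 2 (Ω.arcLength j) = 0 := by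
    have h4 := h2 j hj
    rw [integral_eq_zero_iff_of_nonneg (fun t => by positivity) (hm.integrable_norm_pow two_ne_zero)] at h4
    rw [eLpNorm_eq_zero_iff hm.aestronglyMeasurable (by norm_num)]
    filter_upwards [h4] with t ht
    simpa using ht
  have h5 := eLpNorm_le_weightRoot_mul hφ hQ (fun t => u (Ω.curve j t)) j
  rw [h3, mul_zero] at h5
  exact nonpos_iff_eq_zero.1 h5

/-- The Hilbert space `L²(bΩ, ds)`, as an orthogonal sum over the boundary curves. -/
abbrev BoundaryL2 (Ω : SmoothDomain n) : Type := PiLp 2 fun j => Lp ℂ 2 (Ω.arcLength j)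

/-- The vector `V` of `L²(bΩ, ds)` represents `√φ u` for the boundary values `u` of `h`. -/
def Represents (Ω : SmoothDomain n) (φ : ℂ → ℝ) (V : Ω.BoundaryL2) (h u : ℂ → ℂ) : Prop :=
  Ω.IsHardy h u ∧
    ∀ j, V j =ᵐ[Ω.arcLength j] fun t => (Ω.weightRoot φ j t : ℂ) * u (Ω.curve j t)

theorem exists_represents (hφ : Ω.IsWeight φ) (hh : Ω.IsHardy h u) :
    ∃ V, Ω.Represents φ V h u :=
  ⟨WithLp.toLp 2 fun j => (memLp_weightRoot_mul hφ hh.memL2 j).toLp _, hh,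
    fun j => MemLp.coeFn_toLp (memLp_weightRoot_mul hφ hh.memL2 j)⟩

theorem Represents.add {V V' : Ω.BoundaryL2} (hV : Ω.Represents φ V h u)
    (hV' : Ω.Represents φ V' h' u') : Ω.Represents φ (V + V') (h + h') (u + u') := by
  refine ⟨hV.1.add hV'.1, fun j => ?_⟩
  filter_upwards [Lp.coeFn_add (V j) (V' j), hV.2 j, hV'.2 j] with t h1 h2 h3
  rw [PiLp.add_apply, h1, Pi.add_apply, h2, h3, Pi.add_apply]
  ring

theorem Represents.const_smul {V : Ω.BoundaryL2} (hV : Ω.Represents φ V h u) (c : ℂ) :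
    Ω.Represents φ (c • V) (c • h) (c • u) := by
  refine ⟨hV.1.const_smul c, fun j => ?_⟩
  filter_upwards [Lp.coeFn_smul c (V j), hV.2 j] with t h1 h2
  rw [PiLp.smul_apply, h1, Pi.smul_apply, h2, Pi.smul_apply, smul_eq_mul, smul_eq_mul]
  ring

theorem Represents.boundaryNorm_sub_le (hφ : Ω.IsWeight φ) {Q : ℝ}
    (hQ : ∀ j t, Ω.weightRoot φ j t ≤ Q ∧ (Ω.weightRoot φ j t)⁻¹ ≤ Q) {V V' : Ω.BoundaryL2}
    (hV : ∀ j, V j =ᵐ[Ω.arcLength j] fun t => (Ω.weightRoot φ j t : ℂ) * u (Ω.curve j t))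
    (hV' : ∀ j, V' j =ᵐ[Ω.arcLength j] fun t => (Ω.weightRoot φ j t : ℂ) * u' (Ω.curve j t)) :
    Ω.boundaryNorm (u - u') ≤ ENNReal.ofReal Q * ∑ j, edist (V j) (V' j) := by
  rw [boundaryNorm, Finset.mul_sum]
  refine Finset.sum_le_sum fun j _ => ?_
  refine (eLpNorm_le_weightRoot_mul hφ hQ _ j).trans ?_
  refine mul_le_mul_right (le_of_eq ?_) _
  rw [Lp.edist_def]
  refine eLpNorm_congr_ae ?_
  filter_upwards [hV j, hV' j] with t h1 h2
  rw [Pi.sub_apply, Pi.sub_apply, h1, h2]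
  ring

theorem Represents.unique (hφ : Ω.IsWeight φ) {V : Ω.BoundaryL2} (hV : Ω.Represents φ V h u)
    (hV' : Ω.Represents φ V h' u') {w : ℂ} (hw : w ∈ Ω.carrier) : h w = h' w := by
  obtain ⟨Q, -, hQ⟩ := exists_weightRoot_bound hφ
  have h1 := Represents.boundaryNorm_sub_le hφ hQ hV.2 hV'.2
  simp only [edist_self, Finset.sum_const_zero, mul_zero, nonpos_iff_eq_zero] at h1
  exact sub_eq_zero.1 ((hV.1.sub hV'.1).eq_zero_of_boundaryNorm h1 hw)

/-- The image of the Hardy space in `L²(bΩ, ds)` under multiplication by `√φ`. -/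
noncomputable def hardySubmodule (Ω : SmoothDomain n) {φ : ℂ → ℝ} (hφ : Ω.IsWeight φ) :
    Submodule ℂ Ω.BoundaryL2 where
  carrier := {V | ∃ h u, Ω.Represents φ V h u}
  add_mem' := by
    rintro V V' ⟨h, u, hV⟩ ⟨h', u', hV'⟩
    exact ⟨_, _, hV.add hV'⟩
  zero_mem' := by
    obtain ⟨V, hV⟩ := exists_represents hφ (IsHardy.zero Ω)
    have := hV.const_smul 0
    rw [zero_smul] at this
    exact ⟨_, _, this⟩
  smul_mem' := by
    rintro c V ⟨h, u, hV⟩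
    exact ⟨_, _, hV.const_smul c⟩

theorem isClosed_hardySubmodule (hφ : Ω.IsWeight φ) :
    IsClosed (Ω.hardySubmodule hφ : Set Ω.BoundaryL2) := by
  obtain ⟨Q, -, hQ⟩ := exists_weightRoot_bound hφ
  refine IsSeqClosed.isClosed fun V V₀ hV hlim => ?_
  choose H U hHU using hV
  obtain ⟨u, hu⟩ := Ω.exists_boundary_extension fun j t => ((Ω.weightRoot φ j t)⁻¹ : ℝ) * V₀ j t
  have hae (j : Fin n) : (fun t => u (Ω.curve j t)) =ᵐ[Ω.arcLength j]
      fun t => (((Ω.weightRoot φ j t)⁻¹ : ℝ) : ℂ) * V₀ j t := Ω.ae_arcLength j (hu j)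
  have hu2 : Ω.MemL2 u := fun j => by
    refine (memLp_congr_ae (hae j)).2 (memLp_mul_of_bound (Lp.memLp (V₀ j))
      ((continuous_weightRoot hφ j).inv₀ fun t => (weightRoot_pos hφ j t).ne') (Q := Q) fun t => ?_)
    rw [abs_of_pos (inv_pos.2 (weightRoot_pos hφ j t))]
    exact (hQ j t).2
  have hV₀ (j : Fin n) : V₀ j =ᵐ[Ω.arcLength j]
      fun t => (Ω.weightRoot φ j t : ℂ) * u (Ω.curve j t) := by
    filter_upwards [hae j] with t ht
    have : (Ω.weightRoot φ j t : ℂ) ≠ 0 := by exact_mod_cast (weightRoot_pos hφ j t).ne'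
    rw [ht]
    push_cast
    field_simp
  have hconv : Tendsto (fun m => Ω.boundaryNorm (U m - u)) atTop (𝓝 0) := by
    have h1 : Tendsto (fun m => ENNReal.ofReal Q * ∑ j, edist (V m j) (V₀ j)) atTop (𝓝 0) := by
      have h2 : Tendsto (fun m => ∑ j, edist (V m j) (V₀ j)) atTop (𝓝 (∑ _j : Fin n, 0)) := by
        refine tendsto_finsetSum _ fun j _ => ?_
        have : Tendsto (fun m => V m j) atTop (𝓝 (V₀ j)) :=
          ((PiLp.continuous_apply 2 _ j).tendsto V₀).comp hlim
        exact tendsto_iff_edist_tendsto_0.1 this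
      rw [Finset.sum_const_zero] at h2
      simpa using ENNReal.Tendsto.const_mul (a := ENNReal.ofReal Q) h2 (Or.inr ENNReal.ofReal_ne_top)
    exact tendsto_of_tendsto_of_tendsto_of_le_of_le tendsto_const_nhds h1 (fun _ => zero_le)
      fun m => Represents.boundaryNorm_sub_le hφ hQ (hHU m).2 hV₀
  obtain ⟨h, hh⟩ := IsHardy.of_tendsto (fun m => (hHU m).1) hu2 hconv
  exact ⟨h, u, hh, hV₀⟩

/-- Point evaluation at `w` as a bounded linear functional on the Hardy space. -/
theorem exists_evaluation_functional (hφ : Ω.IsWeight φ) {w : ℂ} (hw : w ∈ Ω.carrier) :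
    ∃ ℓ : StrongDual ℂ (Ω.hardySubmodule hφ), ∀ (V : Ω.hardySubmodule hφ) (h u : ℂ → ℂ),
      Ω.Represents φ V h u → ℓ V = h w := by
  obtain ⟨Q, hQ0, hQ⟩ := exists_weightRoot_bound hφ
  obtain ⟨C, hC⟩ := Ω.exists_evaluation_bound
  choose H U hHU using fun V : Ω.hardySubmodule hφ => V.2
  let L : Ω.hardySubmodule hφ →ₗ[ℂ] ℂ :=
    { toFun := fun V => H V w
      map_add' := fun V V' => Represents.unique hφ (hHU (V + V')) ((hHU V).add (hHU V')) hw
      map_smul' := fun c V => Represents.unique hφ (hHU (c • V)) ((hHU V).const_smul c) hw }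
  have hD := Ω.infDist_pos hw
  set D := Metric.infDist w (frontier Ω.carrier) with hDdef
  have hbound : ∀ V, ‖L V‖ ≤ (C * (Q * n) / D) * ‖V‖ := by
    intro V
    have h1 := hC _ _ (hHU V).1 w hw
    have h2 : Ω.boundaryNorm (U V) ≤ ENNReal.ofReal Q * (n * ‖V‖ₑ) := by
      rw [boundaryNorm]
      calc ∑ j, eLpNorm (fun t => U V (Ω.curve j t)) 2 (Ω.arcLength j)
          ≤ ∑ _j : Fin n, ENNReal.ofReal Q * ‖V‖ₑ := by
            refine Finset.sum_le_sum fun j _ => (eLpNorm_le_weightRoot_mul hφ hQ _ j).trans ?_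
            gcongr
            rw [← eLpNorm_congr_ae ((hHU V).2 j), ← Lp.enorm_def, enorm_le_iff_norm_le]
            exact PiLp.norm_apply_le V.1 j
        _ = _ := by rw [Finset.sum_const, Finset.card_univ, Fintype.card_fin, nsmul_eq_mul]; ring
    have h3 := h1.trans (mul_le_mul_right h2 (C : ENNReal))
    have h4 := ENNReal.toReal_mono (by finiteness) h3
    rw [← hDdef] at h4
    simp only [ENNReal.toReal_mul, toReal_enorm, ENNReal.toReal_ofReal hD.le,
      ENNReal.toReal_ofReal hQ0.le, ENNReal.coe_toReal, ENNReal.toReal_natCast] at h4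
    change ‖H V w‖ ≤ _
    rw [div_mul_eq_mul_div, le_div_iff₀ hD]
    calc _ ≤ _ := h4
      _ = _ := by ring
  refine ⟨L.mkContinuous _ hbound, fun V h u hV => ?_⟩
  exact Represents.unique hφ (hHU V) hV hw

/-- The Szegő kernel exists: the Hardy space is a Hilbert space with bounded point evaluations. -/
theorem exists_isSzegoKernel (hφ : Ω.IsWeight φ) : ∃ K, Ω.IsSzegoKernel φ K := by
  have key : ∀ w ∈ Ω.carrier, ∃ g k : ℂ → ℂ, Ω.IsHardy g k ∧
      ∀ h u : ℂ → ℂ, Ω.IsHardy h u → h w = Ω.weightedInner φ u k := by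
    intro w hw
    have : CompleteSpace (Ω.hardySubmodule hφ) :=
      (isClosed_hardySubmodule hφ).completeSpace_coe
    obtain ⟨ℓ, hℓ⟩ := exists_evaluation_functional hφ hw
    set W := (InnerProductSpace.toDual ℂ (Ω.hardySubmodule hφ)).symm ℓ with hW
    obtain ⟨g, k, hgk⟩ := W.2
    refine ⟨g, k, hgk.1, fun h u hh => ?_⟩
    obtain ⟨V, hV⟩ := exists_represents hφ hh
    let V' : Ω.hardySubmodule hφ := ⟨V, h, u, hV⟩
    rw [← hℓ V' h u hV, ← InnerProductSpace.toDual_symm_apply, ← hW, Submodule.coe_inner,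
      PiLp.inner_apply, weightedInner]
    refine Finset.sum_congr rfl fun j _ => ?_
    rw [L2.inner_def]
    refine integral_congr_ae ?_
    filter_upwards [hV.2 j, hgk.2 j] with t h1 h2
    rw [weighted_eq_inner hφ, ← h1, ← h2]
  choose! g k hgk using key
  exact ⟨fun z w => g w z, fun w hw => ⟨k w, hgk w hw⟩⟩

theorem isSzegoKernel_szegoKernel (hφ : Ω.IsWeight φ) :
    Ω.IsSzegoKernel φ (Ω.szegoKernel φ) := by
  have h := exists_isSzegoKernel hφ
  rw [szegoKernel, dif_pos h]
  exact h.choose_spec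

end SmoothDomain

/-! ### Boundary values of proper maps to the disc -/

/-- A gradient estimate for a holomorphic self-map of the disc, from the Borel–Carathéodory
theorem: the derivative is controlled by the distance of the value to the unit circle. -/
theorem norm_deriv_le_of_mapsTo_ball {f : ℂ → ℂ} {z : ℂ} {R : ℝ} (hR : 0 < R)
    (hf : DifferentiableOn ℂ f (Metric.ball z R)) (hm : ∀ x ∈ Metric.ball z R, ‖f x‖ < 1)
    (hz0 : f z ≠ 0) : ‖deriv f z‖ ≤ 4 * (1 - ‖f z‖) / R := by
  have hMpos : 0 < 1 - ‖f z‖ := sub_pos.2 (hm z (Metric.mem_ball_self hR))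
  have hn : 0 < ‖f z‖ := norm_pos_iff.2 hz0
  -- Rotate the value at `z` to the positive axis; then `e (f - f z)` has real part at most
  -- `1 - ‖f z‖`.
  set e : ℂ := conj (f z) / ‖f z‖ with he
  have hen : ‖e‖ = 1 := by
    rw [he, norm_div, RCLike.norm_conj, Complex.norm_real, norm_norm, div_self hn.ne']
  have hez : e * f z = ‖f z‖ := by
    have : (‖f z‖ : ℂ) ≠ 0 := by exact_mod_cast hn.ne'
    rw [he, div_mul_eq_mul_div, mul_comm, Complex.mul_conj, Complex.normSq_eq_norm_sq]
    field_simp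
    push_cast
    ring
  set g : ℂ → ℂ := fun x => e * (f (z + x) - f z) with hg
  have hmem {x : ℂ} (hx : x ∈ Metric.ball (0 : ℂ) R) : z + x ∈ Metric.ball z R := by
    rw [mem_ball_zero_iff] at hx
    rw [Metric.mem_ball, dist_eq_norm, add_sub_cancel_left]
    exact hx
  have hgd : DifferentiableOn ℂ g (Metric.ball 0 R) := by
    have h1 : DifferentiableOn ℂ (fun x => f (z + x)) (Metric.ball 0 R) :=
      hf.comp (by fun_prop) fun x hx => hmem hx
    exact (h1.sub_const _).const_mul e
  have hgm : MapsTo g (Metric.ball 0 R) {w | w.re ≤ 1 - ‖f z‖} := by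
    intro x hx
    have h1 : (e * f (z + x)).re ≤ 1 := by
      refine (Complex.re_le_norm _).trans ?_
      rw [norm_mul, hen, one_mul]
      exact (hm _ (hmem hx)).le
    simp only [hg, mem_ofPred_eq, mul_sub, Complex.sub_re, hez, Complex.ofReal_re]
    linarith
  have hder : HasDerivAt f (deriv f z) z :=
    (hf.differentiableAt (Metric.ball_mem_nhds z hR)).hasDerivAt
  refine hder.le_of_lip' (by positivity) ?_
  filter_upwards [Metric.ball_mem_nhds z (half_pos hR)] with x hx
  rw [Metric.mem_ball, dist_eq_norm] at hx
  have hx0 : x - z ∈ Metric.ball (0 : ℂ) R := by rw [mem_ball_zero_iff]; linarith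
  have h1 := Complex.borelCaratheodory_zero hMpos hgd hgm hR hx0 (by simp [hg])
  simp only [hg, norm_mul, hen, one_mul, add_sub_cancel] at h1
  refine h1.trans ?_
  rw [div_le_iff₀ (by linarith), div_mul_eq_mul_div, div_mul_eq_mul_div, le_div_iff₀ hR]
  have : 0 ≤ (1 - ‖f z‖) * ‖x - z‖ := by positivity
  nlinarith

namespace SmoothDomain

variable {n : ℕ} {Ω : SmoothDomain n} {f : ℂ → ℂ}

theorem isCompact_sublevel (hmaps : MapsTo f Ω.carrier (Metric.ball 0 1))
    (hproper : IsProperMap (hmaps.restrict f Ω.carrier (Metric.ball 0 1))) {ρ : ℝ} (hρ : ρ < 1) :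
    IsCompact {z | z ∈ Ω.carrier ∧ ‖f z‖ ≤ ρ} := by
  have h1 : IsCompact ((↑) ⁻¹' Metric.closedBall (0 : ℂ) ρ : Set (Metric.ball (0 : ℂ) 1)) := by
    rw [Subtype.isCompact_iff]
    rw [Subtype.image_preimage_coe, inter_eq_self_of_subset_right]
    · exact isCompact_closedBall _ _
    · exact Metric.closedBall_subset_ball hρ
  have h2 := (hproper.isCompact_preimage h1).image continuous_subtype_val
  convert h2 using 1
  ext z
  simp only [mem_ofPred_eq, mem_image, mem_preimage, Subtype.exists, exists_and_right,
    exists_eq_right, MapsTo.val_restrict_apply, mem_closedBall_zero_iff]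
  constructor
  · rintro ⟨h1, h2⟩; exact ⟨h1, h2⟩
  · rintro ⟨h1, h2⟩; exact ⟨h1, h2⟩

/-- A proper map to the disc tends to the unit circle at the boundary. -/
theorem exists_norm_gt_near_boundary (hmaps : MapsTo f Ω.carrier (Metric.ball 0 1))
    (hproper : IsProperMap (hmaps.restrict f Ω.carrier (Metric.ball 0 1))) {ρ : ℝ} (hρ : ρ < 1) :
    ∃ δ > 0, ∀ z ∈ Ω.carrier, Metric.infDist z (frontier Ω.carrier) < δ → ρ < ‖f z‖ := by
  have hK := isCompact_sublevel hmaps hproper hρ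
  rcases eq_empty_or_nonempty {z | z ∈ Ω.carrier ∧ ‖f z‖ ≤ ρ} with he | hne
  · refine ⟨1, one_pos, fun z hz _ => ?_⟩
    by_contra hle
    exact (he ▸ (⟨hz, not_lt.1 hle⟩ : z ∈ {z | z ∈ Ω.carrier ∧ ‖f z‖ ≤ ρ}) : z ∈ (∅ : Set ℂ))
  · obtain ⟨z₀, hz₀, hmin⟩ := hK.exists_isMinOn hne
      (Metric.continuous_infDist_pt (frontier Ω.carrier)).continuousOn
    refine ⟨_, Ω.infDist_pos hz₀.1, fun z hz hd => ?_⟩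
    by_contra hle
    exact absurd hd (not_lt.2 (hmin ⟨hz, not_lt.1 hle⟩))

/-- Comparison of `1 / f` with `1 / (z - c)` near an exterior disc: if the disc of radius `r` about
`c` lies outside the domain and `1 / 2 < ‖f‖` in the part of the domain at distance at most `2 r`
from `c`, then `r ≤ ‖z - c‖ ‖f z‖` there. -/
theorem le_norm_mul_of_exterior_ball (hf : DifferentiableOn ℂ f Ω.carrier)
    (hmaps : MapsTo f Ω.carrier (Metric.ball 0 1))
    (hproper : IsProperMap (hmaps.restrict f Ω.carrier (Metric.ball 0 1))) {c : ℂ} {r : ℝ}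
    (hr : 0 < r) (hball : Disjoint (Metric.ball c r) Ω.carrier)
    (hhalf : ∀ x ∈ Ω.carrier, ‖x - c‖ ≤ 2 * r → 1 / 2 < ‖f x‖) {z : ℂ} (hz : z ∈ Ω.carrier)
    (hzc : ‖z - c‖ < 2 * r) : r ≤ ‖z - c‖ * ‖f z‖ := by
  have hout {x : ℂ} (hx : x ∈ Ω.carrier) : r ≤ ‖x - c‖ := by
    by_contra hlt
    exact Set.disjoint_left.1 hball (by rw [Metric.mem_ball, dist_eq_norm]; exact not_le.1 hlt) hx
  -- The maximum principle on the part where `‖f‖ < 1 - η`, which stays away from the boundary.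
  have key : ∀ η ∈ Ioo (0 : ℝ) 1, (1 - η) * r ≤ ‖z - c‖ * ‖f z‖ := by
    intro η hη
    rcases lt_or_ge ‖f z‖ (1 - η) with hlt | hge
    swap
    · rw [mul_comm]
      exact mul_le_mul (hout hz) hge (by linarith [hη.2]) (norm_nonneg _)
    set U : Set ℂ := {x | x ∈ Ω.carrier ∧ ‖f x‖ < 1 - η ∧ ‖x - c‖ < 2 * r} with hU
    have hUo : IsOpen U := by
      have h1 : IsOpen (Ω.carrier ∩ f ⁻¹' {y | ‖y‖ < 1 - η}) :=
        hf.continuousOn.isOpen_inter_preimage Ω.isOpen (isOpen_lt continuous_norm continuous_const)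
      have h2 : IsOpen {x : ℂ | ‖x - c‖ < 2 * r} := isOpen_lt (by fun_prop) continuous_const
      convert h1.inter h2 using 1
      ext x
      exact ⟨fun h => ⟨⟨h.1, h.2.1⟩, h.2.2⟩, fun h => ⟨h.1.1, h.1.2, h.2⟩⟩
    have hKc := (isCompact_sublevel hmaps hproper (by linarith [hη.1] : 1 - η < 1)).isClosed
    have hcl : closure U ⊆ {x | (x ∈ Ω.carrier ∧ ‖f x‖ ≤ 1 - η) ∧ ‖x - c‖ ≤ 2 * r} :=
      closure_minimal (fun x hx => ⟨⟨hx.1, hx.2.1.le⟩, hx.2.2.le⟩)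
        (hKc.inter (isClosed_le (f := fun x : ℂ => ‖x - c‖) (by fun_prop) continuous_const))
    have hne {x : ℂ} (hx : x ∈ closure U) : (x - c) * f x ≠ 0 := by
      have h1 := hcl hx
      have h2 := hhalf x h1.1.1 h1.2
      have h3 := hout h1.1.1
      refine mul_ne_zero (norm_pos_iff.1 (hr.trans_le h3)) (norm_pos_iff.1 (by linarith))
    set g : ℂ → ℂ := fun x => r / ((x - c) * f x) with hg
    have hgd : DifferentiableOn ℂ g (closure U) := fun x hx => by
      have h1 := hf.differentiableAt (Ω.isOpen.mem_nhds (hcl hx).1.1)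
      exact ((differentiableAt_const _).div ((differentiableAt_id.sub_const c).mul h1)
        (hne hx)).differentiableWithinAt
    have hη1 : 0 < 1 - η := by linarith [hη.2]
    have hgf : ∀ x ∈ frontier U, ‖g x‖ ≤ (1 - η)⁻¹ := by
      intro x hx
      have hxc := hcl hx.1
      have h2 := hhalf x hxc.1.1 hxc.2
      have h3 := hout hxc.1.1
      have hpos : 0 < ‖x - c‖ * ‖f x‖ := mul_pos (hr.trans_le h3) (by linarith)
      rw [hg, norm_div, norm_mul, Complex.norm_real, Real.norm_of_nonneg hr.le, div_le_iff₀ hpos,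
        inv_mul_eq_div, le_div_iff₀ hη1]
      rw [hUo.frontier_eq] at hx
      rcases hxc.1.2.lt_or_eq with h4 | h4
      · have h5 : ‖x - c‖ = 2 * r := by
          by_contra hne
          exact hx.2 ⟨hxc.1.1, h4, lt_of_le_of_ne hxc.2 hne⟩
        rw [h5]
        nlinarith [hη.1]
      · rw [h4]
        exact mul_le_mul_of_nonneg_right h3 hη1.le
    have hUb : Bornology.IsBounded U := Ω.isBounded.subset fun x hx => hx.1
    have hfin := Complex.norm_le_of_forall_mem_frontier_norm_le hUb hgd.diffContOnCl hgf
      (subset_closure (show z ∈ U from ⟨hz, hlt, hzc⟩))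
    have hzU : z ∈ closure U := subset_closure ⟨hz, hlt, hzc⟩
    have hpos : 0 < ‖z - c‖ * ‖f z‖ := by rw [← norm_mul]; exact norm_pos_iff.2 (hne hzU)
    rw [hg, norm_div, norm_mul, Complex.norm_real, Real.norm_of_nonneg hr.le, div_le_iff₀ hpos,
        inv_mul_eq_div, le_div_iff₀ hη1] at hfin
    linarith
  have ht : Tendsto (fun η : ℝ => (1 - η) * r) (𝓝[>] 0) (𝓝 ((1 - 0) * r)) :=
    (((continuous_const.sub continuous_id).mul continuous_const).tendsto 0).mono_left
      nhdsWithin_le_nhds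
  rw [sub_zero, one_mul] at ht
  refine le_of_tendsto ht ?_
  filter_upwards [Ioo_mem_nhdsGT one_pos] with η hη using key η hη

/-- **Hopf-type estimate**: `1 - ‖f‖` vanishes at least linearly at the boundary. -/
theorem exists_one_sub_norm_le (hf : DifferentiableOn ℂ f Ω.carrier)
    (hmaps : MapsTo f Ω.carrier (Metric.ball 0 1))
    (hproper : IsProperMap (hmaps.restrict f Ω.carrier (Metric.ball 0 1))) :
    ∃ C > 0, ∃ δ > 0, ∀ z ∈ Ω.carrier, Metric.infDist z (frontier Ω.carrier) < δ →
      1 - ‖f z‖ ≤ C * Metric.infDist z (frontier Ω.carrier) ∧ 1 / 2 < ‖f z‖ := by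
  obtain ⟨δ₀, hδ₀, hhalf⟩ := exists_norm_gt_near_boundary hmaps hproper
    (by norm_num : (1 / 2 : ℝ) < 1)
  obtain ⟨ε₀, hε₀⟩ := Ω.exists_isCollar
  have hε₀p := hε₀.pos
  set r := min ε₀ (δ₀ / 4) with hr
  have hrp : 0 < r := lt_min hε₀p (by linarith)
  have hcol := hε₀.mono hrp (min_le_left _ _)
  have hr4 : 4 * r ≤ δ₀ := by linarith [min_le_right ε₀ (δ₀ / 4)]
  refine ⟨r⁻¹, inv_pos.2 hrp, r, hrp, fun z hz hd => ⟨?_, hhalf z hz (by linarith)⟩⟩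
  obtain ⟨j, t, -, heq⟩ := hcol.exists_eq hz hd.le
  have hdp := Ω.infDist_pos hz
  set d := Metric.infDist z (frontier Ω.carrier) with hdd
  set c := Ω.normalPoint j t (-r) with hc
  have hzc : ‖z - c‖ = r + d := by
    have : z - c = ((r + d : ℝ) : ℂ) * (Complex.I * Ω.tangent j t) := by
      rw [heq, hc, normalPoint, normalPoint]; push_cast; ring
    rw [this, norm_mul, norm_mul, norm_tangent, Complex.norm_I, Complex.norm_real,
      Real.norm_of_nonneg (by linarith), mul_one, mul_one]
  have h1 := le_norm_mul_of_exterior_ball hf hmaps hproper hrp (hcol.ball_disjoint j t)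
    (fun x hx hxc => hhalf x hx ?_) hz (by rw [hzc]; linarith)
  · rw [hzc] at h1
    rw [inv_mul_eq_div, le_div_iff₀ hrp]
    have h2 : ‖f z‖ < 1 := mem_ball_zero_iff.1 (hmaps hz)
    nlinarith
  · have h2 := Metric.infDist_le_dist_of_mem (x := x) (Ω.curve_mem_frontier j t)
    have h3 : ‖c - Ω.curve j t‖ = r := by
      rw [hc, norm_normalPoint_sub_curve, abs_neg, abs_of_pos hrp]
    have h4 : dist x (Ω.curve j t) ≤ ‖x - c‖ + ‖c - Ω.curve j t‖ := by
      rw [dist_eq_norm]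
      calc _ = ‖(x - c) + (c - Ω.curve j t)‖ := by congr 1; ring
        _ ≤ _ := norm_add_le _ _
    linarith

theorem ball_infDist_subset (Ω : SmoothDomain n) {z : ℂ} (hz : z ∈ Ω.carrier) :
    Metric.ball z (Metric.infDist z (frontier Ω.carrier)) ⊆ Ω.carrier := by
  have hd : Disjoint (Metric.ball z (Metric.infDist z (frontier Ω.carrier)))
      (frontier Ω.carrier) := by
    refine Set.disjoint_left.2 fun x hx hxf => ?_
    have := Metric.infDist_le_dist_of_mem (x := z) hxf
    rw [Metric.mem_ball, dist_comm] at hx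
    linarith
  exact ((convex_ball _ _).isPreconnected.subset_of_disjoint_frontier hd
    ⟨z, Metric.mem_ball_self (Ω.infDist_pos hz), subset_closure hz⟩).trans interior_subset

/-- A proper holomorphic map to the disc has unimodular boundary values along the normals. Its
derivative is at most a constant times `(1 - ‖f‖) / dist`, which is bounded by the Hopf-type
estimate, so the map is Lipschitz along the normals. -/
theorem exists_boundary_values (hf : DifferentiableOn ℂ f Ω.carrier)
    (hmaps : MapsTo f Ω.carrier (Metric.ball 0 1))
    (hproper : IsProperMap (hmaps.restrict f Ω.carrier (Metric.ball 0 1))) :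
    ∃ b : ℂ → ℂ, ∀ j, ∀ t ∈ Ico (0 : ℝ) 1, ‖b (Ω.curve j t)‖ = 1 ∧
      Tendsto (fun ν => f (Ω.normalPoint j t ν)) (𝓝[>] 0) (𝓝 (b (Ω.curve j t))) := by
  obtain ⟨C, hC, δ, hδ, hnear⟩ := exists_one_sub_norm_le hf hmaps hproper
  obtain ⟨ε₀, hε₀⟩ := Ω.exists_isCollar
  set ε := min ε₀ δ with hε
  have hεp : 0 < ε := lt_min hε₀.pos hδ
  have hcol := hε₀.mono hεp (min_le_left _ _)
  have hdist (j : Fin n) (t : ℝ) {ν : ℝ} (hν : ν ∈ Ioo 0 ε) :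
      Metric.infDist (Ω.normalPoint j t ν) (frontier Ω.carrier) ≤ ν := by
    refine (Metric.infDist_le_dist_of_mem (Ω.curve_mem_frontier j t)).trans ?_
    rw [dist_eq_norm, norm_normalPoint_sub_curve, abs_of_pos hν.1]
  have hlim (j : Fin n) (t : ℝ) : ∃ y, ‖y‖ = 1 ∧
      Tendsto (fun ν => f (Ω.normalPoint j t ν)) (𝓝[>] 0) (𝓝 y) := by
    have hmem {ν : ℝ} (hν : ν ∈ Ioo 0 ε) := hcol.inside j t ν hν.1 hν.2.le
    have hb {ν : ℝ} (hν : ν ∈ Ioo 0 ε) := hnear _ (hmem hν)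
      ((hdist j t hν).trans_lt (hν.2.trans_le (min_le_right _ _)))
    have hder : ∀ ν ∈ Ioo 0 ε, HasDerivWithinAt (fun ν => f (Ω.normalPoint j t ν))
        (deriv f (Ω.normalPoint j t ν) * (Complex.I * Ω.tangent j t)) (Ioo 0 ε) ν :=
      fun ν hν => (hcol.hasDerivAt_comp_right j hf hν t).hasDerivWithinAt
    have hbd : ∀ ν ∈ Ioo 0 ε,
        ‖deriv f (Ω.normalPoint j t ν) * (Complex.I * Ω.tangent j t)‖₊ ≤ Real.toNNReal (4 * C) := by
      intro ν hν
      rw [← NNReal.coe_le_coe, coe_nnnorm, Real.coe_toNNReal _ (by linarith), norm_mul, norm_mul,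
        Complex.norm_I, norm_tangent, mul_one, mul_one]
      have hd := Ω.infDist_pos (hmem hν)
      have hsub := Ω.ball_infDist_subset (hmem hν)
      refine (norm_deriv_le_of_mapsTo_ball hd (hf.mono hsub)
        (fun x hx => mem_ball_zero_iff.1 (hmaps (hsub hx)))
        (norm_pos_iff.1 (by linarith [(hb hν).2]))).trans ?_
      rw [div_le_iff₀ hd]
      linarith [(hb hν).1]
    have hlip : LipschitzOnWith (Real.toNNReal (4 * C)) (fun ν => f (Ω.normalPoint j t ν))
        (Ioo 0 ε) :=
      (convex_Ioo 0 ε).lipschitzOnWith_of_nnnorm_hasDerivWithin_le hder hbd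
    have hcauchy : Cauchy ((𝓝[>] (0 : ℝ)).map fun ν => f (Ω.normalPoint j t ν)) :=
      (cauchy_nhds.mono nhdsWithin_le_nhds : Cauchy (𝓝[>] (0 : ℝ))).map_of_le
        hlip.uniformContinuousOn (le_principal_iff.2 (Ioo_mem_nhdsGT hεp))
    obtain ⟨y, hy⟩ := CompleteSpace.complete hcauchy
    refine ⟨y, tendsto_nhds_unique (Tendsto.norm hy : Tendsto _ (𝓝[>] (0 : ℝ)) _) ?_, hy⟩
    have hl : Tendsto (fun ν : ℝ => 1 - C * ν) (𝓝[>] 0) (𝓝 1) := by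
      have : Tendsto (fun ν : ℝ => 1 - C * ν) (𝓝 0) (𝓝 (1 - C * 0)) :=
        (continuous_const.sub (continuous_const.mul continuous_id)).tendsto 0
      rw [mul_zero, sub_zero] at this
      exact this.mono_left nhdsWithin_le_nhds
    refine tendsto_of_tendsto_of_tendsto_of_le_of_le' hl tendsto_const_nhds ?_ ?_
    · filter_upwards [Ioo_mem_nhdsGT hεp] with ν hν
      have h1 := (hb hν).1
      have h2 := mul_le_mul_of_nonneg_left (hdist j t hν) hC.le
      linarith
    · filter_upwards [Ioo_mem_nhdsGT hεp] with ν hν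
      exact (mem_ball_zero_iff.1 (hmaps (hmem hν))).le
  choose y hy1 hy2 using hlim
  obtain ⟨b, hb⟩ := Ω.exists_boundary_extension y
  refine ⟨b, fun j t ht => ?_⟩
  rw [hb j t ht]
  exact ⟨hy1 j t, hy2 j t⟩

end SmoothDomain

/-! ### Multiplication and division by a proper map -/

/-- A holomorphic function vanishing at the zeros of `f` is divisible by `f` if all zeros of `f` are
simple. -/
theorem exists_mul_eq_of_simple_zeros {U : Set ℂ} (hU : IsOpen U) {f h : ℂ → ℂ}
    (hf : DifferentiableOn ℂ f U) (hh : DifferentiableOn ℂ h U)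
    (hsimple : ∀ z ∈ U, f z = 0 → deriv f z ≠ 0) (hzero : ∀ z ∈ U, f z = 0 → h z = 0) :
    ∃ q : ℂ → ℂ, DifferentiableOn ℂ q U ∧ ∀ z ∈ U, q z * f z = h z := by
  classical
  refine ⟨fun z => if f z = 0 then deriv h z / deriv f z else h z / f z, fun a ha => ?_,
    fun z hz => ?_⟩
  · refine DifferentiableAt.differentiableWithinAt ?_
    have hU' := hU.mem_nhds ha
    have hdf : DifferentiableAt ℂ (dslope f a) a :=
      (((Complex.differentiableOn_dslope hU').2 hf).differentiableAt hU')
    have hdh : DifferentiableAt ℂ (dslope h a) a :=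
      (((Complex.differentiableOn_dslope hU').2 hh).differentiableAt hU')
    by_cases h0 : f a = 0
    · have hne : dslope f a a ≠ 0 := by rw [dslope_same]; exact hsimple a ha h0
      refine (hdh.div hdf hne).congr_of_eventuallyEq ?_
      filter_upwards [hdf.continuousAt.eventually_ne hne, hU'] with z hz hzU
      rcases eq_or_ne z a with rfl | hza
      · simp [h0]
      · have e1 := sub_smul_dslope f a z
        have e2 := sub_smul_dslope h a z
        rw [h0, sub_zero, smul_eq_mul] at e1
        rw [hzero a ha h0, sub_zero, smul_eq_mul] at e2
        have hsub : z - a ≠ 0 := sub_ne_zero.2 hza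
        have hfz : f z ≠ 0 := by rw [← e1]; exact mul_ne_zero hsub hz
        rw [if_neg hfz, Pi.div_apply, ← e1, ← e2, mul_div_mul_left _ _ hsub]
    · have hfd := hf.differentiableAt hU'
      refine ((hh.differentiableAt hU').div hfd h0).congr_of_eventuallyEq ?_
      filter_upwards [hfd.continuousAt.eventually_ne h0] with z hz
      rw [if_neg hz, Pi.div_apply]
  · by_cases h0 : f z = 0
    · rw [h0, mul_zero, hzero z hz h0]
    · simp only [if_neg h0]
      exact div_mul_cancel₀ _ h0

namespace SmoothDomain

variable {n : ℕ} {Ω : SmoothDomain n} {f h q p b u v : ℂ → ℂ} {φ : ℂ → ℝ}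

/-- **Bounded multipliers.** If near the boundary `q = p h` with `h` in the Hardy space and `p`
bounded with boundary values `b` along the inner normals, then `q` belongs to the Hardy space and
has the boundary values of `h` multiplied by `b`. -/
theorem IsHardy.mul (hh : Ω.IsHardy h u) (hq : DifferentiableOn ℂ q Ω.carrier) {B : ℝ}
    (hnear : ∀ j, ∀ᶠ ν in 𝓝[>] (0 : ℝ), (Continuous fun t => p (Ω.normalPoint j t ν)) ∧
      ∀ t, ‖p (Ω.normalPoint j t ν)‖ ≤ B ∧
        q (Ω.normalPoint j t ν) = p (Ω.normalPoint j t ν) * h (Ω.normalPoint j t ν))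
    (hlim : ∀ j, ∀ t ∈ Ico (0 : ℝ) 1, Tendsto (fun ν => p (Ω.normalPoint j t ν)) (𝓝[>] 0)
      (𝓝 (b (Ω.curve j t)))) : Ω.IsHardy q (b * u) := by
  have hbB (j : Fin n) (t : ℝ) (ht : t ∈ Ico (0 : ℝ) 1) : ‖b (Ω.curve j t)‖ ≤ B :=
    le_of_tendsto (hlim j t ht).norm ((hnear j).mono fun ν hν => (hν.2 t).1)
  have hbm (j : Fin n) : AEStronglyMeasurable (fun t => b (Ω.curve j t)) (Ω.arcLength j) := by
    obtain ⟨ν, hν, hν'⟩ := exists_seq_forall_of_frequently (hnear j).frequently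
    refine aestronglyMeasurable_of_tendsto_ae atTop
      (fun k => (hν' k).1.aestronglyMeasurable) (Ω.ae_arcLength j fun t ht => ?_)
    exact (hlim j t ht).comp hν
  have hmem : Ω.MemL2 (b * u) := fun j =>
    MemLp.of_le_mul (c := B) (hh.memL2 j) ((hbm j).mul (hh.memL2 j).aestronglyMeasurable)
      (Ω.ae_arcLength j fun t ht => by
        rw [Pi.mul_apply, norm_mul]
        exact mul_le_mul_of_nonneg_right (hbB j t ht) (norm_nonneg _))
  refine ⟨hq, hmem, fun j => ?_⟩
  change Tendsto (fun ν => eLpNorm (fun t => q (Ω.normalPoint j t ν) - (b * u) (Ω.curve j t)) 2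
    (Ω.arcLength j)) (𝓝[>] 0) (𝓝 0)
  -- `q - b u = p (h - u) + (p - b) u`; the second summand tends to `0` by dominated convergence.
  have h1 : Tendsto (fun ν => ENNReal.ofReal B *
      eLpNorm (fun t => h (Ω.normalPoint j t ν) - u (Ω.curve j t)) 2 (Ω.arcLength j))
      (𝓝[>] 0) (𝓝 0) := by
    simpa using ENNReal.Tendsto.const_mul (a := ENNReal.ofReal B) (hh.tendsto_normalPoint j)
      (Or.inr ENNReal.ofReal_ne_top)
  have hmeas2 {ν : ℝ} (hν : Continuous fun t => p (Ω.normalPoint j t ν)) : AEStronglyMeasurable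
      (fun t => (p (Ω.normalPoint j t ν) - b (Ω.curve j t)) * u (Ω.curve j t)) (Ω.arcLength j) :=
    (hν.aestronglyMeasurable.sub (hbm j)).mul (hh.memL2 j).aestronglyMeasurable
  have h2 : Tendsto (fun ν => eLpNorm
      (fun t => (p (Ω.normalPoint j t ν) - b (Ω.curve j t)) * u (Ω.curve j t)) 2 (Ω.arcLength j))
      (𝓝[>] 0) (𝓝 0) := by
    simp only [eLpNorm_eq_lintegral_rpow_enorm_toReal two_ne_zero ENNReal.ofNat_ne_top]
    have h3 : Tendsto (fun ν => ∫⁻ t, ‖(p (Ω.normalPoint j t ν) - b (Ω.curve j t)) *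
        u (Ω.curve j t)‖ₑ ^ (2 : ENNReal).toReal ∂Ω.arcLength j) (𝓝[>] 0)
        (𝓝 (∫⁻ _t, 0 ∂Ω.arcLength j)) := by
      refine tendsto_lintegral_filter_of_dominated_convergence'
        (fun t => (ENNReal.ofReal (2 * B) * ‖u (Ω.curve j t)‖ₑ) ^ (2 : ENNReal).toReal) ?_ ?_ ?_ ?_
      · filter_upwards [hnear j] with ν hν
        exact (hmeas2 hν.1).enorm.pow_const _
      · filter_upwards [hnear j] with ν hν
        refine Ω.ae_arcLength j fun t ht => ?_
        refine ENNReal.rpow_le_rpow ?_ ENNReal.toReal_nonneg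
        rw [enorm_mul]
        gcongr
        rw [← ofReal_norm]
        refine ENNReal.ofReal_le_ofReal ((norm_sub_le _ _).trans ?_)
        linarith [(hν.2 t).1, hbB j t ht]
      · simp_rw [ENNReal.mul_rpow_of_nonneg _ _ (ENNReal.toReal_nonneg (a := 2))]
        rw [lintegral_const_mul' _ _ (by finiteness)]
        exact ENNReal.mul_ne_top (by finiteness) (lintegral_rpow_enorm_lt_top_of_eLpNorm_lt_top
          two_ne_zero ENNReal.ofNat_ne_top (hh.memL2 j).eLpNorm_lt_top).ne
      · refine Ω.ae_arcLength j fun t ht => ?_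
        have h4 := (((hlim j t ht).sub_const (b (Ω.curve j t))).mul_const
          (u (Ω.curve j t))).enorm.ennrpow_const (2 : ENNReal).toReal
        simpa using h4
    simpa using h3.ennrpow_const (1 / (2 : ENNReal).toReal)
  have h3 := h1.add h2
  rw [add_zero] at h3
  refine tendsto_of_tendsto_of_tendsto_of_le_of_le' tendsto_const_nhds h3
    (Eventually.of_forall fun _ => zero_le) ?_
  filter_upwards [hnear j, hh.eventually_aestronglyMeasurable j] with ν hν hm
  have hm1 : AEStronglyMeasurable (fun t => p (Ω.normalPoint j t ν) *
      (h (Ω.normalPoint j t ν) - u (Ω.curve j t))) (Ω.arcLength j) :=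
    hν.1.aestronglyMeasurable.mul hm
  refine le_trans (le_of_eq ?_) ((eLpNorm_add_le hm1 (hmeas2 hν.1) (by norm_num)).trans
    (add_le_add_left (eLpNorm_le_mul_eLpNorm_of_ae_le_mul (Eventually.of_forall fun t => ?_) 2) _))
  · congr 1
    ext t
    simp only [Pi.add_apply, Pi.mul_apply, (hν.2 t).2]
    ring
  · rw [norm_mul]
    exact mul_le_mul_of_nonneg_right (hν.2 t).1 (norm_nonneg _)

/-- The Hardy space is invariant under multiplication by a map to the disc with boundary values
along the normals. -/
theorem IsHardy.mul_of_mapsTo_ball (hh : Ω.IsHardy h u) (hf : DifferentiableOn ℂ f Ω.carrier)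
    (hmaps : MapsTo f Ω.carrier (Metric.ball 0 1))
    (hb : ∀ j, ∀ t ∈ Ico (0 : ℝ) 1, Tendsto (fun ν => f (Ω.normalPoint j t ν)) (𝓝[>] 0)
      (𝓝 (b (Ω.curve j t)))) : Ω.IsHardy (f * h) (b * u) := by
  obtain ⟨ε, hε⟩ := Ω.exists_isCollar
  refine hh.mul (hf.mul hh.holomorphic) (B := 1) (fun j => ?_) hb
  filter_upwards [Ω.eventually_continuous_comp hf.continuousOn j, Ioo_mem_nhdsGT hε.pos]
    with ν hν hνε
  exact ⟨hν, fun t => ⟨(mem_ball_zero_iff.1 (hmaps (hε.inside j t ν hνε.1 hνε.2.le))).le, rfl⟩⟩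

/-- Division by a proper map to the disc does not lead out of the Hardy space, as long as the
quotient is holomorphic: the map is bounded below near the boundary. -/
theorem IsHardy.of_mul_eq (hh : Ω.IsHardy h u) (hf : DifferentiableOn ℂ f Ω.carrier)
    (hmaps : MapsTo f Ω.carrier (Metric.ball 0 1))
    (hproper : IsProperMap (hmaps.restrict f Ω.carrier (Metric.ball 0 1)))
    (hb : ∀ j, ∀ t ∈ Ico (0 : ℝ) 1, ‖b (Ω.curve j t)‖ = 1 ∧
      Tendsto (fun ν => f (Ω.normalPoint j t ν)) (𝓝[>] 0) (𝓝 (b (Ω.curve j t))))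
    (hq : DifferentiableOn ℂ q Ω.carrier) (hqf : ∀ z ∈ Ω.carrier, q z * f z = h z) :
    Ω.IsHardy q (b⁻¹ * u) := by
  obtain ⟨ε, hε⟩ := Ω.exists_isCollar
  obtain ⟨δ, hδ, hhalf⟩ := exists_norm_gt_near_boundary hmaps hproper (ρ := 1 / 2) (by norm_num)
  refine hh.mul (p := f⁻¹) hq (B := 2) (fun j => ?_) fun j t ht => ?_
  · filter_upwards [Ω.eventually_continuous_comp hf.continuousOn j, Ioo_mem_nhdsGT hε.pos,
      Ioo_mem_nhdsGT hδ] with ν hν hνε hνδ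
    have hin (t : ℝ) := hε.inside j t ν hνε.1 hνε.2.le
    have hgt (t : ℝ) : 1 / 2 < ‖f (Ω.normalPoint j t ν)‖ := by
      refine hhalf _ (hin t) ((Metric.infDist_le_dist_of_mem
        (Ω.curve_mem_frontier j t)).trans_lt ?_)
      rw [dist_eq_norm, norm_normalPoint_sub_curve, abs_of_pos hνδ.1]
      exact hνδ.2
    have hne (t : ℝ) : f (Ω.normalPoint j t ν) ≠ 0 := norm_pos_iff.1 (by linarith [hgt t])
    refine ⟨hν.inv₀ hne, fun t => ⟨?_, ?_⟩⟩
    · rw [Pi.inv_apply, norm_inv]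
      exact inv_le_of_inv_le₀ two_pos (by linarith [hgt t])
    · rw [Pi.inv_apply, ← hqf _ (hin t), mul_comm (q _), inv_mul_cancel_left₀ (hne t)]
  · refine (hb j t ht).2.inv₀ (norm_pos_iff.1 ?_)
    rw [(hb j t ht).1]
    exact one_pos

/-- Entire functions belong to the Hardy space. -/
theorem IsHardy.of_differentiable (Ω : SmoothDomain n) (hq : Differentiable ℂ q) :
    Ω.IsHardy q q := by
  obtain ⟨ε, hε⟩ := Ω.exists_isCollar
  have h1 : Ω.IsHardy 1 1 := ⟨differentiableOn_const 1, fun j => memLp_const 1, fun j => by simp⟩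
  obtain ⟨B, hB⟩ := Ω.isBounded.isCompact_closure.exists_bound_of_continuousOn
    hq.continuous.continuousOn
  have := h1.mul (p := q) (b := q) hq.differentiableOn (B := B) (fun j => ?_) fun j t _ => ?_
  · rwa [mul_one] at this
  · filter_upwards [Ioo_mem_nhdsGT hε.pos] with ν hν
    exact ⟨hε.continuous_comp j hq.continuous.continuousOn hν, fun t =>
      ⟨hB _ (subset_closure (hε.inside j t ν hν.1 hν.2.le)), (mul_one _).symm⟩⟩
  · have hc : Continuous fun ν : ℝ => q (Ω.normalPoint j t ν) :=
      hq.continuous.comp ((Ω.continuous_normalPoint j).comp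
        (by fun_prop : Continuous fun ν : ℝ => (t, ν)))
    have h0 := hc.tendsto 0
    rw [show Ω.normalPoint j t 0 = Ω.curve j t by simp [normalPoint]] at h0
    exact h0.mono_left nhdsWithin_le_nhds

/-- Multiplication by a unimodular boundary function is an isometry. -/
theorem weightedInner_mul_of_norm_eq_one
    (hb : ∀ j, ∀ t ∈ Ico (0 : ℝ) 1, ‖b (Ω.curve j t)‖ = 1) (φ : ℂ → ℝ) (u v : ℂ → ℂ) :
    Ω.weightedInner φ (b * u) (b * v) = Ω.weightedInner φ u v := by
  refine Finset.sum_congr rfl fun j _ => integral_congr_ae (Ω.ae_arcLength j fun t ht => ?_)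
  have h1 : b (Ω.curve j t) * conj (b (Ω.curve j t)) = 1 := by
    rw [Complex.mul_conj, Complex.normSq_eq_norm_sq, hb j t ht]
    simp
  simp only [Pi.mul_apply, map_mul]
  linear_combination u (Ω.curve j t) * conj (v (Ω.curve j t)) * φ (Ω.curve j t) * h1

theorem weightedInner_eq_zero_of_boundaryNorm (hu : Ω.MemL2 u) (h0 : Ω.boundaryNorm u = 0)
    (φ : ℂ → ℝ) (v : ℂ → ℂ) : Ω.weightedInner φ v u = 0 := by
  refine Finset.sum_eq_zero fun j hj => integral_eq_zero_of_ae ?_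
  have h1 := Finset.sum_eq_zero_iff.1 h0 j hj
  rw [eLpNorm_eq_zero_iff (hu j).aestronglyMeasurable two_ne_zero] at h1
  filter_upwards [h1] with t ht
  simp only [Pi.zero_apply] at ht ⊢
  rw [ht, map_zero, mul_zero, zero_mul]

end SmoothDomain

/-! ### The Gram matrix and the kernel formula -/

namespace SmoothDomain

variable {n N : ℕ} {Ω : SmoothDomain n} {φ : ℂ → ℝ} {K : ℂ → ℂ → ℂ}

theorem IsSzegoKernel.conj_symm (hK : Ω.IsSzegoKernel φ K) {z w : ℂ} (hz : z ∈ Ω.carrier)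
    (hw : w ∈ Ω.carrier) : conj (K z w) = K w z := by
  obtain ⟨k, hk, hk'⟩ := hK w hw
  obtain ⟨l, hl, hl'⟩ := hK z hz
  rw [hl' _ _ hk, conj_weightedInner, ← hk' _ _ hl]

/-- The Gram matrix of the kernel functions of distinct points is invertible: a linear combination
of them that vanishes at all the points is orthogonal to itself, so it is zero, and then all its
coefficients vanish since polynomials separate points. -/
theorem IsSzegoKernel.isUnit_det_gram (hφ : Ω.IsWeight φ) (hK : Ω.IsSzegoKernel φ K)
    {a : Fin N → ℂ} (ha : Function.Injective a) (haΩ : ∀ i, a i ∈ Ω.carrier) :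
    IsUnit (Matrix.of fun i j => K (a i) (a j)).det := by
  rw [isUnit_iff_ne_zero]
  intro hdet
  obtain ⟨v, hv, hAv⟩ := Matrix.exists_mulVec_eq_zero_iff.2 hdet
  choose k hk hrep using fun i => hK (a i) (haΩ i)
  have hH : Ω.IsHardy (∑ i, v i • fun z => K z (a i)) (∑ i, v i • k i) :=
    IsHardy.sum _ fun i _ => (hk i).const_smul (v i)
  have hinner (h u : ℂ → ℂ) (hh : Ω.IsHardy h u) :
      Ω.weightedInner φ u (∑ i, v i • k i) = ∑ i, conj (v i) * h (a i) := by
    rw [weightedInner_sum_right hφ hh.memL2 _ fun i _ => ((hk i).const_smul (v i)).memL2]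
    refine Finset.sum_congr rfl fun i _ => ?_
    rw [weightedInner_smul_right, ← hrep i h u hh]
  have h0 : Ω.weightedInner φ (∑ i, v i • k i) (∑ i, v i • k i) = 0 := by
    rw [hinner _ _ hH]
    refine Finset.sum_eq_zero fun i _ => ?_
    have h1 := congrFun hAv i
    simp only [Matrix.mulVec, dotProduct, Matrix.of_apply, Pi.zero_apply] at h1
    simp only [Finset.sum_apply, Pi.smul_apply, smul_eq_mul, mul_comm (v _), h1, mul_zero]
  have h1 := boundaryNorm_eq_zero_of_weightedInner_self hφ hH.memL2 h0
  refine hv (funext fun j => ?_)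
  have h2 := hinner _ _ (IsHardy.of_differentiable Ω
    (q := fun z => ∏ i ∈ Finset.univ.erase j, (z - a i)) (by fun_prop))
  rw [weightedInner_eq_zero_of_boundaryNorm hH.memL2 h1, Finset.sum_eq_single j] at h2
  · refine (map_eq_zero (starRingEnd ℂ)).1 ((mul_eq_zero.1 h2.symm).resolve_right ?_)
    exact Finset.prod_ne_zero_iff.2 fun i hi =>
      sub_ne_zero.2 fun h => (Finset.mem_erase.1 hi).1 (ha h).symm
  · intro i _ hij
    rw [Finset.prod_eq_zero (Finset.mem_erase.2 ⟨hij, Finset.mem_univ i⟩) (sub_self _), mul_zero]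
  · exact fun h => absurd (Finset.mem_univ j) h

/-- The function `σ(·, w) - conj (f w) f σ(·, w)` is orthogonal to `f H²(bΩ)`, and therefore a
linear combination of the kernel functions of the zeros of `f`: after subtraction of the combination
with the same values at the zeros it is divisible by `f`, hence orthogonal to itself. -/
theorem IsSzegoKernel.one_sub_mul_eq_sum (hφ : Ω.IsWeight φ) (hK : Ω.IsSzegoKernel φ K)
    {f : ℂ → ℂ} (hf : DifferentiableOn ℂ f Ω.carrier)
    (hmaps : MapsTo f Ω.carrier (Metric.ball 0 1))
    (hproper : IsProperMap (hmaps.restrict f Ω.carrier (Metric.ball 0 1)))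
    {a : Fin N → ℂ} (haΩ : ∀ i, a i ∈ Ω.carrier) (hfa : ∀ i, f (a i) = 0)
    (hzeros : ∀ z ∈ Ω.carrier, f z = 0 → ∃ i, a i = z) (hsimple : ∀ i, deriv f (a i) ≠ 0)
    {w : ℂ} (hw : w ∈ Ω.carrier) {d : Fin N → ℂ}
    (hd : ∀ m, ∑ i, d i * K (a m) (a i) = K (a m) w) {z : ℂ} (hz : z ∈ Ω.carrier) :
    (1 - f z * conj (f w)) * K z w = ∑ i, d i * K z (a i) := by
  obtain ⟨b, hb⟩ := exists_boundary_values hf hmaps hproper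
  choose k hk hrep using fun i => hK (a i) (haΩ i)
  obtain ⟨kw, hkw, hrepw⟩ := hK w hw
  have hfmul {h u : ℂ → ℂ} (hh : Ω.IsHardy h u) : Ω.IsHardy (f * h) (b * u) :=
    hh.mul_of_mapsTo_ball hf hmaps fun j t ht => (hb j t ht).2
  have hg := hkw.sub ((hfmul hkw).const_smul (conj (f w)))
  have horth {h u : ℂ → ℂ} (hh : Ω.IsHardy h u) :
      Ω.weightedInner φ (b * u) (kw - conj (f w) • (b * kw)) = 0 := by
    rw [weightedInner_sub_right hφ (hfmul hh).memL2 hkw.memL2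
      ((hfmul hkw).const_smul (conj (f w))).memL2, weightedInner_smul_right,
      weightedInner_mul_of_norm_eq_one (fun j t ht => (hb j t ht).1), ← hrepw _ _ (hfmul hh),
      ← hrepw _ _ hh, Complex.conj_conj, Pi.mul_apply, sub_self]
  have hS : Ω.IsHardy (∑ i, d i • fun z => K z (a i)) (∑ i, d i • k i) :=
    IsHardy.sum _ fun i _ => (hk i).const_smul (d i)
  have hv := hg.sub hS
  have hvz (x : ℂ) : ((fun z => K z w) - conj (f w) • (f * fun z => K z w) -
      ∑ i, d i • fun z => K z (a i)) x = (1 - f x * conj (f w)) * K x w -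
        ∑ i, d i * K x (a i) := by
    simp only [Pi.sub_apply, Pi.smul_apply, Pi.mul_apply, Finset.sum_apply, smul_eq_mul]
    ring
  obtain ⟨q, hq, hqf⟩ := exists_mul_eq_of_simple_zeros Ω.isOpen hf hv.holomorphic
    (fun x hx h0 => by obtain ⟨i, rfl⟩ := hzeros x hx h0; exact hsimple i)
    (fun x hx h0 => by
      obtain ⟨i, rfl⟩ := hzeros x hx h0
      rw [hvz, hd, h0, zero_mul, sub_zero, one_mul, sub_self])
  have hqH := hv.of_mul_eq hf hmaps hproper hb hq hqf
  have hsum : ∑ i, Ω.weightedInner φ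
      (b * (b⁻¹ * (kw - conj (f w) • (b * kw) - ∑ i, d i • k i))) (d i • k i) = 0 :=
    Finset.sum_eq_zero fun i _ => by
      rw [weightedInner_smul_right, ← hrep i _ _ (hfmul hqH), Pi.mul_apply, hfa, zero_mul, mul_zero]
  have hself := weightedInner_sub_right hφ (hfmul hqH).memL2 hg.memL2 hS.memL2
  rw [horth hqH, weightedInner_sum_right hφ (hfmul hqH).memL2 _
    fun i _ => ((hk i).const_smul (d i)).memL2, hsum, sub_zero] at hself
  have h0 := boundaryNorm_eq_zero_of_weightedInner_self hφ hv.memL2 (by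
    rw [← hself]
    refine Finset.sum_congr rfl fun j _ => integral_congr_ae (Ω.ae_arcLength j fun t ht => ?_)
    have hne : b (Ω.curve j t) ≠ 0 := norm_pos_iff.1 (by rw [(hb j t ht).1]; exact one_pos)
    simp only [Pi.mul_apply, Pi.inv_apply, mul_inv_cancel_left₀ hne])
  have h1 := hv.eq_zero_of_boundaryNorm h0 hz
  rw [hvz] at h1
  exact sub_eq_zero.1 h1

end SmoothDomain

theorem theorem8p2 {n N : ℕ} (Ω : SmoothDomain n)
    (φ : ℂ → ℝ) (hφ : Ω.IsWeight φ)
    (f : ℂ → ℂ) (hf : DifferentiableOn ℂ f Ω.carrier)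
    (hmaps : MapsTo f Ω.carrier (Metric.ball 0 1))
    (hproper : IsProperMap (hmaps.restrict f Ω.carrier (Metric.ball 0 1)))
    (honto : SurjOn f Ω.carrier (Metric.ball 0 1))
    (a : Fin N → ℂ) (ha : Function.Injective a)
    (hzeros : range a = {z | z ∈ Ω.carrier ∧ f z = 0})
    (hsimple : ∀ i, deriv f (a i) ≠ 0) :
    let σ := Ω.szegoKernel φ
    let A : Matrix (Fin N) (Fin N) ℂ := Matrix.of fun k j => σ (a k) (a j)
    IsUnit A.det ∧
      ∀ z ∈ Ω.carrier, ∀ w ∈ Ω.carrier,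
        σ z w = 1 / (1 - f z * conj (f w)) *
          ∑ i, ∑ j, A⁻¹ i j * σ z (a i) * conj (σ w (a j)) := by
  intro σ A
  have hK : Ω.IsSzegoKernel φ σ := SmoothDomain.isSzegoKernel_szegoKernel hφ
  have haz (i : Fin N) : a i ∈ Ω.carrier ∧ f (a i) = 0 := hzeros.subset (mem_range_self i)
  have hA : IsUnit A.det := hK.isUnit_det_gram hφ ha fun i => (haz i).1
  refine ⟨hA, fun z hz w hw => ?_⟩
  have hd (m : Fin N) :
      ∑ i, (A⁻¹.mulVec fun j => conj (σ w (a j))) i * σ (a m) (a i) = σ (a m) w := by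
    have h1 : A.mulVec (A⁻¹.mulVec fun j => conj (σ w (a j))) = fun j => conj (σ w (a j)) := by
      rw [Matrix.mulVec_mulVec, Matrix.mul_nonsing_inv A hA, Matrix.one_mulVec]
    rw [← hK.conj_symm hw (haz m).1, ← congrFun h1 m]
    exact Finset.sum_congr rfl fun i _ => mul_comm _ _
  have key := hK.one_sub_mul_eq_sum hφ hf hmaps hproper (fun i => (haz i).1) (fun i => (haz i).2)
    (fun x hx h0 => hzeros.superset ⟨hx, h0⟩) hsimple hw hd hz
  have hne : 1 - f z * conj (f w) ≠ 0 := by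
    intro h0
    have h1 : ‖f z‖ * ‖f w‖ = 1 := by
      rw [← Complex.norm_conj (f w), ← norm_mul, ← sub_eq_zero.1 h0, norm_one]
    have h2 := mem_ball_zero_iff.1 (hmaps hz)
    have h3 := mem_ball_zero_iff.1 (hmaps hw)
    nlinarith [norm_nonneg (f z), norm_nonneg (f w)]
  rw [one_div, eq_inv_mul_iff_mul_eq₀ hne, key]
  refine Finset.sum_congr rfl fun i _ => ?_
  rw [Matrix.mulVec, dotProduct, Finset.sum_mul]
  exact Finset.sum_congr rfl fun j _ => by ring
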